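/- Let $n\ge 1$, $\alpha\in(0,1)$ and $p\in[1,\infty)$; all functions and distributions are real-valued. For $\varphi\in C_c^\infty(\mathbb R^n;\mathbb R^n)$ let $$\mathrm{div}^\alpha\varphi(x)=\mu_{n,\alpha}\int_{\mathbb R^n}\frac{(y-x)\cdot(\varphi(y)-\varphi(x))}{|y-x|^{n+\alpha+1}}\,dy,\qquad \mu_{n,\alpha}=2^\alpha\pi^{-\frac n2}\,\frac{\Gamma\left(\frac{n+\alpha+1}2\right)}{\Gamma\left(\frac{1-\alpha}2\right)}.$$ The weak fractional $\alpha$-gradient of $f\in L^p(\mathbb R^n)$ is the (a.e. unique) function $\nabla^\alpha f\in L^1_{\mathrm{loc}}(\mathbb R^n;\mathbb R^n)$, if it exists, such that $\int_{\mathbb R^n} f\,\mathrm{div}^\alpha\varphi\,dx=-\int_{\mathbb R^n}\nabla^\alpha f\cdot\varphi\,dx$ for all $\varphi\in C_c^\infty(\mathbb R^n;\mathbb R^n)$. The distributional fractional Sobolev space is $$S^{\alpha,p}(\mathbb R^n)=\{f\in L^p(\mathbb R^n):\ \nabla^\alpha f \text{ exists and } \nabla^\alpha f\in L^p(\mathbb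 R^n;\mathbb R^n)\},\qquad \|f\|_{S^{\alpha,p}}=\|f\|_{L^p}+\|\nabla^\alpha f\|_{L^p}.$$ Then: (i) $C_c^\infty(\mathbb R^n)$ is a dense subset of $\bigl(S^{\alpha,p}(\mathbb R^n),\|\cdot\|_{S^{\alpha,p}}\bigr)$. (ii) If $p\in(1,\infty)$, then $S^{\alpha,p}(\mathbb R^n)$ coincides, with equivalent norms, with the Bessel potential space $$L^{\alpha,p}(\mathbb R^n)=\{f\in\mathcal S'(\mathbb R^n):\ (\mathrm{Id}-\Delta)^{\frac\alpha2}f\in L^p(\mathbb R^n)\},\qquad \|f\|_{L^{\alpha,p}}=\|(\mathrm{Id}-\Delta)^{\frac\alpha2}f\|_{L^p},$$ where functions in $L^p(\mathbb R^n)$ are identified with tempered distributions. -/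

import Mathlib

open MeasureTheory
open scoped ENNReal ContDiff SchwartzMap

namespace FracSobolev

/-- The Euclidean space `ℝⁿ`. -/
abbrev Rn (n : ℕ) : Type := EuclideanSpace ℝ (Fin n)

/-- The constant `μ_{n,α} = 2^α π^{-n/2} Γ((n+α+1)/2) / Γ((1-α)/2)`. -/
noncomputable def muConst (n : ℕ) (α : ℝ) : ℝ :=
  (2 : ℝ) ^ α * Real.pi ^ (-(n : ℝ) / 2) *
    (Real.Gamma (((n : ℝ) + α + 1) / 2) / Real.Gamma ((1 - α) / 2))

/-- The fractional `α`-divergence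
`div^α φ (x) = μ_{n,α} ∫ (y - x) · (φ(y) - φ(x)) / |y - x|^{n+α+1} dy`. For `α ∈ (0,1)` the integral
converges absolutely when `φ` is Lipschitz and bounded. -/
noncomputable def fracDiv {n : ℕ} (α : ℝ) (φ : Rn n → Rn n) (x : Rn n) : ℝ :=
  muConst n α * ∫ y, inner ℝ (y - x) (φ y - φ x) / ‖y - x‖ ^ ((n : ℝ) + α + 1)

/-- `g ∈ L¹_loc(ℝⁿ; ℝⁿ)` is a weak fractional `α`-gradient of `f`:
`∫ f div^α φ dx = - ∫ g · φ dx` for all `φ ∈ C_c^∞(ℝⁿ; ℝⁿ)`. -/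
def IsWeakFracGrad {n : ℕ} (α : ℝ) (f : Rn n → ℝ) (g : Rn n → Rn n) : Prop :=
  LocallyIntegrable g ∧
    ∀ φ : Rn n → Rn n, ContDiff ℝ ∞ φ → HasCompactSupport φ →
      ∫ x, f x * fracDiv α φ x = - ∫ x, inner ℝ (g x) (φ x)

/-- Weak fractional gradients are unique up to null sets. -/
theorem IsWeakFracGrad.ae_eq {n : ℕ} {α : ℝ} {f : Rn n → ℝ} {g₁ g₂ : Rn n → Rn n}
    (h₁ : IsWeakFracGrad α f g₁) (h₂ : IsWeakFracGrad α f g₂) : g₁ =ᵐ[volume] g₂ := by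
  refine ae_eq_of_integral_contDiff_smul_eq h₁.1 h₂.1 fun ψ hψ hψc => ?_
  have int : ∀ g : Rn n → Rn n, LocallyIntegrable g → Integrable (fun x => ψ x • g x) :=
    fun g hg => hg.integrable_smul_left_of_hasCompactSupport hψ.continuous hψc
  refine ext_inner_right ℝ fun v => ?_
  have key : ∀ g : Rn n → Rn n, LocallyIntegrable g →
      inner ℝ (∫ x, ψ x • g x) v = ∫ x, inner ℝ (g x) (ψ x • v) := by
    intro g hg
    rw [real_inner_comm, ← integral_inner (int g hg)]
    refine integral_congr_ae (Filter.Eventually.of_forall fun x => ?_)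
    simp only [real_inner_smul_right, real_inner_comm v]
  have e₁ := h₁.2 (fun x => ψ x • v) (hψ.smul contDiff_const) hψc.smul_right
  have e₂ := h₂.2 (fun x => ψ x • v) (hψ.smul contDiff_const) hψc.smul_right
  rw [key g₁ h₁.1, key g₂ h₂.1]
  linarith

/-- The distributional fractional Sobolev space
`S^{α,p}(ℝⁿ) = {f ∈ L^p(ℝⁿ) : ∃ ∇^α f ∈ L^p(ℝⁿ; ℝⁿ)}`. -/
def S (n : ℕ) (α : ℝ) (p : ℝ≥0∞) : Set (Lp ℝ p (volume : Measure (Rn n))) :=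
  {f | ∃ g : Lp (Rn n) p (volume : Measure (Rn n)), IsWeakFracGrad α f g}

open Classical in
/-- The weak fractional gradient `∇^α f ∈ L^p(ℝⁿ; ℝⁿ)` of `f ∈ S^{α,p}(ℝⁿ)` (and `0` for
`f ∉ S^{α,p}(ℝⁿ)`). -/
noncomputable def weakFracGrad {n : ℕ} (α : ℝ) {p : ℝ≥0∞}
    (f : Lp ℝ p (volume : Measure (Rn n))) : Lp (Rn n) p (volume : Measure (Rn n)) :=
  if h : ∃ g : Lp (Rn n) p (volume : Measure (Rn n)), IsWeakFracGrad α f g then h.choose else 0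

/-- `weakFracGrad` is the one weak fractional gradient in `L^p`. -/
theorem weakFracGrad_eq {n : ℕ} {α : ℝ} {p : ℝ≥0∞} {f : Lp ℝ p (volume : Measure (Rn n))}
    {g : Lp (Rn n) p (volume : Measure (Rn n))} (h : IsWeakFracGrad α f g) :
    weakFracGrad α f = g := by
  have hex : ∃ g : Lp (Rn n) p (volume : Measure (Rn n)), IsWeakFracGrad α f g := ⟨g, h⟩
  rw [weakFracGrad, dif_pos hex]
  exact Lp.ext (hex.choose_spec.ae_eq h)

/-- The norm `‖f‖_{S^{α,p}} = ‖f‖_{L^p} + ‖∇^α f‖_{L^p}`. -/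
noncomputable def normS {n : ℕ} (α : ℝ) {p : ℝ≥0∞} (f : Lp ℝ p (volume : Measure (Rn n))) : ℝ :=
  ‖f‖ + ‖weakFracGrad α f‖

/-- The classes in `L^p(ℝⁿ)` of the functions in `C_c^∞(ℝⁿ)`. -/
def testFunctions (n : ℕ) (p : ℝ≥0∞) : Set (Lp ℝ p (volume : Measure (Rn n))) :=
  {u | ∃ v : Rn n → ℝ, ContDiff ℝ ∞ v ∧ HasCompactSupport v ∧ u =ᵐ[volume] v}

/-- The tempered distribution `φ ↦ ∫ φ f dx` of a real-valued `f ∈ L^p(ℝⁿ)`. -/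
noncomputable def toDistribution {n : ℕ} {p : ℝ≥0∞} [Fact (1 ≤ p)]
    (f : Lp ℝ p (volume : Measure (Rn n))) : 𝓢'(Rn n, ℂ) :=
  Lp.toTemperedDistribution (Complex.ofRealCLM.compLp f)

/-- The operator `(Id - Δ)^{s/2}` on tempered distributions. The Fourier transform here is
`𝓕 f (ξ) = ∫ e^{-2πi x·ξ} f(x) dx`, so that its symbol is `(1 + |2πξ|²)^{s/2}`. -/
noncomputable def besselOp (n : ℕ) (s : ℝ) : 𝓢'(Rn n, ℂ) →L[ℂ] 𝓢'(Rn n, ℂ) :=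
  TemperedDistribution.fourierMultiplierCLM ℂ
    (fun ξ : Rn n => (((1 + ‖(2 * Real.pi) • ξ‖ ^ 2) ^ (s / 2) : ℝ) : ℂ))

/-- A tempered distribution is real if it takes real values on real-valued Schwartz functions. -/
def IsRealDistribution {n : ℕ} (T : 𝓢'(Rn n, ℂ)) : Prop :=
  ∀ φ : 𝓢(Rn n, ℂ), (∀ x, (φ x).im = 0) → (T φ).im = 0

/-- The Bessel potential space
`L^{α,p}(ℝⁿ) = {T ∈ 𝓢'(ℝⁿ) : (Id - Δ)^{α/2} T ∈ L^p(ℝⁿ)}` of real tempered distributions. -/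
def besselSpace (n : ℕ) (α : ℝ) (p : ℝ≥0∞) [Fact (1 ≤ p)] : Set 𝓢'(Rn n, ℂ) :=
  {T | IsRealDistribution T ∧
    ∃ g : Lp ℝ p (volume : Measure (Rn n)), besselOp n α T = toDistribution g}

open Classical in
/-- The norm `‖T‖_{L^{α,p}} = ‖(Id - Δ)^{α/2} T‖_{L^p}` of `T ∈ L^{α,p}(ℝⁿ)`. -/
noncomputable def besselNorm {n : ℕ} (α : ℝ) (p : ℝ≥0∞) [Fact (1 ≤ p)] (T : 𝓢'(Rn n, ℂ)) : ℝ :=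
  if h : ∃ g : Lp ℝ p (volume : Measure (Rn n)), besselOp n α T = toDistribution g
    then ‖h.choose‖ else 0

end FracSobolev

/-! Density in `S^{α,p}` uses mollification followed by truncation. The operator `div^α` commutes
with translations, so mollification commutes with `∇^α` (`IsWeakFracGrad.mollify`). Truncation rests
on the Leibniz rule `∇^α(η f) = η ∇^α f + μ ∫ (η(x+h) - η(x)) f(x+h) h / |h|^{n+α+1} dh`
(`IsWeakFracGrad.schwartz_mul`). When `η` is a cutoff at scale `R`, Young's inequality bounds the
commutator in `L^p` by `‖f‖_p` times a multiple of the mass of `min(1, |h|/R) / |h|^{n+α}`. This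
mass tends to `0` as `R → ∞` by dominated convergence, and the argument works for all `1 ≤ p < ∞`.

For the comparison with the Bessel space, the two norms are first shown equivalent on Schwartz
functions (`exists_schwartz_norm_equiv`). There `∇^α` has Fourier symbol `i (ξ/|ξ|) |2πξ|^α`
(`ft_inner_fracGrad`), so it is the vector of Riesz transforms applied to `(-Δ)^{α/2}`, up to sign.
Conversely `(-Δ)^{α/2}` is recovered from `∇^α` because `∑ (ξ_j/|ξ|)² = 1`. The functions
`(1+|2πξ|²)^{-α/2}` and `(1+|2πξ|²)^{α/2} - |2πξ|^α` are Fourier transforms of `L¹` functions, being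
mixtures of Gaussians. Hence `(Id-Δ)^{α/2} f` controls `f`, and it differs from `(-Δ)^{α/2} f` by a
term controlled by `f`.

What remains is the `L^p` boundedness of the Riesz transforms (`exists_norm_riesz_pairing_le`),
obtained by the method of rotations: a Riesz transform is an average, with weight `⟨a,v⟩
e^{-π|v|²}`, of Hilbert transforms along the lines parallel to `v`. The one-dimensional bound for `1
< p ≤ 2` is the complex-variable proof of M. Riesz: for `f ≥ 0` the Cauchy integral `F` has positive
real part, `∫ F^p = 0` on horizontal lines, and `|F|^p ≤ A (Re F)^p - B Re F^p`. The range `p ≥ 2`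
follows by duality.

The equivalence passes to the full spaces by completion: Schwartz functions are dense on both sides,
`∇^α` is closed in `L^p`, and `(Id-Δ)^{α/2}` is continuous and injective on tempered distributions.
-/

namespace FracSobolev

open Filter Topology
open scoped Convolution FourierTransform RealInnerProductSpace

/-! ### Young's inequality `L¹ * L^p ⊂ L^p`. -/

section Young

variable {G : Type*} [AddCommGroup G] [MeasurableSpace G] [MeasurableAdd₂ G] [MeasurableNeg G]
  {μ : Measure G} [SFinite μ] [μ.IsAddLeftInvariant]

/-- Jensen's inequality for the weight `K`. -/
theorem lintegral_mul_rpow_le {X : Type*} [MeasurableSpace X] {ν : Measure X} {p : ℝ} (hp : 1 ≤ p)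
    {K F : X → ℝ≥0∞} (hK : AEMeasurable K ν) (hF : AEMeasurable F ν) :
    (∫⁻ y, K y * F y ∂ν) ^ p ≤ (∫⁻ y, K y ∂ν) ^ (p - 1) * ∫⁻ y, K y * F y ^ p ∂ν := by
  have hp0 : 0 < p := by linarith
  have h1 : 0 ≤ 1 - p⁻¹ := by
    have := inv_le_one_of_one_le₀ hp
    linarith
  -- Hölder with exponents `1 - 1/p` and `1/p` for `K F = K^{1-1/p} (K F^p)^{1/p}`. Both exponents
  -- are nonnegative, so the factorization is valid at the values `0` and `∞` as well.
  have h := ENNReal.lintegral_mul_norm_pow_le hK (hK.mul (hF.pow_const p)) h1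
    (inv_nonneg.2 hp0.le) (by ring)
  have e : ∀ y, K y ^ (1 - p⁻¹) * (K y * F y ^ p) ^ p⁻¹ = K y * F y := by
    intro y
    rw [ENNReal.mul_rpow_of_nonneg _ _ (inv_nonneg.2 hp0.le), ← mul_assoc,
      ← ENNReal.rpow_add_of_nonneg _ _ h1 (inv_nonneg.2 hp0.le), ← ENNReal.rpow_mul,
      mul_inv_cancel₀ hp0.ne']
    simp
  simp only [Pi.mul_apply, e] at h
  refine (ENNReal.rpow_le_rpow h hp0.le).trans (le_of_eq ?_)
  rw [ENNReal.mul_rpow_of_nonneg _ _ hp0.le, ← ENNReal.rpow_mul, ← ENNReal.rpow_mul,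
    inv_mul_cancel₀ hp0.ne', ENNReal.rpow_one, sub_mul, inv_mul_cancel₀ hp0.ne', one_mul]

/-- Jensen in `y` for the weight `K`, then Tonelli and translation invariance. Passing to measurable
representatives first makes Tonelli applicable; for `F` this is legitimate because `y ↦ x - y`
preserves null sets. -/
theorem lintegral_conv_rpow_le {p : ℝ} (hp : 1 ≤ p)
    {K F : G → ℝ≥0∞} (hK : AEMeasurable K μ) (hF : AEMeasurable F μ) :
    ∫⁻ x, (∫⁻ y, K y * F (x - y) ∂μ) ^ p ∂μ ≤ (∫⁻ y, K y ∂μ) ^ p * ∫⁻ x, F x ^ p ∂μ := by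
  have hp0 : 0 < p := by linarith
  wlog hKm : Measurable K generalizing K
  · have := this hK.measurable_mk.aemeasurable hK.measurable_mk
    rw [← lintegral_congr_ae hK.ae_eq_mk] at this
    convert this using 3 with x
    congr 1
    refine lintegral_congr_ae ?_
    filter_upwards [hK.ae_eq_mk] with y hy
    rw [hy]
  wlog hFm : Measurable F generalizing F
  · have := this hF.measurable_mk.aemeasurable hF.measurable_mk
    have e : ∫⁻ x, F x ^ p ∂μ = ∫⁻ x, hF.mk F x ^ p ∂μ :=
      lintegral_congr_ae (by filter_upwards [hF.ae_eq_mk] with x hx; rw [hx])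
    rw [e]
    refine le_trans (le_of_eq ?_) this
    refine lintegral_congr fun x => ?_
    congr 1
    refine lintegral_congr_ae ?_
    have := (quasiMeasurePreserving_sub_left μ x).ae_eq_comp hF.ae_eq_mk
    filter_upwards [this] with y hy
    simp only [Function.comp_apply] at hy
    rw [hy]
  have hm : Measurable fun z : G × G => K z.2 * F (z.1 - z.2) ^ p := by fun_prop
  calc ∫⁻ x, (∫⁻ y, K y * F (x - y) ∂μ) ^ p ∂μ
      ≤ ∫⁻ x, (∫⁻ y, K y ∂μ) ^ (p - 1) * ∫⁻ y, K y * F (x - y) ^ p ∂μ ∂μ :=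
        lintegral_mono fun x => lintegral_mul_rpow_le hp hK
          (hFm.comp (measurable_const.sub measurable_id)).aemeasurable
    _ = (∫⁻ y, K y ∂μ) ^ (p - 1) * ∫⁻ x, ∫⁻ y, K y * F (x - y) ^ p ∂μ ∂μ :=
        lintegral_const_mul _ hm.lintegral_prod_right'
    _ = (∫⁻ y, K y ∂μ) ^ (p - 1) * ∫⁻ y, ∫⁻ x, K y * F (x - y) ^ p ∂μ ∂μ := by
        rw [lintegral_lintegral_swap hm.aemeasurable]
    _ = (∫⁻ y, K y ∂μ) ^ (p - 1) * ((∫⁻ y, K y ∂μ) * ∫⁻ x, F x ^ p ∂μ) := by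
        congr 1
        rw [← lintegral_mul_const _ hKm]
        refine lintegral_congr fun y => ?_
        have : Measurable fun x => F (x - y) ^ p := by fun_prop
        rw [lintegral_const_mul _ this]
        congr 1
        exact lintegral_sub_right_eq_self (fun x => F x ^ p) y
    _ = _ := by
        rw [← mul_assoc]
        congr 1
        nth_rewrite 2 [← ENNReal.rpow_one (∫⁻ y, K y ∂μ)]
        rw [← ENNReal.rpow_add_of_nonneg _ _ (by linarith) zero_le_one]
        simp

/-- Young's inequality: a function dominated by the convolution of `K` with `‖f‖` is bounded in
`L^p` by the mass of `K` times the `L^p` norm of `f`. -/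
theorem eLpNorm_le_of_conv_bound {F₁ F₂ : Type*} [NormedAddCommGroup F₁] [NormedAddCommGroup F₂]
    {p : ℝ≥0∞} (hp1 : 1 ≤ p) (hp : p ≠ ⊤) {K : G → ℝ≥0∞} (hK : AEMeasurable K μ)
    {f : G → F₁} (hf : AEStronglyMeasurable f μ) {h : G → F₂}
    (hh : ∀ᵐ x ∂μ, ‖h x‖ₑ ≤ ∫⁻ y, K y * ‖f (x - y)‖ₑ ∂μ) :
    eLpNorm h p μ ≤ (∫⁻ y, K y ∂μ) * eLpNorm f p μ := by
  have hp0 : p ≠ 0 := (zero_lt_one.trans_le hp1).ne'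
  have hpr : 0 < p.toReal := ENNReal.toReal_pos hp0 hp
  have hpr1 : 1 ≤ p.toReal := by simpa using ENNReal.toReal_mono hp hp1
  rw [eLpNorm_eq_lintegral_rpow_enorm_toReal hp0 hp, eLpNorm_eq_lintegral_rpow_enorm_toReal hp0 hp]
  calc (∫⁻ x, ‖h x‖ₑ ^ p.toReal ∂μ) ^ (1 / p.toReal)
      ≤ ((∫⁻ y, K y ∂μ) ^ p.toReal * ∫⁻ x, ‖f x‖ₑ ^ p.toReal ∂μ) ^ (1 / p.toReal) := by
        refine ENNReal.rpow_le_rpow ?_ (by positivity)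
        refine le_trans (lintegral_mono_ae ?_) (lintegral_conv_rpow_le hpr1 hK hf.enorm)
        filter_upwards [hh] with x hx
        exact ENNReal.rpow_le_rpow hx hpr.le
    _ = _ := by
        rw [ENNReal.mul_rpow_of_nonneg _ _ (by positivity), ← ENNReal.rpow_mul,
          mul_one_div_cancel hpr.ne', ENNReal.rpow_one]

end Young

/-! ### Hölder bounds and the Fubini hypothesis for correlations. -/

section Holder

variable {n : ℕ}

theorem memLp_of_integrable_of_bound {X F : Type*} [MeasurableSpace X] {μ : Measure X}
    [NormedAddCommGroup F] {f : X → F} (hf : Integrable f μ) {C : ℝ} (hC : ∀ x, ‖f x‖ ≤ C)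
    {p : ℝ≥0∞} (hp : 1 ≤ p) : MemLp f p μ := by
  rcases eq_or_ne p ⊤ with rfl | hpt
  · exact memLp_top_of_bound hf.1 C (Eventually.of_forall hC)
  have hp0 : p ≠ 0 := (zero_lt_one.trans_le hp).ne'
  have hpr1 : 1 ≤ p.toReal := by simpa using ENNReal.toReal_mono hpt hp
  rw [← integrable_norm_rpow_iff hf.1 hp0 hpt]
  have h1 : Integrable (fun x => C ^ (p.toReal - 1) * ‖f x‖) μ := hf.norm.const_mul _
  refine h1.mono' ((hf.1.norm.aemeasurable.pow_const _).aestronglyMeasurable)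
    (Eventually.of_forall fun x => ?_)
  rw [Real.norm_of_nonneg (by positivity)]
  rcases (norm_nonneg (f x)).eq_or_lt with h0 | h0
  · rw [← h0, Real.zero_rpow (by linarith)]
    simp
  · calc ‖f x‖ ^ p.toReal = ‖f x‖ ^ (p.toReal - 1) * ‖f x‖ := by
          rw [Real.rpow_sub_one h0.ne']; field_simp
      _ ≤ _ := by
          gcongr
          exact hC x

/-- The source of the Fubini hypotheses for integrals involving `L^p` functions: Hölder bounds `∫
|f(x) g(x+y)| dx` by `‖f‖_p ‖g‖_q` uniformly in `y`, and `k` is integrable in `y`. -/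
theorem integrable_prod_of_holder {p q : ℝ≥0∞} (hpq : p.HolderConjugate q)
    {k f g : Rn n → ℝ} (hk : Integrable k) (hf : MemLp f p) (hg : MemLp g q) :
    Integrable (fun z : Rn n × Rn n => k z.2 * (f z.1 * g (z.1 + z.2))) (volume.prod volume) := by
  have hgm : AEStronglyMeasurable (fun z : Rn n × Rn n => g (z.1 + z.2)) (volume.prod volume) := by
    have : Measure.QuasiMeasurePreserving (fun z : Rn n × Rn n => z.1 + z.2)
        (volume.prod volume) volume :=
      quasiMeasurePreserving_add _ _
    exact hg.1.comp_quasiMeasurePreserving this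
  have hmeas : AEStronglyMeasurable (fun z : Rn n × Rn n => k z.2 * (f z.1 * g (z.1 + z.2)))
      (volume.prod volume) := hk.1.comp_snd.mul (hf.1.comp_fst.mul hgm)
  have htr : ∀ y : Rn n, MemLp (fun x => g (x + y)) q :=
    fun y => hg.comp_measurePreserving (measurePreserving_add_right volume y)
  have hfg : ∀ y : Rn n, Integrable (fun x => f x * g (x + y)) := fun y =>
    memLp_one_iff_integrable.1 ((htr y).mul hf)
  rw [integrable_prod_iff' hmeas]
  refine ⟨Eventually.of_forall fun y => (hfg y).const_mul (k y), ?_⟩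
  have hbound : ∀ y : Rn n, ∫ x, ‖k y * (f x * g (x + y))‖ ≤
      (eLpNorm f p volume * eLpNorm g q volume).toReal * ‖k y‖ := by
    intro y
    simp_rw [norm_mul (k y)]
    rw [integral_const_mul, mul_comm]
    gcongr
    rw [integral_norm_eq_lintegral_enorm (hfg y).1]
    refine ENNReal.toReal_mono (ENNReal.mul_ne_top hf.2.ne hg.2.ne) ?_
    rw [← eLpNorm_one_eq_lintegral_enorm]
    refine (eLpNorm_smul_le_mul_eLpNorm (p := p) (q := q) (r := 1) (φ := f) (htr y).1 hf.1).trans (le_of_eq ?_)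
    congr 1
    exact eLpNorm_comp_measurePreserving hg.1 (measurePreserving_add_right volume y)
  refine (hk.norm.const_mul (eLpNorm f p volume * eLpNorm g q volume).toReal).mono'
    ?_ (Eventually.of_forall fun y => ?_)
  · exact hmeas.norm.prod_swap.integral_prod_right'
  · rw [Real.norm_of_nonneg (integral_nonneg fun x => norm_nonneg _)]
    exact hbound y

theorem integrable_mul_of_holder {X : Type*} [MeasurableSpace X] {μ : Measure X}
    {p q : ℝ≥0∞} (hpq : p.HolderConjugate q) {f g : X → ℝ} (hf : MemLp f p μ) (hg : MemLp g q μ) :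
    Integrable (fun x => f x * g x) μ :=
  memLp_one_iff_integrable.1 (hg.mul hf)

theorem norm_integral_mul_le_of_memLp {X : Type*} [MeasurableSpace X] {μ : Measure X}
    {p q : ℝ≥0∞} (hpq : p.HolderConjugate q) {f g : X → ℝ} (hf : MemLp f p μ) (hg : MemLp g q μ) :
    ‖∫ x, f x * g x ∂μ‖ ≤ (eLpNorm f p μ).toReal * (eLpNorm g q μ).toReal := by
  have hfg := integrable_mul_of_holder hpq hf hg
  refine (norm_integral_le_integral_norm _).trans ?_
  rw [integral_norm_eq_lintegral_enorm hfg.1, ← ENNReal.toReal_mul]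
  refine ENNReal.toReal_mono (ENNReal.mul_ne_top hf.2.ne hg.2.ne) ?_
  rw [← eLpNorm_one_eq_lintegral_enorm]
  exact eLpNorm_smul_le_mul_eLpNorm (p := p) (q := q) (r := 1) (φ := f) hg.1 hf.1

end Holder

/-! ### Mollification in `L^p`. -/

section Mollify

variable {n : ℕ} {F : Type*} [NormedAddCommGroup F] [NormedSpace ℝ F]

/-- The mollification of `f` by the normalized bump function `ρ`. -/
noncomputable def mollify (ρ : ContDiffBump (0 : Rn n)) (f : Rn n → F) : Rn n → F :=
  (ρ.normed volume) ⋆[ContinuousLinearMap.lsmul ℝ ℝ, volume] f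

theorem mollify_apply (ρ : ContDiffBump (0 : Rn n)) (f : Rn n → F) (x : Rn n) :
    mollify ρ f x = ∫ t, ρ.normed volume t • f (x - t) := rfl

theorem mollify_sub (ρ : ContDiffBump (0 : Rn n)) {f g : Rn n → F} (hf : LocallyIntegrable f)
    (hg : LocallyIntegrable g) : mollify ρ (f - g) = mollify ρ f - mollify ρ g := by
  have hex : ∀ f : Rn n → F, LocallyIntegrable f → ConvolutionExists (ρ.normed volume) f
      (ContinuousLinearMap.lsmul ℝ ℝ) volume := fun f hf =>
    ρ.hasCompactSupport_normed.convolutionExists_left _ ρ.continuous_normed hf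
  ext x
  simp only [mollify_apply, Pi.sub_apply, smul_sub]
  exact integral_sub (hex f hf x) (hex g hg x)

theorem contDiff_mollify (ρ : ContDiffBump (0 : Rn n)) {f : Rn n → F} (hf : LocallyIntegrable f) :
    ContDiff ℝ ∞ (mollify ρ f) :=
  ρ.hasCompactSupport_normed.contDiff_convolution_left _ ρ.contDiff_normed hf

theorem eLpNorm_mollify_le (ρ : ContDiffBump (0 : Rn n)) {p : ℝ≥0∞} (hp1 : 1 ≤ p) (hp : p ≠ ⊤)
    {f : Rn n → F} (hf : AEStronglyMeasurable f) :
    eLpNorm (mollify ρ f) p volume ≤ eLpNorm f p volume := by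
  have hK : ∫⁻ y, ‖ρ.normed volume y‖ₑ = 1 := by
    have h := ofReal_integral_eq_lintegral_ofReal (ρ.integrable_normed (μ := volume))
      (Eventually.of_forall ρ.nonneg_normed)
    rw [ρ.integral_normed, ENNReal.ofReal_one] at h
    rw [h]
    exact lintegral_congr fun y => Real.enorm_eq_ofReal (ρ.nonneg_normed y)
  have := eLpNorm_le_of_conv_bound (μ := volume) (h := mollify ρ f) hp1 hp
    ρ.continuous_normed.aestronglyMeasurable.enorm hf
    (Eventually.of_forall fun x => (enorm_integral_le_lintegral_enorm _).trans
      (le_of_eq (lintegral_congr fun y => enorm_smul _ _)))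
  rwa [hK, one_mul] at this

theorem memLp_mollify (ρ : ContDiffBump (0 : Rn n)) {p : ℝ≥0∞} (hp1 : 1 ≤ p) (hp : p ≠ ⊤)
    {f : Rn n → F} (hf : MemLp f p) : MemLp (mollify ρ f) p :=
  ⟨(contDiff_mollify ρ (hf.locallyIntegrable hp1)).continuous.aestronglyMeasurable,
    (eLpNorm_mollify_le ρ hp1 hp hf.1).trans_lt hf.2⟩

theorem exists_eLpNorm_mollify_sub_le_of_hasCompactSupport [CompleteSpace F] {p : ℝ≥0∞} (hp : p ≠ ⊤)
    {g : Rn n → F} (hg : Continuous g) (hgc : HasCompactSupport g) {ε : ℝ} (hε : 0 < ε) :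
    ∃ δ > 0, ∀ ρ : ContDiffBump (0 : Rn n), ρ.rOut < δ →
      eLpNorm (mollify ρ g - g) p volume ≤ ENNReal.ofReal ε := by
  -- Radii below `1` keep the support of the mollification inside this fixed compact set, so a
  -- uniform bound turns into an `L^p` bound with the factor `M`.
  set S : Set (Rn n) := Metric.cthickening 1 (tsupport g) with hS
  have hSc : IsCompact S := hgc.isCompact.cthickening
  set M : ℝ≥0∞ := volume S ^ (1 / p.toReal) with hM
  have hMt : M ≠ ⊤ := ENNReal.rpow_ne_top_of_nonneg (by positivity) hSc.measure_lt_top.ne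
  -- The `+ 1` keeps the denominator positive even when `M = 0`.
  set ε' : ℝ := ε / (M.toReal + 1) with hε'
  have hε'0 : 0 < ε' := by positivity
  obtain ⟨δ, hδ, hu⟩ := Metric.uniformContinuous_iff.1
    (hgc.uniformContinuous_of_continuous hg) ε' hε'0
  refine ⟨min δ 1, by positivity, fun ρ hρ => ?_⟩
  have hd : ∀ x, dist (mollify ρ g x) (g x) ≤ ε' := fun x =>
    ρ.dist_normed_convolution_le hg.aestronglyMeasurable fun y hy =>
      (hu ((Metric.mem_ball.1 hy).trans (hρ.trans_le (min_le_left _ _)))).le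
  refine (eLpNorm_sub_le_of_dist_bdd volume hp hSc.isClosed.measurableSet hε'0.le hd ?_ ?_).trans ?_
  · intro x hx
    by_contra hxS
    apply hx
    rw [mollify_apply]
    refine integral_eq_zero_of_ae (Eventually.of_forall fun t => ?_)
    by_cases ht : t ∈ Function.support (ρ.normed volume)
    · rw [ρ.support_normed_eq, mem_ball_zero_iff] at ht
      have : g (x - t) = 0 := by
        by_contra hne
        refine hxS (Metric.mem_cthickening_of_dist_le x (x - t) 1 _ (subset_tsupport _ hne) ?_)
        rw [dist_eq_norm, sub_sub_cancel]
        exact (ht.trans (hρ.trans_le (min_le_right _ _))).le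
      simp [this]
    · simp [Function.notMem_support.1 ht]
  · exact (subset_tsupport g).trans (Metric.self_subset_cthickening _)
  · rw [← hM, ← ENNReal.ofReal_toReal hMt, ← ENNReal.ofReal_mul hε'0.le]
    refine ENNReal.ofReal_le_ofReal ?_
    rw [hε', div_mul_eq_mul_div, div_le_iff₀ (by positivity)]
    nlinarith [ENNReal.toReal_nonneg (a := M)]

/-- Mollification is an `L^p` contraction, so the compactly supported continuous case extends by
density, with three errors of size `ε/3`. -/
theorem exists_eLpNorm_mollify_sub_le [CompleteSpace F] {p : ℝ≥0∞} (hp1 : 1 ≤ p) (hp : p ≠ ⊤)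
    {f : Rn n → F} (hf : MemLp f p) {ε : ℝ} (hε : 0 < ε) :
    ∃ δ > 0, ∀ ρ : ContDiffBump (0 : Rn n), ρ.rOut < δ →
      eLpNorm (mollify ρ f - f) p volume ≤ ENNReal.ofReal ε := by
  have hε3 : 0 < ε / 3 := by positivity
  obtain ⟨g, hgc, hg, hfg⟩ := hf.exist_eLpNorm_sub_le hp hp1 hε3
  obtain ⟨δ, hδ, h⟩ := exists_eLpNorm_mollify_sub_le_of_hasCompactSupport hp hg.continuous hgc hε3
  refine ⟨δ, hδ, fun ρ hρ => ?_⟩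
  have hgL : MemLp g p := hg.continuous.memLp_of_hasCompactSupport hgc
  have e : mollify ρ f - f = mollify ρ (f - g) + ((mollify ρ g - g) - (f - g)) := by
    rw [mollify_sub ρ (hf.locallyIntegrable hp1) (hgL.locallyIntegrable hp1)]
    abel
  have m1 := (memLp_mollify ρ hp1 hp (hf.sub hgL)).1
  have m2 := (memLp_mollify ρ hp1 hp hgL).1.sub hgL.1
  have m3 := (hf.sub hgL).1
  rw [e]
  calc _ ≤ ENNReal.ofReal (ε / 3) + (ENNReal.ofReal (ε / 3) + ENNReal.ofReal (ε / 3)) := by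
        refine (eLpNorm_add_le m1 (m2.sub m3) hp1).trans (add_le_add ?_ ?_)
        · exact (eLpNorm_mollify_le ρ hp1 hp m3).trans hfg
        · exact (eLpNorm_sub_le m2 m3 hp1).trans (add_le_add (h ρ hρ) hfg)
    _ = ENNReal.ofReal ε := by
        rw [← ENNReal.ofReal_add hε3.le hε3.le, ← ENNReal.ofReal_add hε3.le (by positivity)]
        congr 1
        ring

theorem exists_contDiffBump_rOut_lt {δ : ℝ} (hδ : 0 < δ) :
    ∃ ρ : ContDiffBump (0 : Rn n), ρ.rOut < δ :=
  ⟨⟨δ / 4, δ / 2, by positivity, by linarith⟩, by simp; linarith⟩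

end Mollify

/-! ### Truncation by smooth cutoffs at scale `R`. -/

section Cutoff

variable (n : ℕ)

/-- A smooth cutoff function equal to `1` on the unit ball. -/
noncomputable def unitBump : ContDiffBump (0 : Rn n) := ⟨1, 2, one_pos, one_lt_two⟩

/-- The cutoff function at scale `R`. -/
noncomputable def cutoff (R : ℝ) (x : Rn n) : ℝ := unitBump n (R⁻¹ • x)

variable {n}

theorem contDiff_cutoff (R : ℝ) : ContDiff ℝ ∞ (cutoff n R) :=
  (unitBump n).contDiff.comp (contDiff_const_smul _)

theorem norm_cutoff_le (R : ℝ) (x : Rn n) : ‖cutoff n R x‖ ≤ 1 := by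
  rw [cutoff, Real.norm_of_nonneg (unitBump n).nonneg]
  exact (unitBump n).le_one

theorem hasCompactSupport_cutoff {R : ℝ} (hR : 0 < R) : HasCompactSupport (cutoff n R) :=
  (unitBump n).hasCompactSupport.comp_smul (inv_ne_zero hR.ne')

theorem cutoff_eq_one {R : ℝ} (hR : 0 < R) {x : Rn n} (hx : ‖x‖ ≤ R) : cutoff n R x = 1 := by
  refine (unitBump n).one_of_mem_closedBall ?_
  rw [mem_closedBall_zero_iff, norm_smul, norm_inv, Real.norm_of_nonneg hR.le]
  change R⁻¹ * ‖x‖ ≤ 1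
  rw [inv_mul_le_iff₀ hR]
  linarith

theorem eLpNorm_cutoff_smul_le {F : Type*} [NormedAddCommGroup F] [NormedSpace ℝ F] (R : ℝ)
    (f : Rn n → F) (p : ℝ≥0∞) :
    eLpNorm (fun x => cutoff n R x • f x) p volume ≤ eLpNorm f p volume := by
  refine eLpNorm_mono fun x => ?_
  rw [norm_smul]
  exact mul_le_of_le_one_left (norm_nonneg _) (norm_cutoff_le R x)

/-- Multiplication by the cutoff is an `L^p` contraction and fixes a compactly supported `g` once
`R` exceeds the radius of its support. -/
theorem exists_eLpNorm_cutoff_sub_le {F : Type*} [NormedAddCommGroup F] [NormedSpace ℝ F]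
    {p : ℝ≥0∞} (hp1 : 1 ≤ p) (hp : p ≠ ⊤)
    {f : Rn n → F} (hf : MemLp f p) {ε : ℝ} (hε : 0 < ε) :
    ∃ R₀ > 0, ∀ R, R₀ ≤ R →
      eLpNorm (fun x => cutoff n R x • f x - f x) p volume ≤ ENNReal.ofReal ε := by
  have hε2 : 0 < ε / 2 := by positivity
  obtain ⟨g, hgc, hg, hfg⟩ := hf.exist_eLpNorm_sub_le hp hp1 hε2
  obtain ⟨R₀, hR₀, hb⟩ := hgc.isCompact.isBounded.exists_pos_norm_le
  refine ⟨R₀, hR₀, fun R hR => ?_⟩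
  have hgL : MemLp g p := hg.continuous.memLp_of_hasCompactSupport hgc
  have hcg : ∀ x, cutoff n R x • g x = g x := by
    intro x
    by_cases hx : x ∈ tsupport g
    · rw [cutoff_eq_one (hR₀.trans_le hR) ((hb x hx).trans hR), one_smul]
    · rw [image_eq_zero_of_notMem_tsupport hx, smul_zero]
  have e : (fun x => cutoff n R x • f x - f x) =
      (fun x => cutoff n R x • (f - g) x) - (f - g) := by
    ext x
    simp only [Pi.sub_apply, smul_sub, hcg]
    abel
  have m3 := (hf.sub hgL).1
  rw [e]
  calc _ ≤ ENNReal.ofReal (ε / 2) + ENNReal.ofReal (ε / 2) := by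
        refine (eLpNorm_sub_le ?_ m3 hp1).trans (add_le_add ?_ hfg)
        · exact (contDiff_cutoff R).continuous.aestronglyMeasurable.smul m3
        · exact (eLpNorm_cutoff_smul_le R _ p).trans hfg
    _ = ENNReal.ofReal ε := by rw [← ENNReal.ofReal_add hε2.le hε2.le, add_halves]

end Cutoff

/-! ### The `L^p` norm by duality with test functions. -/

section Duality

variable {n : ℕ}

/-- Density of test functions in `L^q`, which needs `q < ∞`. It makes the extremal function, which
is only in `L^q`, admissible in the duality argument. -/
theorem norm_integral_mul_le_of_test {p q : ℝ≥0∞} (hpq : p.HolderConjugate q) (hq : q ≠ ⊤)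
    {h : Rn n → ℝ} (hh : MemLp h p) {C : ℝ} (hC0 : 0 ≤ C)
    (hC : ∀ ψ : Rn n → ℝ, ContDiff ℝ ∞ ψ → HasCompactSupport ψ →
      ‖∫ x, h x * ψ x‖ ≤ C * (eLpNorm ψ q volume).toReal)
    {ψ : Rn n → ℝ} (hψ : MemLp ψ q) :
    ‖∫ x, h x * ψ x‖ ≤ C * (eLpNorm ψ q volume).toReal := by
  have hq1 : 1 ≤ q := hpq.symm.one_le
  set N := (eLpNorm h p volume).toReal
  have key : ∀ ε > 0, ‖∫ x, h x * ψ x‖ ≤ C * (eLpNorm ψ q volume).toReal + (N + C) * ε := by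
    intro ε hε
    obtain ⟨g, hgc, hg, hfg⟩ := hψ.exist_eLpNorm_sub_le hq hq1 hε
    have hgL : MemLp g q := hg.continuous.memLp_of_hasCompactSupport hgc
    have hd : (eLpNorm (ψ - g) q volume).toReal ≤ ε := ENNReal.toReal_le_of_le_ofReal hε.le hfg
    have hi : ∀ u : Rn n → ℝ, MemLp u q → Integrable (fun x => h x * u x) := fun u hu =>
      integrable_mul_of_holder hpq hh hu
    have e : ∫ x, h x * ψ x = (∫ x, h x * (ψ - g) x) + ∫ x, h x * g x := by
      rw [← integral_add (hi _ (hψ.sub hgL)) (hi _ hgL)]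
      refine integral_congr_ae (Eventually.of_forall fun x => ?_)
      simp only [Pi.sub_apply]
      ring
    have h1 := norm_integral_mul_le_of_memLp hpq hh (hψ.sub hgL)
    have h2 := hC g hg hgc
    have h3 : (eLpNorm g q volume).toReal ≤ (eLpNorm ψ q volume).toReal + ε := by
      have : g = ψ - (ψ - g) := by abel
      have h4 := eLpNorm_sub_le hψ.1 (hψ.sub hgL).1 hq1
      rw [← this] at h4
      refine (ENNReal.toReal_mono (ENNReal.add_ne_top.2 ⟨hψ.2.ne, (hψ.sub hgL).2.ne⟩) h4).trans ?_
      rw [ENNReal.toReal_add hψ.2.ne (hψ.sub hgL).2.ne]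
      linarith
    rw [e]
    have h5 : N * (eLpNorm (ψ - g) q volume).toReal ≤ N * ε :=
      mul_le_mul_of_nonneg_left hd ENNReal.toReal_nonneg
    have h6 := mul_le_mul_of_nonneg_left h3 hC0
    linarith [norm_add_le (∫ x, h x * (ψ - g) x) (∫ x, h x * g x)]
  refine le_of_forall_pos_le_add fun ε hε => ?_
  have hN : 0 ≤ N := ENNReal.toReal_nonneg
  refine (key (ε / (N + C + 1)) (by positivity)).trans ?_
  gcongr
  rw [mul_div_assoc', div_le_iff₀ (by positivity)]
  nlinarith

/-- The `L^p` norm is controlled by the pairings with test functions. -/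
theorem eLpNorm_le_of_test {p q : ℝ≥0∞} (hpq : p.HolderConjugate q) (hp : p ≠ ⊤) (hq : q ≠ ⊤)
    {h : Rn n → ℝ} (hh : MemLp h p) {C : ℝ} (hC0 : 0 ≤ C)
    (hC : ∀ ψ : Rn n → ℝ, ContDiff ℝ ∞ ψ → HasCompactSupport ψ →
      ‖∫ x, h x * ψ x‖ ≤ C * (eLpNorm ψ q volume).toReal) :
    (eLpNorm h p volume).toReal ≤ C := by
  have hp0 : p ≠ 0 := hpq.ne_zero
  have hq0 : q ≠ 0 := hpq.symm.ne_zero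
  have hr : p.toReal.HolderConjugate q.toReal := ENNReal.HolderConjugate.toReal_of_ne_top hp hq
  set a := p.toReal
  set b := q.toReal
  -- The extremal function of Hölder's inequality: `h ψ = |h|^p = |ψ|^q`. Where `h = 0` the leading
  -- factor makes `ψ` vanish whatever value the power takes.
  set ψ : Rn n → ℝ := fun x => h x * |h x| ^ (a - 2) with hψdef
  have habs : ∀ x, |ψ x| = |h x| ^ (a - 1) := by
    intro x
    rcases eq_or_ne (h x) 0 with h0 | h0
    · simp [hψdef, h0, Real.zero_rpow (sub_ne_zero.2 hr.lt.ne')]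
    · have : 0 < |h x| := abs_pos.2 h0
      rw [hψdef]
      simp only [abs_mul]
      rw [abs_of_nonneg (Real.rpow_nonneg (abs_nonneg (h x)) _)]
      nth_rewrite 1 [← Real.rpow_one |h x|]
      rw [← Real.rpow_add this]
      congr 1
      ring
  have hmul : ∀ x, h x * ψ x = |h x| ^ a := by
    intro x
    rcases eq_or_ne (h x) 0 with h0 | h0
    · simp [hψdef, h0, Real.zero_rpow hr.pos.ne']
    · have : 0 < |h x| := abs_pos.2 h0
      rw [hψdef]
      simp only [← mul_assoc]
      rw [← abs_mul_abs_self (h x), ← pow_two, ← Real.rpow_natCast, ← Real.rpow_add this]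
      congr 1
      push_cast
      ring
  have hab : (a - 1) * b = a := hr.sub_one_mul_conj
  have hpow : ∀ x, ‖ψ x‖ ^ b = ‖h x‖ ^ a := by
    intro x
    rw [Real.norm_eq_abs, habs, ← Real.rpow_mul (abs_nonneg _), hab, Real.norm_eq_abs]
  have hψm : AEStronglyMeasurable ψ :=
    hh.1.mul ((hh.1.norm.aemeasurable.pow_const _).aestronglyMeasurable)
  have hint : Integrable fun x => ‖h x‖ ^ a := hh.integrable_norm_rpow hp0 hp
  have hψL : MemLp ψ q := by
    rw [← integrable_norm_rpow_iff hψm hq0 hq]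
    exact hint.congr (Eventually.of_forall fun x => (hpow x).symm)
  have hmain := norm_integral_mul_le_of_test hpq hq hh hC0 hC hψL
  set I := ∫ x, ‖h x‖ ^ a with hI
  have hI0 : 0 ≤ I := integral_nonneg fun x => by positivity
  have e1 : ∫ x, h x * ψ x = I := integral_congr_ae (Eventually.of_forall fun x => by
    simp only [hmul, Real.norm_eq_abs])
  have e2 : (eLpNorm ψ q volume).toReal = I ^ b⁻¹ := by
    rw [hψL.eLpNorm_eq_integral_rpow_norm hq0 hq, ENNReal.toReal_ofReal (by positivity)]
    congr 1
    exact integral_congr_ae (Eventually.of_forall hpow)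
  have e3 : (eLpNorm h p volume).toReal = I ^ a⁻¹ := by
    rw [hh.eLpNorm_eq_integral_rpow_norm hp0 hp, ENNReal.toReal_ofReal (by positivity)]
  rw [e1, e2, Real.norm_of_nonneg hI0] at hmain
  rw [e3]
  -- For `I > 0` one divides `I ≤ C I^{1/q}` by `I^{1/q}`; for `I = 0` the norm is `0`.
  rcases hI0.eq_or_lt with h0 | h0
  · rw [← h0, Real.zero_rpow (inv_ne_zero hr.pos.ne')]
    exact hC0
  · have h1 : I ^ a⁻¹ * I ^ b⁻¹ = I := by
      rw [← Real.rpow_add h0, hr.inv_add_inv_eq_one, Real.rpow_one]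
    have h2 : 0 < I ^ b⁻¹ := by positivity
    refine le_of_mul_le_mul_right ?_ h2
    rw [h1]
    exact hmain

end Duality

/-! ### The singular kernel and Schwartz difference estimates. -/

section Kernel

variable {n : ℕ} {α : ℝ}

/-- The integrable weight `min(1, |h|) / |h|^{n+α}`. -/
noncomputable def kern (n : ℕ) (α : ℝ) (h : Rn n) : ℝ := min 1 ‖h‖ / ‖h‖ ^ ((n : ℝ) + α)

theorem kern_nonneg (h : Rn n) : 0 ≤ kern n α h := by unfold kern; positivity

/-- Near the origin the kernel is of size `|h|^{1-n-α}`, integrable because `α < 1`; at infinity it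
is `|h|^{-n-α}`, integrable because `α > 0`. -/
theorem integrable_kern (hn : 1 ≤ n) (hα0 : 0 < α) (hα1 : α < 1) : Integrable (kern n α) := by
  have hmeas : Measurable (kern n α) := by unfold kern; fun_prop
  have hd : Module.finrank ℝ (Rn n) = n := by simp
  rw [← integrableOn_univ, ← Set.union_compl_self (Metric.ball (0 : Rn n) 1)]
  refine IntegrableOn.union ?_ ?_
  · refine integrableOn_ball_of_norm_le_rpow (C := 1) (α := n + α - 1) (by rw [hd]; exact hn)
      (by rw [hd]; linarith) (Eventually.of_forall fun x => ?_) hmeas.aestronglyMeasurable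
    rw [Real.norm_of_nonneg (kern_nonneg x), kern, one_mul]
    rcases (norm_nonneg x).eq_or_lt with h0 | h0
    · rw [← h0]; simp; positivity
    · rw [show -((n : ℝ) + α - 1) = 1 - (n + α) by ring, Real.rpow_sub h0, Real.rpow_one]
      gcongr
      exact min_le_right _ _
  · have h1 : Integrable (fun x : Rn n => (2 : ℝ) ^ ((n : ℝ) + α) * (1 + ‖x‖) ^ (-((n : ℝ) + α))) :=
      (integrable_one_add_norm (by rw [hd]; linarith)).const_mul _
    refine h1.integrableOn.mono' hmeas.aestronglyMeasurable ?_
    refine (ae_restrict_iff' Metric.isOpen_ball.measurableSet.compl).2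
      (Eventually.of_forall fun x hx => ?_)
    have hx1 : 1 ≤ ‖x‖ := by simpa using hx
    rw [Real.norm_of_nonneg (kern_nonneg x), kern, min_eq_left hx1, Real.rpow_neg (by positivity),
      ← div_eq_mul_inv, div_le_div_iff₀ (by positivity) (by positivity), one_mul,
      ← Real.mul_rpow (by norm_num) (by positivity)]
    gcongr
    linarith

/-- Division by zero makes both sides `0` at `h = 0`; positivity of `n + α` is what gives `0 ^ (n +
α) = 0` there. -/
theorem norm_div_rpow (h : Rn n) (hα : 0 < (n : ℝ) + α) :
    ‖h‖ / ‖h‖ ^ ((n : ℝ) + α + 1) = 1 / ‖h‖ ^ ((n : ℝ) + α) := by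
  rcases (norm_nonneg h).eq_or_lt with h0 | h0
  · rw [← h0, Real.zero_rpow hα.ne']; simp
  · rw [Real.rpow_add_one h0.ne']
    field_simp

/-- An integrable weight that dominates Schwartz functions. -/
noncomputable def weight (n : ℕ) (x : Rn n) : ℝ := (1 + ‖x‖) ^ (-((n : ℝ) + 1))

theorem weight_nonneg (x : Rn n) : 0 ≤ weight n x := by unfold weight; positivity

theorem weight_le_one (x : Rn n) : weight n x ≤ 1 := by
  unfold weight
  exact Real.rpow_le_one_of_one_le_of_nonpos (by linarith [norm_nonneg x])
    (by linarith [n.cast_nonneg (α := ℝ)])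

theorem integrable_weight : Integrable (weight n) :=
  integrable_one_add_norm (by simp)

theorem weight_le_of_norm_sub_le {x y : Rn n} (h : ‖y - x‖ ≤ 1) :
    weight n y ≤ 2 ^ ((n : ℝ) + 1) * weight n x := by
  unfold weight
  have h1 : ‖x‖ ≤ ‖y‖ + 1 := by
    have := norm_sub_norm_le x y
    rw [norm_sub_rev] at this
    linarith
  rw [Real.rpow_neg (by positivity), Real.rpow_neg (by positivity), ← div_eq_mul_inv,
    inv_eq_one_div, div_le_div_iff₀ (by positivity) (by positivity), one_mul,
    ← Real.mul_rpow (by norm_num) (by positivity)]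
  gcongr
  linarith [norm_nonneg y]

theorem exists_norm_iteratedFDeriv_le_weight {F : Type*} [NormedAddCommGroup F] [NormedSpace ℝ F]
    (u : 𝓢(Rn n, F)) (k : ℕ) : ∃ C, 0 ≤ C ∧ ∀ x, ‖iteratedFDeriv ℝ k u x‖ ≤ C * weight n x := by
  refine ⟨2 ^ (n + 1) * (Finset.Iic (n + 1, k)).sup
    (fun m => SchwartzMap.seminorm ℝ m.1 m.2) u, by positivity, fun x => ?_⟩
  have h := SchwartzMap.one_add_le_sup_seminorm_apply (𝕜 := ℝ) (m := (n + 1, k)) (k := n + 1)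
    (n := k) le_rfl le_rfl u x
  rw [weight, Real.rpow_neg (by positivity), ← div_eq_mul_inv, le_div_iff₀ (by positivity),
    mul_comm]
  have e : (1 + ‖x‖) ^ ((n : ℝ) + 1) = (1 + ‖x‖) ^ (n + 1) := by
    rw [← Real.rpow_natCast]; push_cast; rfl
  rw [e]
  exact h

/-- The factor `min 1 ‖h‖` compensates the singularity at `h = 0`, and the weights give decay in
`x`; multiplied by the singular kernel the bound is jointly integrable in `(x, h)`. The triangle
inequality covers `‖h‖ ≥ 1`. -/
theorem exists_norm_sub_le_weight {F : Type*} [NormedAddCommGroup F] [NormedSpace ℝ F]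
    (u : 𝓢(Rn n, F)) : ∃ C, 0 ≤ C ∧ (∀ x, ‖u x‖ ≤ C * weight n x) ∧
      ∀ x h, ‖u (x + h) - u x‖ ≤ C * min 1 ‖h‖ * (weight n x + weight n (x + h)) := by
  obtain ⟨C₀, hC₀, h₀⟩ := exists_norm_iteratedFDeriv_le_weight u 0
  obtain ⟨C₁, hC₁, h₁⟩ := exists_norm_iteratedFDeriv_le_weight u 1
  have hu : ∀ x, ‖u x‖ ≤ C₀ * weight n x := fun x => by simpa using h₀ x
  have hd : ∀ x, ‖fderiv ℝ u x‖ ≤ C₁ * weight n x := fun x => by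
    simpa [norm_iteratedFDeriv_one] using h₁ x
  set c : ℝ := 2 ^ ((n : ℝ) + 1)
  have hc : 0 ≤ c := by positivity
  refine ⟨max C₀ (C₁ * c), by positivity, fun x => (hu x).trans ?_, fun x h => ?_⟩
  · have := weight_nonneg x
    gcongr
    exact le_max_left _ _
  have hx := weight_nonneg x
  have hxh := weight_nonneg (x + h)
  rcases le_total 1 ‖h‖ with h1 | h1
  · rw [min_eq_left h1, mul_one]
    calc ‖u (x + h) - u x‖ ≤ ‖u (x + h)‖ + ‖u x‖ := norm_sub_le _ _
      _ ≤ C₀ * weight n (x + h) + C₀ * weight n x := add_le_add (hu _) (hu _)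
      _ = C₀ * (weight n x + weight n (x + h)) := by ring
      _ ≤ _ := by gcongr; exact le_max_left _ _
  · rw [min_eq_right h1]
    -- Mean value inequality on the unit ball around `x`, where the weight is at most `2^{n+1}`
    -- times its value at the centre.
    have hmv := (convex_closedBall x (1 : ℝ)).norm_image_sub_le_of_norm_fderiv_le (𝕜 := ℝ)
      (f := u) (C := C₁ * (c * weight n x)) (x := x) (y := x + h)
      (fun y _ => u.differentiableAt) (fun y hy => (hd y).trans (by
        gcongr
        exact weight_le_of_norm_sub_le (mem_closedBall_iff_norm.1 hy)))
      (Metric.mem_closedBall_self zero_le_one) (by simpa using h1)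
    rw [add_sub_cancel_left] at hmv
    calc _ ≤ C₁ * (c * weight n x) * ‖h‖ := hmv
      _ = C₁ * c * ‖h‖ * (weight n x) := by ring
      _ ≤ _ := by
        gcongr
        · exact le_max_right _ _
        · linarith

end Kernel

/-! ### Fractional gradient and divergence of Schwartz functions. -/

section Operators

variable {n : ℕ} {α : ℝ}

/-- The fractional gradient of a regular function. -/
noncomputable def fracGrad (α : ℝ) (f : Rn n → ℝ) (x : Rn n) : Rn n :=
  muConst n α • ∫ h, ((f (x + h) - f x) / ‖h‖ ^ ((n : ℝ) + α + 1)) • h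

/-- The commutator term in the Leibniz rule for the fractional gradient of `η f`. -/
noncomputable def leibnizTerm (α : ℝ) (η f : Rn n → ℝ) (x : Rn n) : Rn n :=
  muConst n α • ∫ h, ((η (x + h) - η x) * f (x + h) / ‖h‖ ^ ((n : ℝ) + α + 1)) • h

theorem leibnizTerm_one (α : ℝ) (η : Rn n → ℝ) :
    leibnizTerm α η (fun _ => 1) = fracGrad α η := by
  ext1 x
  simp [leibnizTerm, fracGrad]

theorem fracDiv_eq (α : ℝ) (φ : Rn n → Rn n) (x : Rn n) :
    fracDiv α φ x =
      muConst n α * ∫ h, inner ℝ h (φ (x + h) - φ x) / ‖h‖ ^ ((n : ℝ) + α + 1) := by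
  rw [fracDiv]
  congr 1
  rw [← integral_add_left_eq_self _ x]
  simp

theorem norm_smul_div_le (hα : 0 < (n : ℝ) + α) {a c : ℝ} {h : Rn n} (ha : |a| ≤ c * min 1 ‖h‖) :
    ‖(a / ‖h‖ ^ ((n : ℝ) + α + 1)) • h‖ ≤ c * kern n α h := by
  rw [norm_smul, norm_div, Real.norm_eq_abs,
    Real.norm_of_nonneg (Real.rpow_nonneg (norm_nonneg h) _), div_mul_eq_mul_div, mul_div_assoc,
    norm_div_rpow h hα, kern, mul_one_div, mul_div_assoc']
  gcongr

theorem abs_inner_div_le (hα : 0 < (n : ℝ) + α) {v : Rn n} {c : ℝ} {h : Rn n}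
    (ha : ‖v‖ ≤ c * min 1 ‖h‖) :
    |inner ℝ h v / ‖h‖ ^ ((n : ℝ) + α + 1)| ≤ c * kern n α h := by
  rw [abs_div, abs_of_nonneg (Real.rpow_nonneg (norm_nonneg h) _)]
  calc _ ≤ ‖h‖ * ‖v‖ / ‖h‖ ^ ((n : ℝ) + α + 1) := by gcongr; exact abs_real_inner_le_norm _ _
    _ = ‖v‖ * (‖h‖ / ‖h‖ ^ ((n : ℝ) + α + 1)) := by ring
    _ = ‖v‖ / ‖h‖ ^ ((n : ℝ) + α) := by rw [norm_div_rpow h hα, mul_one_div]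
    _ ≤ _ := by
      rw [kern, mul_div_assoc']
      gcongr

theorem integrable_kern_mul_weight (hn : 1 ≤ n) (hα0 : 0 < α) (hα1 : α < 1) :
    Integrable (fun z : Rn n × Rn n => kern n α z.2 * (weight n z.1 + weight n (z.1 + z.2)))
      (volume.prod volume) := by
  have hk := integrable_kern hn hα0 hα1
  have h1 : Integrable (fun z : Rn n × Rn n => kern n α z.2 * (1 * weight n (z.1 + z.2)))
      (volume.prod volume) :=
    -- The pair `(∞, 1)` with the constant function `1` in the `L^∞` slot.
    integrable_prod_of_holder (p := ⊤) (q := 1) inferInstance hk (memLp_top_const 1)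
      (memLp_one_iff_integrable.2 integrable_weight)
  have h2 : Integrable (fun z : Rn n × Rn n => weight n z.1 * kern n α z.2)
      (volume.prod volume) := integrable_weight.mul_prod hk
  refine (h2.add h1).congr (Eventually.of_forall fun z => ?_)
  simp only [Pi.add_apply]
  ring

/-- The integrand of a fractional operator on Schwartz functions is absolutely integrable. -/
theorem integrable_prod_of_le_kern_weight (hn : 1 ≤ n) (hα0 : 0 < α) (hα1 : α < 1)
    {F : Type*} [NormedAddCommGroup F] {N : Rn n × Rn n → F} {C : ℝ}
    (hN : AEStronglyMeasurable N (volume.prod volume))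
    (hC : ∀ z, ‖N z‖ ≤ C * (kern n α z.2 * (weight n z.1 + weight n (z.1 + z.2)))) :
    Integrable N (volume.prod volume) :=
  ((integrable_kern_mul_weight hn hα0 hα1).const_mul C).mono' hN (Eventually.of_forall hC)

theorem norm_integral_le_of_le_kern (hn : 1 ≤ n) (hα0 : 0 < α) (hα1 : α < 1)
    {F : Type*} [NormedAddCommGroup F] [NormedSpace ℝ F] {N : Rn n → F} {C : ℝ}
    (hC : ∀ h, ‖N h‖ ≤ C * kern n α h) :
    ‖∫ h, N h‖ ≤ C * ∫ h, kern n α h := by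
  rw [← integral_const_mul]
  exact norm_integral_le_of_norm_le ((integrable_kern hn hα0 hα1).const_mul C)
    (Eventually.of_forall hC)

theorem exists_div_integrand_le (u : 𝓢(Rn n, Rn n)) (hα : 0 < (n : ℝ) + α) :
    ∃ C, 0 ≤ C ∧ ∀ x h, |inner ℝ h (u (x + h) - u x) / ‖h‖ ^ ((n : ℝ) + α + 1)| ≤
      C * (kern n α h * (weight n x + weight n (x + h))) := by
  obtain ⟨C, hC, -, h⟩ := exists_norm_sub_le_weight u
  refine ⟨C, hC, fun x k => ?_⟩
  refine (abs_inner_div_le (c := C * (weight n x + weight n (x + k))) hα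
    ((h x k).trans (le_of_eq (by ring)))).trans (le_of_eq (by ring))

theorem exists_grad_integrand_le (u : 𝓢(Rn n, ℝ)) (hα : 0 < (n : ℝ) + α) :
    ∃ C, 0 ≤ C ∧ ∀ x h, ‖((u (x + h) - u x) / ‖h‖ ^ ((n : ℝ) + α + 1)) • h‖ ≤
      C * (kern n α h * (weight n x + weight n (x + h))) := by
  obtain ⟨C, hC, -, h⟩ := exists_norm_sub_le_weight u
  refine ⟨C, hC, fun x k => ?_⟩
  refine (norm_smul_div_le (c := C * (weight n x + weight n (x + k))) hα
    ((h x k).trans (le_of_eq (by ring)))).trans (le_of_eq (by ring))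

theorem kern_mul_weight_le (x h : Rn n) :
    kern n α h * (weight n x + weight n (x + h)) ≤ 2 * kern n α h := by
  have := weight_le_one x
  have := weight_le_one (x + h)
  nlinarith [kern_nonneg (α := α) h]

theorem integrable_div_integrand (hn : 1 ≤ n) (hα0 : 0 < α) (hα1 : α < 1) (u : 𝓢(Rn n, Rn n)) :
    Integrable (fun z : Rn n × Rn n =>
      inner ℝ z.2 (u (z.1 + z.2) - u z.1) / ‖z.2‖ ^ ((n : ℝ) + α + 1)) (volume.prod volume) := by
  obtain ⟨C, -, hC⟩ := exists_div_integrand_le (α := α) u (by positivity)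
  refine integrable_prod_of_le_kern_weight hn hα0 hα1 (C := C) ?_ fun z => hC z.1 z.2
  have hu := u.continuous
  have h1 : Continuous fun z : Rn n × Rn n => inner ℝ z.2 (u (z.1 + z.2) - u z.1) := by fun_prop
  have h2 : Measurable fun z : Rn n × Rn n => ‖z.2‖ ^ ((n : ℝ) + α + 1) := by fun_prop
  exact (h1.measurable.div h2).aestronglyMeasurable

theorem integrable_grad_integrand (hn : 1 ≤ n) (hα0 : 0 < α) (hα1 : α < 1) (u : 𝓢(Rn n, ℝ)) :
    Integrable (fun z : Rn n × Rn n =>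
      ((u (z.1 + z.2) - u z.1) / ‖z.2‖ ^ ((n : ℝ) + α + 1)) • z.2) (volume.prod volume) := by
  obtain ⟨C, -, hC⟩ := exists_grad_integrand_le (α := α) u (by positivity)
  refine integrable_prod_of_le_kern_weight hn hα0 hα1 (C := C) ?_ fun z => hC z.1 z.2
  have hu := u.continuous
  have h1 : Continuous fun z : Rn n × Rn n => u (z.1 + z.2) - u z.1 := by fun_prop
  have h2 : Measurable fun z : Rn n × Rn n => ‖z.2‖ ^ ((n : ℝ) + α + 1) := by fun_prop
  exact ((h1.measurable.div h2).smul measurable_snd).aestronglyMeasurable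

theorem integrable_fracDiv (hn : 1 ≤ n) (hα0 : 0 < α) (hα1 : α < 1) (u : 𝓢(Rn n, Rn n)) :
    Integrable (fracDiv α u) := by
  have := ((integrable_div_integrand hn hα0 hα1 u).integral_prod_left).const_mul (muConst n α)
  exact this.congr (Eventually.of_forall fun x => (fracDiv_eq α u x).symm)

theorem integrable_fracGrad (hn : 1 ≤ n) (hα0 : 0 < α) (hα1 : α < 1) (u : 𝓢(Rn n, ℝ)) :
    Integrable (fracGrad α u) :=
  ((integrable_grad_integrand hn hα0 hα1 u).integral_prod_left).smul (muConst n α)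

theorem memLp_fracDiv (hn : 1 ≤ n) (hα0 : 0 < α) (hα1 : α < 1) (u : 𝓢(Rn n, Rn n))
    {q : ℝ≥0∞} (hq : 1 ≤ q) : MemLp (fracDiv α u) q := by
  obtain ⟨C, hC0, hC⟩ := exists_div_integrand_le (α := α) u (by positivity)
  refine memLp_of_integrable_of_bound (integrable_fracDiv hn hα0 hα1 u)
    (C := ‖muConst n α‖ * (C * 2 * ∫ h, kern n α h)) (fun x => ?_) hq
  rw [fracDiv_eq, norm_mul]
  gcongr
  refine norm_integral_le_of_le_kern hn hα0 hα1 fun h => (hC x h).trans ?_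
  rw [mul_assoc]
  exact mul_le_mul_of_nonneg_left (kern_mul_weight_le x h) hC0

theorem memLp_fracGrad (hn : 1 ≤ n) (hα0 : 0 < α) (hα1 : α < 1) (u : 𝓢(Rn n, ℝ))
    {q : ℝ≥0∞} (hq : 1 ≤ q) : MemLp (fracGrad α u) q := by
  obtain ⟨C, hC0, hC⟩ := exists_grad_integrand_le (α := α) u (by positivity)
  refine memLp_of_integrable_of_bound (integrable_fracGrad hn hα0 hα1 u)
    (C := ‖muConst n α‖ * (C * 2 * ∫ h, kern n α h)) (fun x => ?_) hq
  rw [fracGrad, norm_smul]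
  gcongr
  refine norm_integral_le_of_le_kern hn hα0 hα1 fun h => (hC x h).trans ?_
  rw [mul_assoc]
  exact mul_le_mul_of_nonneg_left (kern_mul_weight_le x h) hC0

/-- After Fubini the inner integral of `u(x+h) - u(x)` over `x` vanishes by translation invariance.
In weak form this says that constants have zero fractional gradient. -/
theorem integral_fracDiv_eq_zero (hn : 1 ≤ n) (hα0 : 0 < α) (hα1 : α < 1) (u : 𝓢(Rn n, Rn n)) :
    ∫ x, fracDiv α u x = 0 := by
  simp_rw [fracDiv_eq]
  rw [integral_const_mul, integral_integral_swap (integrable_div_integrand hn hα0 hα1 u)]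
  refine mul_eq_zero_of_right _ (integral_eq_zero_of_ae (Eventually.of_forall fun h => ?_))
  have hu : Integrable (u : Rn n → Rn n) := u.integrable
  have hu' : Integrable fun x => u (x + h) := hu.comp_add_right h
  simp only [Pi.zero_apply]
  have e : ∫ x, inner ℝ h (u (x + h) - u x) = inner ℝ h (∫ x, (u (x + h) - u x)) :=
    integral_inner (hu'.sub hu) h
  rw [integral_div, e, integral_sub hu' hu,
    integral_add_right_eq_self (μ := volume) (fun x => u x) h]
  simp

end Operators

/-! ### The Leibniz rule for weak fractional gradients. -/

section Leibniz

variable {n : ℕ} {α : ℝ}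

theorem integrable_leibniz_prod (hn : 1 ≤ n) (hα0 : 0 < α) (hα1 : α < 1) {p q : ℝ≥0∞}
    (hpq : p.HolderConjugate q) {f : Rn n → ℝ} (hf : MemLp f p) {φ : Rn n → Rn n}
    (hφ : MemLp φ q) (η : 𝓢(Rn n, ℝ)) :
    Integrable (fun z : Rn n × Rn n => f z.1 * ((η (z.1 + z.2) - η z.1) *
      inner ℝ z.2 (φ (z.1 + z.2)) / ‖z.2‖ ^ ((n : ℝ) + α + 1))) (volume.prod volume) := by
  obtain ⟨C, hC0, -, hC⟩ := exists_norm_sub_le_weight η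
  have h := integrable_prod_of_holder hpq (integrable_kern hn hα0 hα1) hf.norm hφ.norm
  have hφm : AEStronglyMeasurable (fun z : Rn n × Rn n => φ (z.1 + z.2)) (volume.prod volume) :=
    hφ.1.comp_quasiMeasurePreserving (quasiMeasurePreserving_add _ _)
  have hη := η.continuous
  have h1 : Continuous fun z : Rn n × Rn n => η (z.1 + z.2) - η z.1 := by fun_prop
  have h2 : Measurable fun z : Rn n × Rn n => ‖z.2‖ ^ ((n : ℝ) + α + 1) := by fun_prop
  refine (h.const_mul (2 * C)).mono' ?_ (Eventually.of_forall fun z => ?_)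
  · refine hf.1.comp_fst.mul ?_
    have h3 := h1.aestronglyMeasurable.mul
      ((measurable_snd.aestronglyMeasurable (μ := volume.prod volume)).inner (𝕜 := ℝ) hφm)
    exact (h3.aemeasurable.div h2.aemeasurable).aestronglyMeasurable
  · rw [norm_mul, ← real_inner_smul_right, Real.norm_eq_abs (_ / _)]
    have hk := kern_nonneg (α := α) z.2
    have hb : ‖η (z.1 + z.2) - η z.1‖ ≤ 2 * C * min 1 ‖z.2‖ := by
      refine (hC z.1 z.2).trans ?_
      have := weight_le_one z.1
      have := weight_le_one (z.1 + z.2)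
      have : 0 ≤ C * min 1 ‖z.2‖ := by positivity
      nlinarith
    refine (mul_le_mul_of_nonneg_left (abs_inner_div_le (c := 2 * C * ‖φ (z.1 + z.2)‖)
      (by positivity) ?_) (norm_nonneg _)).trans (le_of_eq (by ring))
    rw [norm_smul]
    calc _ ≤ 2 * C * min 1 ‖z.2‖ * ‖φ (z.1 + z.2)‖ := by gcongr
      _ = _ := by ring

/-- The substitution `(x, h) ↦ (x + h, -h)` moves the commutator from the test field `φ` to `f`. The
increment of `η` and the factor `h` both change sign, so the signs cancel. -/
theorem integral_leibniz_symm (hn : 1 ≤ n) (hα0 : 0 < α) (hα1 : α < 1) {p q : ℝ≥0∞}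
    (hpq : p.HolderConjugate q) {f : Rn n → ℝ} (hf : MemLp f p) {φ : Rn n → Rn n}
    (hφ : MemLp φ q) (η : 𝓢(Rn n, ℝ)) :
    Integrable (fun z : Rn n × Rn n => (η (z.1 + z.2) - η z.1) * f (z.1 + z.2) *
      inner ℝ z.2 (φ z.1) / ‖z.2‖ ^ ((n : ℝ) + α + 1)) (volume.prod volume) ∧
    ∫ y, ∫ h, (η (y + h) - η y) * f (y + h) * inner ℝ h (φ y) / ‖h‖ ^ ((n : ℝ) + α + 1) =
      ∫ x, ∫ h, f x * ((η (x + h) - η x) * inner ℝ h (φ (x + h)) / ‖h‖ ^ ((n : ℝ) + α + 1)) := by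
  have h1 := integrable_leibniz_prod (α := α) hn hα0 hα1 hpq hf hφ η
  -- The substitution is a composition of a shear, coordinate swaps and a reflection, each of which
  -- preserves the product measure.
  have hmp : MeasurePreserving (fun z : Rn n × Rn n => (z.1 + z.2, -z.2))
      (volume.prod volume) (volume.prod volume) := by
    have a1 : MeasurePreserving (fun z : Rn n × Rn n => (z.1, z.2 + z.1))
      (volume.prod volume) (volume.prod volume) := measurePreserving_prod_add_right _ _
    have a2 : MeasurePreserving (Prod.map id (Neg.neg) : Rn n × Rn n → Rn n × Rn n)
      (volume.prod volume) (volume.prod volume) :=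
      (MeasurePreserving.id _).prod (Measure.measurePreserving_neg _)
    have a3 := Measure.measurePreserving_swap (μ := (volume : Measure (Rn n)))
      (ν := (volume : Measure (Rn n)))
    have := a2.comp (a3.comp (a1.comp a3))
    exact this
  have hpt : ∀ z : Rn n × Rn n, (η (z.1 + z.2) - η z.1) * f (z.1 + z.2) *
      inner ℝ z.2 (φ z.1) / ‖z.2‖ ^ ((n : ℝ) + α + 1) =
      (fun z : Rn n × Rn n => f z.1 * ((η (z.1 + z.2) - η z.1) *
      inner ℝ z.2 (φ (z.1 + z.2)) / ‖z.2‖ ^ ((n : ℝ) + α + 1))) (z.1 + z.2, -z.2) := by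
    intro z
    simp only [norm_neg, inner_neg_left, add_neg_cancel_right]
    ring
  have hint := hmp.integrable_comp_of_integrable h1
  have hint' : Integrable (fun z : Rn n × Rn n => (η (z.1 + z.2) - η z.1) * f (z.1 + z.2) *
      inner ℝ z.2 (φ z.1) / ‖z.2‖ ^ ((n : ℝ) + α + 1)) (volume.prod volume) :=
    hint.congr (Eventually.of_forall fun z => (hpt z).symm)
  refine ⟨hint', ?_⟩
  refine (integral_prod _ hint').symm.trans (Eq.trans ?_ (integral_prod _ h1))
  rw [integral_congr_ae (Eventually.of_forall hpt)]
  have he : MeasurableEmbedding (fun z : Rn n × Rn n => (z.1 + z.2, -z.2)) := by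
    refine Continuous.measurableEmbedding (by fun_prop) ?_
    intro z w hzw
    simp only [Prod.mk.injEq, neg_inj] at hzw
    obtain ⟨h1, h2⟩ := hzw
    rw [h2] at h1
    exact Prod.ext (add_right_cancel h1) h2
  exact hmp.integral_comp he (fun z : Rn n × Rn n => f z.1 * ((η (z.1 + z.2) - η z.1) *
      inner ℝ z.2 (φ (z.1 + z.2)) / ‖z.2‖ ^ ((n : ℝ) + α + 1)))

theorem integrable_leibniz_slice (hn : 1 ≤ n) (hα0 : 0 < α) (hα1 : α < 1)
    (η : 𝓢(Rn n, ℝ)) (u : 𝓢(Rn n, Rn n)) (x : Rn n) :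
    Integrable fun h => (η (x + h) - η x) * inner ℝ h (u (x + h)) / ‖h‖ ^ ((n : ℝ) + α + 1) := by
  obtain ⟨C, hC0, -, hC⟩ := exists_norm_sub_le_weight η
  obtain ⟨D, hD0, hD, -⟩ := exists_norm_sub_le_weight u
  have hη := η.continuous
  have hu := u.continuous
  have h1 : Continuous fun h : Rn n => (η (x + h) - η x) * inner ℝ h (u (x + h)) := by fun_prop
  have h2 : Measurable fun h : Rn n => ‖h‖ ^ ((n : ℝ) + α + 1) := by fun_prop
  refine ((integrable_kern hn hα0 hα1).const_mul (2 * C * D)).mono'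
    (h1.measurable.div h2).aestronglyMeasurable (Eventually.of_forall fun h => ?_)
  rw [← real_inner_smul_right, Real.norm_eq_abs (_ / _)]
  refine abs_inner_div_le (by positivity) ?_
  rw [norm_smul]
  calc _ ≤ (C * min 1 ‖h‖ * (weight n x + weight n (x + h))) * (D * weight n (x + h)) := by
        exact mul_le_mul (hC x h) (hD _) (norm_nonneg _) ((norm_nonneg _).trans (hC x h))
    _ ≤ (C * min 1 ‖h‖ * (1 + 1)) * (D * 1) := by
        have := weight_nonneg x
        have := weight_nonneg (x + h)
        gcongr <;> exact weight_le_one _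
    _ = _ := by ring

theorem integrable_div_slice (hn : 1 ≤ n) (hα0 : 0 < α) (hα1 : α < 1)
    (u : 𝓢(Rn n, Rn n)) (x : Rn n) :
    Integrable fun h => inner ℝ h (u (x + h) - u x) / ‖h‖ ^ ((n : ℝ) + α + 1) := by
  obtain ⟨C, hC0, hC⟩ := exists_div_integrand_le (α := α) u (by positivity)
  have hu := u.continuous
  have h1 : Continuous fun h : Rn n => inner ℝ h (u (x + h) - u x) := by fun_prop
  have h2 : Measurable fun h : Rn n => ‖h‖ ^ ((n : ℝ) + α + 1) := by fun_prop
  refine ((integrable_kern hn hα0 hα1).const_mul (C * 2)).mono'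
    (h1.measurable.div h2).aestronglyMeasurable (Eventually.of_forall fun h => ?_)
  refine (hC x h).trans ?_
  rw [mul_assoc]
  exact mul_le_mul_of_nonneg_left (kern_mul_weight_le x h) hC0

theorem integrable_inner_of_locallyIntegrable {G φ : Rn n → Rn n} (hG : LocallyIntegrable G)
    (hφ : Continuous φ) (hφc : HasCompactSupport φ) : Integrable fun x => inner ℝ (G x) (φ x) := by
  have hK := hφc.isCompact
  have hint : IntegrableOn (fun x => inner ℝ (G x) (φ x)) (tsupport φ) := by
    have h1 := (hG.integrableOn_isCompact hK).norm
    obtain ⟨M, hM⟩ := hφ.bounded_above_of_compact_support hφc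
    refine (h1.const_mul M).mono' ?_ (Eventually.of_forall fun x => ?_)
    · exact (hG.integrableOn_isCompact hK).1.inner hφ.aestronglyMeasurable
    · rw [mul_comm]
      exact (abs_real_inner_le_norm _ _).trans (by gcongr; exact hM x)
  refine (integrableOn_iff_integrable_of_support_subset ?_).1 hint
  intro x hx
  refine subset_tsupport φ fun h0 => hx ?_
  simp [h0]

/-- For `f` in `L^p` the commutator integrand need not be integrable in `(x, h)`; the weight in `x`,
which lies in the dual `L^q`, makes it so. Since the weight is continuous and positive it can be
divided out afterwards, which gives integrability of almost every slice and local integrability of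
the commutator. The case `p = ∞` is included. -/
theorem integrable_weight_smul_leibniz (hn : 1 ≤ n) (hα0 : 0 < α) (hα1 : α < 1) {p : ℝ≥0∞}
    (hp1 : 1 ≤ p) {f : Rn n → ℝ} (hf : MemLp f p) (η : 𝓢(Rn n, ℝ)) :
    Integrable (fun z : Rn n × Rn n => weight n z.1 • (((η (z.1 + z.2) - η z.1) * f (z.1 + z.2) /
      ‖z.2‖ ^ ((n : ℝ) + α + 1)) • z.2)) (volume.prod volume) := by
  obtain ⟨q, hpq⟩ : ∃ q, p.HolderConjugate q := ⟨_, ENNReal.HolderConjugate.inv_one_sub_inv' hp1⟩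
  obtain ⟨C, hC0, -, hC⟩ := exists_norm_sub_le_weight η
  have hw : MemLp (weight n) q := memLp_of_integrable_of_bound integrable_weight (C := 1)
    (fun x => by rw [Real.norm_of_nonneg (weight_nonneg x)]; exact weight_le_one x) hpq.symm.one_le
  have h := integrable_prod_of_holder hpq.symm (integrable_kern hn hα0 hα1) hw hf.norm
  have hfm : AEStronglyMeasurable (fun z : Rn n × Rn n => f (z.1 + z.2)) (volume.prod volume) :=
    hf.1.comp_quasiMeasurePreserving (quasiMeasurePreserving_add _ _)
  have hη := η.continuous
  have h1 : Continuous fun z : Rn n × Rn n => η (z.1 + z.2) - η z.1 := by fun_prop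
  have h2 : Measurable fun z : Rn n × Rn n => ‖z.2‖ ^ ((n : ℝ) + α + 1) := by fun_prop
  refine (h.const_mul (2 * C)).mono' ?_ (Eventually.of_forall fun z => ?_)
  · refine hw.1.comp_fst.smul ?_
    have h3 := h1.aestronglyMeasurable.mul hfm
    exact (h3.aemeasurable.div h2.aemeasurable).aestronglyMeasurable.smul
      measurable_snd.aestronglyMeasurable
  · rw [norm_smul, Real.norm_of_nonneg (weight_nonneg _)]
    have hb : ‖η (z.1 + z.2) - η z.1‖ ≤ 2 * C * min 1 ‖z.2‖ := by
      refine (hC z.1 z.2).trans ?_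
      have := weight_le_one z.1
      have := weight_le_one (z.1 + z.2)
      have : 0 ≤ C * min 1 ‖z.2‖ := by positivity
      nlinarith
    refine (mul_le_mul_of_nonneg_left (norm_smul_div_le (c := 2 * C * ‖f (z.1 + z.2)‖)
      (by positivity) ?_) (weight_nonneg _)).trans (le_of_eq (by ring))
    rw [abs_mul]
    calc _ ≤ 2 * C * min 1 ‖z.2‖ * ‖f (z.1 + z.2)‖ := by gcongr; exact hb; exact le_rfl
      _ = _ := by ring

theorem weight_pos (x : Rn n) : 0 < weight n x := by unfold weight; positivity

theorem continuous_weight : Continuous (weight n) := by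
  unfold weight
  exact (continuous_const.add continuous_norm).rpow_const fun x =>
    Or.inl (ne_of_gt (by positivity : 0 < 1 + ‖x‖))

theorem ae_integrable_leibniz (hn : 1 ≤ n) (hα0 : 0 < α) (hα1 : α < 1) {p : ℝ≥0∞}
    (hp1 : 1 ≤ p) {f : Rn n → ℝ} (hf : MemLp f p) (η : 𝓢(Rn n, ℝ)) :
    ∀ᵐ x, Integrable fun h => ((η (x + h) - η x) * f (x + h) / ‖h‖ ^ ((n : ℝ) + α + 1)) • h := by
  filter_upwards [(integrable_weight_smul_leibniz hn hα0 hα1 hp1 hf η).prod_right_ae] with x hx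
  exact (integrable_smul_iff (weight_pos x).ne' _).1 hx

theorem locallyIntegrable_leibnizTerm (hn : 1 ≤ n) (hα0 : 0 < α) (hα1 : α < 1) {p : ℝ≥0∞}
    (hp1 : 1 ≤ p) {f : Rn n → ℝ} (hf : MemLp f p) (η : 𝓢(Rn n, ℝ)) :
    LocallyIntegrable (leibnizTerm α η f) := by
  have h := (integrable_weight_smul_leibniz hn hα0 hα1 hp1 hf η).integral_prod_left
  have h1 : LocallyIntegrableOn (fun x => (muConst n α * (weight n x)⁻¹) •
      ∫ h, weight n x • (((η (x + h) - η x) * f (x + h) / ‖h‖ ^ ((n : ℝ) + α + 1)) • h))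
      Set.univ :=
    (locallyIntegrableOn_univ.2 h.locallyIntegrable).continuousOn_smul isOpen_univ.isLocallyClosed
      (continuous_const.mul (continuous_weight.inv₀ fun x => (weight_pos x).ne')).continuousOn
  rw [locallyIntegrableOn_univ] at h1
  convert h1 using 2 with x
  rw [leibnizTerm, integral_smul, mul_smul, inv_smul_smul₀ (weight_pos x).ne']

/-- The algebra of the Leibniz rule: `(ηu)(x+h) - (ηu)(x) = η(x) (u(x+h) - u(x)) + (η(x+h) - η(x))
u(x+h)`, integrated against the kernel. -/
theorem mul_fracDiv_eq (hn : 1 ≤ n) (hα0 : 0 < α) (hα1 : α < 1) (η : 𝓢(Rn n, ℝ))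
    (u w : 𝓢(Rn n, Rn n)) (hw : ∀ x, w x = η x • u x) (f : Rn n → ℝ) (x : Rn n) :
    η x * f x * fracDiv α u x = f x * fracDiv α w x - muConst n α *
      ∫ h, f x * ((η (x + h) - η x) * inner ℝ h (u (x + h)) / ‖h‖ ^ ((n : ℝ) + α + 1)) := by
  have e1 := integrable_div_slice (α := α) hn hα0 hα1 w x
  have e2 := integrable_leibniz_slice (α := α) hn hα0 hα1 η u x
  have e3 : η x * ∫ h, inner ℝ h (u (x + h) - u x) / ‖h‖ ^ ((n : ℝ) + α + 1) =
      (∫ h, inner ℝ h (w (x + h) - w x) / ‖h‖ ^ ((n : ℝ) + α + 1)) -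
        ∫ h, (η (x + h) - η x) * inner ℝ h (u (x + h)) / ‖h‖ ^ ((n : ℝ) + α + 1) := by
    rw [← integral_sub e1 e2, ← integral_const_mul]
    refine integral_congr_ae (Eventually.of_forall fun h => ?_)
    simp only [hw, inner_sub_right, inner_smul_right]
    ring
  rw [fracDiv_eq, fracDiv_eq, integral_const_mul]
  calc _ = f x * muConst n α *
        (η x * ∫ h, inner ℝ h (u (x + h) - u x) / ‖h‖ ^ ((n : ℝ) + α + 1)) := by ring
    _ = _ := by rw [e3]; ring

theorem inner_leibnizTerm {η f : Rn n → ℝ} {x : Rn n} (hI : Integrable fun h =>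
    ((η (x + h) - η x) * f (x + h) / ‖h‖ ^ ((n : ℝ) + α + 1)) • h) (v : Rn n) :
    inner ℝ (leibnizTerm α η f x) v = muConst n α *
      ∫ h, (η (x + h) - η x) * f (x + h) * inner ℝ h v / ‖h‖ ^ ((n : ℝ) + α + 1) := by
  rw [leibnizTerm, real_inner_smul_left, real_inner_comm, ← integral_inner hI]
  congr 1
  refine integral_congr_ae (Eventually.of_forall fun h => ?_)
  simp only [inner_smul_right, real_inner_comm h]
  ring

/-- The Leibniz rule for weak fractional gradients. -/
theorem IsWeakFracGrad.schwartz_mul (hn : 1 ≤ n) (hα0 : 0 < α) (hα1 : α < 1) {p : ℝ≥0∞}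
    (hp1 : 1 ≤ p) {f : Rn n → ℝ} {g : Rn n → Rn n} (hf : MemLp f p) (hfg : IsWeakFracGrad α f g)
    (η : 𝓢(Rn n, ℝ)) :
    IsWeakFracGrad α (fun x => η x * f x) (fun x => η x • g x + leibnizTerm α η f x) := by
  have hηg : LocallyIntegrable fun x => η x • g x := by
    rw [← locallyIntegrableOn_univ]
    exact (locallyIntegrableOn_univ.2 hfg.1).continuousOn_smul isOpen_univ.isLocallyClosed
      η.continuous.continuousOn
  have hG := locallyIntegrable_leibnizTerm hn hα0 hα1 hp1 hf η
  have hsum : LocallyIntegrable ((fun x => η x • g x) + leibnizTerm α η f) :=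
    LocallyIntegrable.add hηg hG
  refine ⟨hsum, fun φ hφ hφc => ?_⟩
  obtain ⟨q, hpq⟩ : ∃ q, p.HolderConjugate q := ⟨_, ENNReal.HolderConjugate.inv_one_sub_inv' hp1⟩
  have hq1 : 1 ≤ q := hpq.symm.one_le
  obtain ⟨u, rfl⟩ : ∃ u : 𝓢(Rn n, Rn n), (u : Rn n → Rn n) = φ := ⟨hφc.toSchwartzMap hφ, rfl⟩
  have hηφ : ContDiff ℝ ∞ fun x => η x • u x := η.smooth'.smul hφ
  have hηφc : HasCompactSupport fun x => η x • u x :=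
    hφc.mono fun x hx h0 => hx (by simp [h0])
  obtain ⟨w, hw⟩ : ∃ w : 𝓢(Rn n, Rn n), (w : Rn n → Rn n) = fun x => η x • u x :=
    ⟨hηφc.toSchwartzMap hηφ, rfl⟩
  have hpt := mul_fracDiv_eq (α := α) hn hα0 hα1 η u w (fun x => by rw [hw]) f
  obtain ⟨hsym, hsym'⟩ := integral_leibniz_symm (α := α) hn hα0 hα1 hpq hf (u.memLp q) η
  have hprod := integrable_leibniz_prod (α := α) hn hα0 hα1 hpq hf (u.memLp q) η
  have hi1 : Integrable fun x => f x * fracDiv α w x :=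
    integrable_mul_of_holder hpq hf (memLp_fracDiv hn hα0 hα1 w hq1)
  have hi2 := (hprod.integral_prod_left).const_mul (muConst n α)
  -- The weak gradient of `f` is tested with `η u`; the commutator left over is then moved onto `f`
  -- by `hsym'`.
  have hmain := hfg.2 (fun x => η x • u x) hηφ hηφc
  have e1 : ∫ x, η x * f x * fracDiv α u x = (∫ x, f x * fracDiv α w x) - muConst n α *
      ∫ x, ∫ h, f x * ((η (x + h) - η x) * inner ℝ h (u (x + h)) / ‖h‖ ^ ((n : ℝ) + α + 1)) := by
    rw [← integral_const_mul, ← integral_sub hi1 hi2]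
    exact integral_congr_ae (Eventually.of_forall hpt)
  have e2 : ∫ x, inner ℝ (leibnizTerm α η f x) (u x) = muConst n α *
      ∫ x, ∫ h, (η (x + h) - η x) * f (x + h) * inner ℝ h (u x) / ‖h‖ ^ ((n : ℝ) + α + 1) := by
    rw [← integral_const_mul]
    refine integral_congr_ae ?_
    filter_upwards [ae_integrable_leibniz (α := α) hn hα0 hα1 hp1 hf η] with x hx
    exact inner_leibnizTerm hx (u x)
  have e3 : ∫ x, inner ℝ (η x • g x + leibnizTerm α η f x) (u x) =
      (∫ x, inner ℝ (g x) (η x • u x)) + ∫ x, inner ℝ (leibnizTerm α η f x) (u x) := by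
    rw [← integral_add]
    · refine integral_congr_ae (Eventually.of_forall fun x => ?_)
      simp only [inner_add_left, real_inner_smul_left, real_inner_smul_right]
    · exact integrable_inner_of_locallyIntegrable hfg.1 hηφ.continuous hηφc
    · exact integrable_inner_of_locallyIntegrable hG u.continuous hφc
  rw [e1, e3, e2, hsym', hw, hmain]
  ring

/-- A constant function has vanishing fractional gradient. -/
theorem isWeakFracGrad_one (hn : 1 ≤ n) (hα0 : 0 < α) (hα1 : α < 1) :
    IsWeakFracGrad α (fun _ : Rn n => 1) (fun _ => 0) := by
  refine ⟨locallyIntegrable_const 0, fun φ hφ hφc => ?_⟩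
  have : ∫ x, fracDiv α φ x = 0 := integral_fracDiv_eq_zero hn hα0 hα1 (hφc.toSchwartzMap hφ)
  simpa using this

/-- The Leibniz rule applied to `f = 1` in `L^∞`, whose gradient is `0`: only the commutator
survives, and it is the pointwise fractional gradient. -/
theorem isWeakFracGrad_schwartz (hn : 1 ≤ n) (hα0 : 0 < α) (hα1 : α < 1) (η : 𝓢(Rn n, ℝ)) :
    IsWeakFracGrad α η (fracGrad α η) := by
  have := (isWeakFracGrad_one hn hα0 hα1).schwartz_mul hn hα0 hα1 (p := ⊤) le_top
    (memLp_top_const 1) η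
  simpa [leibnizTerm_one] using this

end Leibniz

/-! ### Linearity, closedness and mollification of weak gradients. -/

section WeakGradient

variable {n : ℕ} {α : ℝ}

theorem IsWeakFracGrad.congr {f f' : Rn n → ℝ} {g g' : Rn n → Rn n} (h : IsWeakFracGrad α f g)
    (hf : f =ᵐ[volume] f') (hg : g =ᵐ[volume] g') : IsWeakFracGrad α f' g' := by
  refine ⟨h.1.congr hg, fun φ hφ hφc => ?_⟩
  have := h.2 φ hφ hφc
  rw [integral_congr_ae (g := fun x => f' x * fracDiv α φ x)
    (by filter_upwards [hf] with x hx; rw [hx]),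
    integral_congr_ae (f := fun x => inner ℝ (g x) (φ x)) (g := fun x => inner ℝ (g' x) (φ x))
    (by filter_upwards [hg] with x hx; rw [hx])] at this
  exact this

theorem integrable_inner_of_holder {p q : ℝ≥0∞} (hpq : p.HolderConjugate q) {g φ : Rn n → Rn n}
    (hg : MemLp g p) (hφ : MemLp φ q) : Integrable fun x => inner ℝ (g x) (φ x) :=
  (integrable_mul_of_holder hpq hg.norm hφ.norm).mono' (hg.1.inner hφ.1)
    (Eventually.of_forall fun x => abs_real_inner_le_norm (g x) (φ x))

theorem norm_integral_inner_le_of_holder {p q : ℝ≥0∞} (hpq : p.HolderConjugate q)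
    {g φ : Rn n → Rn n} (hg : MemLp g p) (hφ : MemLp φ q) :
    ‖∫ x, inner ℝ (g x) (φ x)‖ ≤ (eLpNorm g p volume).toReal * (eLpNorm φ q volume).toReal := by
  have h1 := norm_integral_mul_le_of_memLp hpq hg.norm hφ.norm
  rw [eLpNorm_norm, eLpNorm_norm] at h1
  refine le_trans ?_ h1
  refine le_trans ?_ (le_abs_self _)
  exact norm_integral_le_of_norm_le (integrable_mul_of_holder hpq hg.norm hφ.norm)
    (Eventually.of_forall fun x => abs_real_inner_le_norm (g x) (φ x))

theorem IsWeakFracGrad.sub (hn : 1 ≤ n) (hα0 : 0 < α) (hα1 : α < 1) {p : ℝ≥0∞} (hp1 : 1 ≤ p)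
    {f₁ f₂ : Rn n → ℝ} {g₁ g₂ : Rn n → Rn n} (hf₁ : MemLp f₁ p) (hf₂ : MemLp f₂ p)
    (h₁ : IsWeakFracGrad α f₁ g₁) (h₂ : IsWeakFracGrad α f₂ g₂) :
    IsWeakFracGrad α (f₁ - f₂) (g₁ - g₂) := by
  refine ⟨h₁.1.sub h₂.1, fun φ hφ hφc => ?_⟩
  obtain ⟨q, hpq⟩ : ∃ q, p.HolderConjugate q := ⟨_, ENNReal.HolderConjugate.inv_one_sub_inv' hp1⟩
  have hd : MemLp (fracDiv α φ) q :=
    memLp_fracDiv hn hα0 hα1 (hφc.toSchwartzMap hφ) hpq.symm.one_le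
  simp only [Pi.sub_apply, sub_mul, inner_sub_left]
  rw [integral_sub (integrable_mul_of_holder hpq hf₁ hd) (integrable_mul_of_holder hpq hf₂ hd),
    integral_sub (integrable_inner_of_locallyIntegrable h₁.1 hφ.continuous hφc)
      (integrable_inner_of_locallyIntegrable h₂.1 hφ.continuous hφc), h₁.2 φ hφ hφc, h₂.2 φ hφ hφc]
  ring

/-- The graph of the weak fractional gradient is closed in `L^p × L^p`. -/
theorem isWeakFracGrad_of_approx (hn : 1 ≤ n) (hα0 : 0 < α) (hα1 : α < 1) {p : ℝ≥0∞} (hp1 : 1 ≤ p)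
    {f : Rn n → ℝ} {g : Rn n → Rn n} (hf : MemLp f p) (hg : MemLp g p)
    (h : ∀ ε : ℝ, 0 < ε → ∃ (f' : Rn n → ℝ) (g' : Rn n → Rn n), MemLp f' p ∧ MemLp g' p ∧
      IsWeakFracGrad α f' g' ∧ (eLpNorm (f - f') p volume).toReal ≤ ε ∧
      (eLpNorm (g - g') p volume).toReal ≤ ε) :
    IsWeakFracGrad α f g := by
  refine ⟨hg.locallyIntegrable hp1, fun φ hφ hφc => ?_⟩
  obtain ⟨q, hpq⟩ : ∃ q, p.HolderConjugate q := ⟨_, ENNReal.HolderConjugate.inv_one_sub_inv' hp1⟩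
  have hd : MemLp (fracDiv α φ) q :=
    memLp_fracDiv hn hα0 hα1 (hφc.toSchwartzMap hφ) hpq.symm.one_le
  have hφL : MemLp φ q := hφ.continuous.memLp_of_hasCompactSupport hφc
  set M := (eLpNorm (fracDiv α φ) q volume).toReal + (eLpNorm φ q volume).toReal with hM
  have hM0 : 0 ≤ M := by positivity
  rw [eq_neg_iff_add_eq_zero, ← norm_eq_zero]
  refine le_antisymm (le_of_forall_pos_le_add fun ε hε => ?_) (norm_nonneg _)
  obtain ⟨f', g', hf', hg', hw, h1, h2⟩ := h (ε / (M + 1)) (by positivity)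
  have e : (∫ x, f x * fracDiv α φ x) + ∫ x, inner ℝ (g x) (φ x) =
      (∫ x, (f - f') x * fracDiv α φ x) + ∫ x, inner ℝ ((g - g') x) (φ x) := by
    simp only [Pi.sub_apply, sub_mul, inner_sub_left]
    rw [integral_sub (integrable_mul_of_holder hpq hf hd) (integrable_mul_of_holder hpq hf' hd),
      integral_sub (integrable_inner_of_holder hpq hg hφL)
        (integrable_inner_of_holder hpq hg' hφL), hw.2 φ hφ hφc]
    ring
  rw [e, zero_add]
  have b1 := norm_integral_mul_le_of_memLp hpq (hf.sub hf') hd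
  have b2 := norm_integral_inner_le_of_holder hpq (hg.sub hg') hφL
  calc _ ≤ ε / (M + 1) * (eLpNorm (fracDiv α φ) q volume).toReal +
        ε / (M + 1) * (eLpNorm φ q volume).toReal :=
        (norm_add_le _ _).trans (add_le_add (b1.trans (by gcongr)) (b2.trans (by gcongr)))
    _ = ε / (M + 1) * M := by rw [hM]; ring
    _ ≤ ε := by
        rw [div_mul_eq_mul_div, div_le_iff₀ (by positivity)]
        nlinarith

theorem fracDiv_comp_sub (φ : Rn n → Rn n) (t x : Rn n) :
    fracDiv α (fun y => φ (y - t)) x = fracDiv α φ (x - t) := by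
  rw [fracDiv_eq, fracDiv_eq]
  simp only [sub_add_eq_add_sub]

theorem mollify_eq_integral_add {F : Type*} [NormedAddCommGroup F] [NormedSpace ℝ F]
    (ρ : ContDiffBump (0 : Rn n)) (f : Rn n → F) (x : Rn n) :
    mollify ρ f x = ∫ t, ρ.normed volume (-t) • f (x + t) := by
  rw [mollify_apply, ← integral_neg_eq_self]
  simp

/-- By Fubini the mollifier passes onto the test field, as an average of its translates. Since
`div^α` commutes with translations, each translate is an admissible test field for `f`. -/
theorem IsWeakFracGrad.mollify (hn : 1 ≤ n) (hα0 : 0 < α) (hα1 : α < 1) {p : ℝ≥0∞} (hp1 : 1 ≤ p)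
    (hp : p ≠ ⊤) {f : Rn n → ℝ} {g : Rn n → Rn n} (hf : MemLp f p) (hg : MemLp g p)
    (h : IsWeakFracGrad α f g) (ρ : ContDiffBump (0 : Rn n)) :
    IsWeakFracGrad α (FracSobolev.mollify ρ f) (FracSobolev.mollify ρ g) := by
  refine ⟨(memLp_mollify ρ hp1 hp hg).locallyIntegrable hp1, fun φ hφ hφc => ?_⟩
  obtain ⟨q, hpq⟩ : ∃ q, p.HolderConjugate q := ⟨_, ENNReal.HolderConjugate.inv_one_sub_inv' hp1⟩
  have hd : MemLp (fracDiv α φ) q :=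
    memLp_fracDiv hn hα0 hα1 (hφc.toSchwartzMap hφ) hpq.symm.one_le
  have hφL : MemLp φ q := hφ.continuous.memLp_of_hasCompactSupport hφc
  have hk : Integrable fun t : Rn n => ρ.normed volume (-t) := by
    have := (ρ.integrable_normed (μ := volume)).comp_neg
    exact this
  have i1 := integrable_prod_of_holder hpq.symm hk hd hf
  have i2 : Integrable (fun z : Rn n × Rn n =>
      ρ.normed volume (-z.2) * inner ℝ (g (z.1 + z.2)) (φ z.1)) (volume.prod volume) := by
    refine (integrable_prod_of_holder hpq.symm hk.norm hφL.norm hg.norm).mono'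
      (hk.1.comp_snd.mul (AEStronglyMeasurable.inner (𝕜 := ℝ) ?_ hφL.1.comp_fst))
      (Eventually.of_forall fun z => ?_)
    · exact hg.1.comp_quasiMeasurePreserving (quasiMeasurePreserving_add _ _)
    · rw [norm_mul]
      gcongr
      rw [mul_comm]
      exact abs_real_inner_le_norm _ _
  have hgi : ∀ᵐ x, Integrable fun t => ρ.normed volume (-t) • g (x + t) := by
    refine Eventually.of_forall fun x => ?_
    have := (ρ.hasCompactSupport_normed (μ := volume)).convolutionExists_left
      (ContinuousLinearMap.lsmul ℝ ℝ) ρ.continuous_normed (hg.locallyIntegrable hp1) x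
    have h2 := this.comp_neg
    simpa using h2
  have e1 : ∫ x, FracSobolev.mollify ρ f x * fracDiv α φ x =
      ∫ t, ρ.normed volume (-t) * ∫ x, f x * fracDiv α (fun y => φ (y - t)) x := by
    calc _ = ∫ x, ∫ t, ρ.normed volume (-t) * (fracDiv α φ x * f (x + t)) := by
          refine integral_congr_ae (Eventually.of_forall fun x => ?_)
          simp only [mollify_eq_integral_add, smul_eq_mul]
          rw [← integral_mul_const]
          exact integral_congr_ae (Eventually.of_forall fun t => by ring)
      _ = ∫ t, ∫ x, ρ.normed volume (-t) * (fracDiv α φ x * f (x + t)) :=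
          integral_integral_swap i1
      _ = _ := by
          refine integral_congr_ae (Eventually.of_forall fun t => ?_)
          simp only [fracDiv_comp_sub]
          rw [integral_const_mul, ← integral_sub_right_eq_self _ t]
          congr 1
          exact integral_congr_ae (Eventually.of_forall fun x => by simp; ring)
  have e2 : ∫ x, inner ℝ (FracSobolev.mollify ρ g x) (φ x) =
      ∫ t, ρ.normed volume (-t) * ∫ x, inner ℝ (g x) (φ (x - t)) := by
    calc _ = ∫ x, ∫ t, ρ.normed volume (-t) * inner ℝ (g (x + t)) (φ x) := by
          refine integral_congr_ae ?_
          filter_upwards [hgi] with x hx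
          rw [mollify_eq_integral_add, real_inner_comm, ← integral_inner hx]
          refine integral_congr_ae (Eventually.of_forall fun t => ?_)
          simp only [real_inner_smul_right, real_inner_comm]
      _ = ∫ t, ∫ x, ρ.normed volume (-t) * inner ℝ (g (x + t)) (φ x) :=
          integral_integral_swap i2
      _ = _ := by
          refine integral_congr_ae (Eventually.of_forall fun t => ?_)
          simp only
          rw [integral_const_mul, ← integral_sub_right_eq_self _ t]
          simp
  rw [e1, e2, ← integral_neg]
  refine integral_congr_ae (Eventually.of_forall fun t => ?_)
  simp only
  rw [h.2 (fun y => φ (y - t)) (hφ.comp (contDiff_id.sub contDiff_const))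
    (hφc.comp_homeomorph (Homeomorph.subRight t))]
  ring

end WeakGradient

/-! ### Decay of the cutoff commutator. -/

section CutoffGradient

variable {n : ℕ} {α : ℝ}

/-- The rescaled weight `min(1, |h|/R) / |h|^{n+α}`. -/
noncomputable def kernAt (n : ℕ) (α R : ℝ) (h : Rn n) : ℝ :=
  min 1 (‖h‖ / R) / ‖h‖ ^ ((n : ℝ) + α)

theorem kernAt_nonneg {R : ℝ} (hR : 0 < R) (h : Rn n) : 0 ≤ kernAt n α R h := by
  unfold kernAt; positivity

theorem kernAt_le_kern {R : ℝ} (hR : 1 ≤ R) (h : Rn n) : kernAt n α R h ≤ kern n α h := by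
  unfold kernAt kern
  gcongr
  exact div_le_self (norm_nonneg h) hR

/-- For `R ≥ 1` the rescaled kernel is dominated by the integrable `kern`, and it tends to `0`
pointwise. -/
theorem tendsto_lintegral_kernAt (hn : 1 ≤ n) (hα0 : 0 < α) (hα1 : α < 1) :
    Tendsto (fun R => ∫⁻ h, ENNReal.ofReal (kernAt n α R h)) atTop (𝓝 0) := by
  have hm : ∀ R, Measurable fun h : Rn n => ENNReal.ofReal (kernAt n α R h) := by
    intro R
    unfold kernAt
    fun_prop
  have hb : ∫⁻ h, ENNReal.ofReal (kern n α h) ≠ ⊤ := by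
    have := (integrable_kern hn hα0 hα1).2
    rw [hasFiniteIntegral_iff_ofReal (Eventually.of_forall kern_nonneg)] at this
    exact this.ne
  have := tendsto_lintegral_filter_of_dominated_convergence (μ := (volume : Measure (Rn n)))
    (F := fun R h => ENNReal.ofReal (kernAt n α R h)) (f := fun _ => 0) (l := atTop)
    (fun h => ENNReal.ofReal (kern n α h)) (Eventually.of_forall hm)
    (by
      filter_upwards [eventually_ge_atTop 1] with R hR
      exact Eventually.of_forall fun h => ENNReal.ofReal_le_ofReal (kernAt_le_kern hR h)) hb
    (Eventually.of_forall fun h => ?_)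
  · simpa using this
  · rw [← ENNReal.ofReal_zero]
    refine ENNReal.tendsto_ofReal ?_
    have h1 : Tendsto (fun R : ℝ => ‖h‖ / R) atTop (𝓝 0) := tendsto_const_nhds.div_atTop tendsto_id
    have h2 := (tendsto_const_nhds (x := (1 : ℝ))).min h1
    have h3 := h2.div_const (‖h‖ ^ ((n : ℝ) + α))
    simpa [kernAt] using h3

/-- The constant is independent of `R`: it comes from the unit-scale estimate applied at `R⁻¹ x` and
`R⁻¹ h`. -/
theorem exists_abs_cutoff_sub_le (n : ℕ) : ∃ C, 0 ≤ C ∧ ∀ R > 0, ∀ x h : Rn n,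
    |cutoff n R (x + h) - cutoff n R x| ≤ C * min 1 (‖h‖ / R) := by
  obtain ⟨C, hC0, -, hC⟩ := exists_norm_sub_le_weight
    ((unitBump n).hasCompactSupport.toSchwartzMap (unitBump n).contDiff)
  refine ⟨C * 2, by positivity, fun R hR x h => ?_⟩
  have := hC (R⁻¹ • x) (R⁻¹ • h)
  rw [← smul_add, norm_smul, norm_inv, Real.norm_of_nonneg hR.le, inv_mul_eq_div] at this
  refine (this.trans ?_)
  have h1 := weight_le_one (R⁻¹ • x)
  have h2 := weight_le_one (R⁻¹ • (x + h))
  have h3 : 0 ≤ C * min 1 (‖h‖ / R) := by positivity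
  nlinarith

/-- The commutator with the cutoff functions vanishes in `L^p` at infinite scale. -/
theorem tendsto_eLpNorm_leibnizTerm_cutoff (hn : 1 ≤ n) (hα0 : 0 < α) (hα1 : α < 1) {p : ℝ≥0∞}
    (hp1 : 1 ≤ p) (hp : p ≠ ⊤) {f : Rn n → ℝ} (hf : MemLp f p) :
    Tendsto (fun R => eLpNorm (leibnizTerm α (cutoff n R) f) p volume) atTop (𝓝 0) := by
  obtain ⟨C, hC0, hC⟩ := exists_abs_cutoff_sub_le n
  set c := ‖muConst n α‖ * C
  have hc : 0 ≤ c := by positivity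
  have hbound : ∀ R, 0 < R → eLpNorm (leibnizTerm α (cutoff n R) f) p volume ≤
      (ENNReal.ofReal c * ∫⁻ h, ENNReal.ofReal (kernAt n α R h)) * eLpNorm f p volume := by
    intro R hR
    have hm : Measurable fun h : Rn n => ENNReal.ofReal (kernAt n α R h) := by
      unfold kernAt
      fun_prop
    rw [← lintegral_const_mul _ hm]
    refine eLpNorm_le_of_conv_bound hp1 hp (hm.const_mul _).aemeasurable hf.1
      (Eventually.of_forall fun x => ?_)
    -- The reflection `h ↦ -h` on the convolution side turns `f(x - h)` into the `f(x + h)` of the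
    -- commutator; the kernel is even.
    rw [leibnizTerm, enorm_smul, ← lintegral_neg_eq_self]
    calc _ ≤ ‖muConst n α‖ₑ * ∫⁻ h, ‖((cutoff n R (x + h) - cutoff n R x) * f (x + h) /
            ‖h‖ ^ ((n : ℝ) + α + 1)) • h‖ₑ := by
          gcongr
          exact enorm_integral_le_lintegral_enorm _
      _ = ∫⁻ h, ‖muConst n α‖ₑ * ‖((cutoff n R (x + h) - cutoff n R x) * f (x + h) /
            ‖h‖ ^ ((n : ℝ) + α + 1)) • h‖ₑ := (lintegral_const_mul' _ _ enorm_ne_top).symm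
      _ ≤ _ := by
          refine lintegral_mono fun h => ?_
          have hk : kernAt n α R (-h) = kernAt n α R h := by simp [kernAt]
          simp only [sub_neg_eq_add, hk]
          rw [← ofReal_norm, ← ofReal_norm, ← ofReal_norm (f _),
            ← ENNReal.ofReal_mul (norm_nonneg _), ← ENNReal.ofReal_mul hc,
            ← ENNReal.ofReal_mul (mul_nonneg hc (kernAt_nonneg hR h))]
          refine ENNReal.ofReal_le_ofReal ?_
          rw [norm_smul, norm_div, norm_mul, Real.norm_of_nonneg
            (Real.rpow_nonneg (norm_nonneg h) _), div_mul_eq_mul_div, mul_div_assoc,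
            norm_div_rpow h (by positivity), mul_one_div]
          calc _ ≤ ‖muConst n α‖ * (C * min 1 (‖h‖ / R) * ‖f (x + h)‖ / ‖h‖ ^ ((n : ℝ) + α)) := by
                gcongr
                exact hC R hR x h
            _ = _ := by rw [kernAt]; ring
  have hlim : Tendsto (fun R => (ENNReal.ofReal c * ∫⁻ h, ENNReal.ofReal (kernAt n α R h)) *
      eLpNorm f p volume) atTop (𝓝 0) := by
    have h1 := ENNReal.Tendsto.const_mul (a := ENNReal.ofReal c)
      (tendsto_lintegral_kernAt hn hα0 hα1) (Or.inr ENNReal.ofReal_ne_top)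
    have h2 := ENNReal.Tendsto.mul_const (b := eLpNorm f p volume) h1 (Or.inr hf.2.ne)
    simpa using h2
  refine tendsto_of_tendsto_of_tendsto_of_le_of_le' tendsto_const_nhds hlim
    (Eventually.of_forall fun R => zero_le) ?_
  filter_upwards [eventually_gt_atTop 0] with R hR using hbound R hR

end CutoffGradient

/-! ### Density of test functions. -/

section Density

variable {n : ℕ} {α : ℝ}

/-- The weak fractional gradient of a Schwartz function multiplied by an `L^p` function. -/
theorem IsWeakFracGrad.cutoff_mul (hn : 1 ≤ n) (hα0 : 0 < α) (hα1 : α < 1) {p : ℝ≥0∞}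
    (hp1 : 1 ≤ p) {f : Rn n → ℝ} {g : Rn n → Rn n} (hf : MemLp f p) (hfg : IsWeakFracGrad α f g)
    {R : ℝ} (hR : 0 < R) :
    IsWeakFracGrad α (fun x => cutoff n R x * f x)
      (fun x => cutoff n R x • g x + leibnizTerm α (cutoff n R) f x) :=
  hfg.schwartz_mul hn hα0 hα1 hp1 hf
    ((hasCompactSupport_cutoff hR).toSchwartzMap (contDiff_cutoff R))

/-- Mollify, then truncate. Three errors of size `ε/3` occur in the gradient: mollification of `g`,
truncation of the mollified gradient, and the commutator with the cutoff. -/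
theorem exists_test_approx (hn : 1 ≤ n) (hα0 : 0 < α) (hα1 : α < 1) {p : ℝ≥0∞} (hp1 : 1 ≤ p)
    (hp : p ≠ ⊤) {f : Rn n → ℝ} {g : Rn n → Rn n} (hf : MemLp f p) (hg : MemLp g p)
    (hfg : IsWeakFracGrad α f g) {ε : ℝ} (hε : 0 < ε) :
    ∃ (u : Rn n → ℝ) (gu : Rn n → Rn n), ContDiff ℝ ∞ u ∧ HasCompactSupport u ∧ MemLp gu p ∧
      IsWeakFracGrad α u gu ∧ eLpNorm (f - u) p volume ≤ ENNReal.ofReal ε ∧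
      eLpNorm (g - gu) p volume ≤ ENNReal.ofReal ε := by
  have hε3 : 0 < ε / 3 := by positivity
  obtain ⟨δ₁, hδ₁, h₁⟩ := exists_eLpNorm_mollify_sub_le hp1 hp hf hε3
  obtain ⟨δ₂, hδ₂, h₂⟩ := exists_eLpNorm_mollify_sub_le hp1 hp hg hε3
  obtain ⟨ρ, hρ⟩ := exists_contDiffBump_rOut_lt (n := n) (lt_min hδ₁ hδ₂)
  have hf₁ := memLp_mollify ρ hp1 hp hf
  have hg₁ := memLp_mollify ρ hp1 hp hg
  have hw₁ := hfg.mollify hn hα0 hα1 hp1 hp hf hg ρ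
  have a₁ := h₁ ρ (hρ.trans_le (min_le_left _ _))
  have a₂ := h₂ ρ (hρ.trans_le (min_le_right _ _))
  have hsm := contDiff_mollify ρ (hf.locallyIntegrable hp1)
  set f₁ := mollify ρ f
  set g₁ := mollify ρ g
  obtain ⟨R₁, hR₁, b₁⟩ := exists_eLpNorm_cutoff_sub_le hp1 hp hf₁ hε3
  obtain ⟨R₂, hR₂, b₂⟩ := exists_eLpNorm_cutoff_sub_le hp1 hp hg₁ hε3
  -- The mollification parameter is already fixed here, so one scale `R` can be taken large enough
  -- for all three truncation estimates.
  have hG := tendsto_eLpNorm_leibnizTerm_cutoff hn hα0 hα1 hp1 hp hf₁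
  obtain ⟨R, hRG, hRR₁, hRR₂⟩ := ((hG.eventually_le_const
    (u := ENNReal.ofReal (ε / 3)) (by simpa using hε3)).and
    ((eventually_ge_atTop R₁).and (eventually_ge_atTop R₂))).exists
  have hR : 0 < R := hR₁.trans_le hRR₁
  have c₁ := b₁ R hRR₁
  have c₂ := b₂ R hRR₂
  have hGm : AEStronglyMeasurable (leibnizTerm α (cutoff n R) f₁) :=
    (locallyIntegrable_leibnizTerm hn hα0 hα1 hp1 hf₁
      ((hasCompactSupport_cutoff hR).toSchwartzMap (contDiff_cutoff R))).aestronglyMeasurable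
  have hGL : MemLp (leibnizTerm α (cutoff n R) f₁) p :=
    ⟨hGm, hRG.trans_lt ENNReal.ofReal_lt_top⟩
  have hcg : MemLp (fun x => cutoff n R x • g₁ x) p :=
    ⟨(contDiff_cutoff R).continuous.aestronglyMeasurable.smul hg₁.1,
      (eLpNorm_cutoff_smul_le R g₁ p).trans_lt hg₁.2⟩
  have hcf : MemLp (fun x => cutoff n R x • f₁ x) p :=
    ⟨(contDiff_cutoff R).continuous.aestronglyMeasurable.smul hf₁.1,
      (eLpNorm_cutoff_smul_le R f₁ p).trans_lt hf₁.2⟩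
  have three : ENNReal.ofReal (ε / 3) + (ENNReal.ofReal (ε / 3) + ENNReal.ofReal (ε / 3)) =
      ENNReal.ofReal ε := by
    rw [← ENNReal.ofReal_add hε3.le hε3.le, ← ENNReal.ofReal_add hε3.le (by positivity)]
    congr 1
    ring
  refine ⟨fun x => cutoff n R x * f₁ x, fun x => cutoff n R x • g₁ x +
    leibnizTerm α (cutoff n R) f₁ x, (contDiff_cutoff R).mul hsm,
    (hasCompactSupport_cutoff hR).mono fun x hx h0 => hx (by simp [h0]), hcg.add hGL,
    hw₁.cutoff_mul hn hα0 hα1 hp1 hf₁ hR, ?_, ?_⟩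
  · have e : (f - fun x => cutoff n R x * f₁ x) =
        (f - f₁) - ((fun x => cutoff n R x • f₁ x - f₁ x) : Rn n → ℝ) := by
      ext x
      simp
    rw [e, ← three]
    refine (eLpNorm_sub_le (hf.1.sub hf₁.1) (hcf.1.sub hf₁.1) hp1).trans (add_le_add ?_ ?_)
    · rw [eLpNorm_sub_comm]
      exact a₁
    · exact c₁.trans le_self_add
  · have e : (g - fun x => cutoff n R x • g₁ x + leibnizTerm α (cutoff n R) f₁ x) =
        (g - g₁) - ((fun x => cutoff n R x • g₁ x - g₁ x) + leibnizTerm α (cutoff n R) f₁) := by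
      ext1 x
      simp only [Pi.sub_apply, Pi.add_apply]
      abel
    rw [e, ← three]
    refine (eLpNorm_sub_le (hg.1.sub hg₁.1) ((hcg.1.sub hg₁.1).add hGm) hp1).trans
      (add_le_add ?_ ((eLpNorm_add_le (hcg.1.sub hg₁.1) hGm hp1).trans (add_le_add c₂ hRG)))
    rw [eLpNorm_sub_comm]
    exact a₂

theorem mem_S_of_isWeakFracGrad {p : ℝ≥0∞} {f : Lp ℝ p (volume : Measure (Rn n))}
    {f' : Rn n → ℝ} {g : Rn n → Rn n} (hf : f =ᵐ[volume] f') (hg : MemLp g p)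
    (h : IsWeakFracGrad α f' g) :
    f ∈ S n α p ∧ normS α f = ‖f‖ + (eLpNorm g p volume).toReal := by
  have h1 : IsWeakFracGrad α f hg.toLp := h.congr hf.symm hg.coeFn_toLp.symm
  refine ⟨⟨hg.toLp, h1⟩, ?_⟩
  rw [normS, weakFracGrad_eq h1, Lp.norm_toLp]

theorem testFunctions_subset_S (hn : 1 ≤ n) (hα0 : 0 < α) (hα1 : α < 1) {p : ℝ≥0∞}
    (hp1 : 1 ≤ p) : testFunctions n p ⊆ S n α p := by
  rintro u ⟨v, hv, hvc, huv⟩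
  exact (mem_S_of_isWeakFracGrad huv (memLp_fracGrad hn hα0 hα1 (hvc.toSchwartzMap hv) hp1)
    (isWeakFracGrad_schwartz hn hα0 hα1 (hvc.toSchwartzMap hv))).1

/-- Test functions are dense in the fractional Sobolev space. -/
theorem exists_testFunction_normS_lt (hn : 1 ≤ n) (hα0 : 0 < α) (hα1 : α < 1) {p : ℝ≥0∞}
    (hp1 : 1 ≤ p) (hp : p ≠ ⊤) {f : Lp ℝ p (volume : Measure (Rn n))} (hf : f ∈ S n α p)
    {ε : ℝ} (hε : 0 < ε) :
    ∃ u ∈ testFunctions n p, f - u ∈ S n α p ∧ normS α (f - u) < ε := by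
  obtain ⟨g, hg⟩ := hf
  have hε3 : 0 < ε / 3 := by positivity
  obtain ⟨u, gu, hu, huc, hgu, hw, h1, h2⟩ := exists_test_approx hn hα0 hα1 hp1 hp (Lp.memLp f)
    (Lp.memLp g) hg hε3
  have huL : MemLp u p := hu.continuous.memLp_of_hasCompactSupport huc
  refine ⟨huL.toLp, ⟨u, hu, huc, huL.coeFn_toLp⟩, ?_⟩
  have hsub : ((f - huL.toLp : Lp ℝ p (volume : Measure (Rn n))) : Rn n → ℝ) =ᵐ[volume] f - u := by
    filter_upwards [Lp.coeFn_sub f huL.toLp, huL.coeFn_toLp] with x hx hx'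
    rw [hx, Pi.sub_apply, Pi.sub_apply, hx']
  obtain ⟨m1, m2⟩ := mem_S_of_isWeakFracGrad hsub ((Lp.memLp g).sub hgu)
    (hg.sub hn hα0 hα1 hp1 (Lp.memLp f) huL hw)
  refine ⟨m1, ?_⟩
  rw [m2, Lp.norm_def, eLpNorm_congr_ae hsub]
  have b1 := ENNReal.toReal_le_of_le_ofReal hε3.le h1
  have b2 := ENNReal.toReal_le_of_le_ofReal hε3.le h2
  linarith

end Density

/-! ### M. Riesz's theorem for truncated Hilbert kernels on the line. -/

section Hilbert

/-- The pointwise inequality behind the theorem of M. Riesz on conjugate functions. -/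
theorem exists_norm_rpow_le_re {p : ℝ} (hp1 : 1 < p) (hp2 : p ≤ 2) :
    ∃ A B : ℝ, 0 ≤ A ∧ ∀ w : ℂ, 0 < w.re → ‖w‖ ^ p ≤ A * w.re ^ p - B * (w ^ (p : ℂ)).re := by
  have hp0 : 0 < p := by linarith
  have hπ := Real.pi_pos
  -- The midpoint of `π/(2p)` and `π/2`, an interval that is nonempty because `p > 1`. Thus `cos θ₀
  -- > 0` while `cos(p θ₀) < 0`.
  set θ₀ : ℝ := (Real.pi / (2 * p) + Real.pi / 2) / 2 with hθ₀
  have h1 : Real.pi / (2 * p) < Real.pi / 2 := by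
    apply div_lt_div_of_pos_left hπ (by norm_num) (by linarith)
  have h2 : Real.pi / (2 * p) < θ₀ := by rw [hθ₀]; linarith
  have h3 : θ₀ < Real.pi / 2 := by rw [hθ₀]; linarith
  have h0 : 0 < θ₀ := lt_trans (by positivity) h2
  have h4 : Real.pi / 2 < p * θ₀ := by
    rw [div_lt_iff₀ (by positivity)] at h2
    linarith
  have h5 : p * θ₀ < Real.pi := by nlinarith
  have h6 : Real.cos (p * θ₀) < 0 := Real.cos_neg_of_pi_div_two_lt_of_lt h4 (by linarith)
  have h7 : 0 < Real.cos θ₀ := Real.cos_pos_of_mem_Ioo ⟨by linarith, h3⟩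
  -- Normalized so that `B cos(p θ₀) = -1`.
  set B : ℝ := (-Real.cos (p * θ₀))⁻¹ with hB
  have hB0 : 0 < B := inv_pos.2 (by linarith)
  refine ⟨(1 + B) / Real.cos θ₀ ^ p, B, by positivity, fun w hw => ?_⟩
  have harg : |w.arg| < Real.pi / 2 := Complex.abs_arg_lt_pi_div_two_iff.2 (Or.inl hw)
  have hcos : Real.cos (w.arg * p) = Real.cos (p * |w.arg|) := by
    rcases abs_choice w.arg with h | h <;> rw [h]
    · rw [mul_comm]
    · rw [mul_neg, Real.cos_neg, mul_comm]
  have hc : 0 < Real.cos w.arg := Real.cos_pos_of_mem_Ioo ⟨(abs_lt.1 harg).1, (abs_lt.1 harg).2⟩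
  rw [Complex.cpow_ofReal_re, ← Complex.norm_mul_cos_arg w,
    Real.mul_rpow (norm_nonneg w) hc.le, hcos]
  have key : 1 ≤ (1 + B) / Real.cos θ₀ ^ p * Real.cos w.arg ^ p - B * Real.cos (p * |w.arg|) := by
    -- In the sector `|arg w| ≤ θ₀` the real part is comparable to `|w|`, and `A` absorbs the other
    -- term. Outside it `p |arg w|` lies in `[p θ₀, π]` because `p ≤ 2`, so `-B cos(p |arg w|) ≥ 1`.
    rcases le_total |w.arg| θ₀ with h | h
    · have e1 : Real.cos θ₀ ≤ Real.cos w.arg := by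
        rw [← Real.cos_abs w.arg]
        exact Real.cos_le_cos_of_nonneg_of_le_pi (abs_nonneg _) (by linarith) h
      have e2 : Real.cos θ₀ ^ p ≤ Real.cos w.arg ^ p := Real.rpow_le_rpow h7.le e1 hp0.le
      have e3 : 0 < Real.cos θ₀ ^ p := by positivity
      have e4 : 1 + B ≤ (1 + B) / Real.cos θ₀ ^ p * Real.cos w.arg ^ p := by
        rw [div_mul_eq_mul_div, le_div_iff₀ e3]
        gcongr
      have e5 : B * Real.cos (p * |w.arg|) ≤ B * 1 := by gcongr; exact Real.cos_le_one _
      linarith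
    · have e1 : Real.cos (p * |w.arg|) ≤ Real.cos (p * θ₀) :=
        Real.cos_le_cos_of_nonneg_of_le_pi (by positivity) (by nlinarith) (by gcongr)
      have e2 : B * Real.cos (p * |w.arg|) ≤ B * Real.cos (p * θ₀) := by gcongr
      have e3 : B * Real.cos (p * θ₀) = -1 := by
        rw [hB, inv_neg, neg_mul, inv_mul_cancel₀ h6.ne]
      have e4 : 0 ≤ (1 + B) / Real.cos θ₀ ^ p * Real.cos w.arg ^ p := by positivity
      linarith
  have := mul_le_mul_of_nonneg_left key (Real.rpow_nonneg (norm_nonneg w) p)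
  calc _ = ‖w‖ ^ p * 1 := (mul_one _).symm
    _ ≤ _ := this
    _ = _ := by ring

/-- The Cauchy integral of `f` in the upper half plane. -/
noncomputable def cauchyInt (f : ℝ → ℝ) (z : ℂ) : ℂ := ∫ t, (f t : ℂ) * (Complex.I / (z - t))

theorem im_le_norm_sub (z : ℂ) (t : ℝ) : z.im ≤ ‖z - t‖ := by
  have := Complex.abs_im_le_norm (z - t)
  simp only [Complex.sub_im, Complex.ofReal_im, sub_zero] at this
  exact (le_abs_self _).trans this

theorem sub_ofReal_ne_zero {z : ℂ} (hz : 0 < z.im) (t : ℝ) : z - t ≠ 0 :=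
  norm_pos_iff.1 (hz.trans_le (im_le_norm_sub z t))

variable {f : ℝ → ℝ}

theorem continuous_cauchy_integrand (hf : Continuous f) {z : ℂ} (hz : 0 < z.im) :
    Continuous fun t : ℝ => (f t : ℂ) * (Complex.I / (z - t)) :=
  (Complex.continuous_ofReal.comp hf).mul (continuous_const.div
    (continuous_const.sub Complex.continuous_ofReal) fun t => sub_ofReal_ne_zero hz t)

theorem integrable_cauchy_integrand (hf : Continuous f) (hfc : HasCompactSupport f) {z : ℂ}
    (hz : 0 < z.im) : Integrable fun t : ℝ => (f t : ℂ) * (Complex.I / (z - t)) :=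
  (continuous_cauchy_integrand hf hz).integrable_of_hasCompactSupport
    (hfc.mono fun t ht h0 => ht (by simp [h0]))

theorem differentiableAt_cauchyInt (hf : Continuous f) (hfc : HasCompactSupport f) {z : ℂ}
    (hz : 0 < z.im) : DifferentiableAt ℂ (cauchyInt f) z := by
  have hfi : Integrable f := hf.integrable_of_hasCompactSupport hfc
  set s : Set ℂ := {w | z.im / 2 < w.im}
  have hs : s ∈ 𝓝 z :=
    (isOpen_lt continuous_const Complex.continuous_im).mem_nhds (by
      change z.im / 2 < z.im
      linarith)
  have hs0 : ∀ w ∈ s, 0 < w.im := fun w hw => lt_trans (by linarith) (show z.im / 2 < w.im from hw)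
  have := hasDerivAt_integral_of_dominated_loc_of_deriv_le (μ := (volume : Measure ℝ)) (𝕜 := ℂ)
    (F := fun w t => (f t : ℂ) * (Complex.I / (w - t)))
    (F' := fun w t => (f t : ℂ) * (-Complex.I / (w - t) ^ 2))
    (bound := fun t => ‖f t‖ * (1 / (z.im / 2) ^ 2)) hs
    (by
      filter_upwards [hs] with w hw
      exact (continuous_cauchy_integrand hf (hs0 w hw)).aestronglyMeasurable)
    (integrable_cauchy_integrand hf hfc hz)
    (((Complex.continuous_ofReal.comp hf).mul (continuous_const.div
      ((continuous_const.sub Complex.continuous_ofReal).pow 2)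
      fun t => pow_ne_zero 2 (sub_ofReal_ne_zero hz t))).aestronglyMeasurable)
    (Eventually.of_forall fun t w hw => by
      rw [norm_mul, norm_div, norm_neg, Complex.norm_I, norm_pow, Complex.norm_real]
      have h1 := im_le_norm_sub w t
      have h2 : z.im / 2 < w.im := hw
      gcongr
      linarith)
    (hfi.norm.mul_const _)
    (Eventually.of_forall fun t w hw => by
      have h1 : HasDerivAt (fun w : ℂ => w - t) 1 w := (hasDerivAt_id w).sub_const _
      have h2 := (h1.inv (sub_ofReal_ne_zero (hs0 w hw) t)).const_mul Complex.I
      have h3 := h2.const_mul (f t : ℂ)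
      have e : (f t : ℂ) * (Complex.I * (-1 / (w - t) ^ 2)) =
          (f t : ℂ) * (-Complex.I / (w - t) ^ 2) := by ring
      rw [e] at h3
      exact h3)
  exact this.2.differentiableAt

/-- Decay like `1/|z|` above height `ε`: with `p > 1` it makes `|F|^p` integrable on horizontal
lines and the remote sides of the contour negligible. -/
theorem exists_norm_cauchyInt_le (hf : Continuous f) (hfc : HasCompactSupport f) {ε : ℝ}
    (hε : 0 < ε) : ∃ C, 0 ≤ C ∧ ∀ z : ℂ, ε ≤ z.im → ‖cauchyInt f z‖ ≤ C / (1 + ‖z‖) := by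
  have hfi : Integrable f := hf.integrable_of_hasCompactSupport hfc
  obtain ⟨R, hR, hb⟩ := hfc.isCompact.isBounded.exists_pos_norm_le
  -- Chosen so that `1 + ‖z‖ ≤ c ‖z - t‖` for `|t| ≤ R` and `Im z ≥ ε`, using `‖z - t‖ ≥ ε`.
  set c : ℝ := (1 + R) / ε + 1
  have hc : 0 < c := by positivity
  refine ⟨(∫ t, ‖f t‖) * c, by positivity, fun z hz => ?_⟩
  have hz0 : 0 < z.im := hε.trans_le hz
  rw [cauchyInt, mul_div_assoc, ← integral_mul_const]
  refine norm_integral_le_of_norm_le (hfi.norm.mul_const _) (Eventually.of_forall fun t => ?_)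
  rw [norm_mul, Complex.norm_real]
  by_cases ht : t ∈ tsupport f
  · gcongr
    have h1 := im_le_norm_sub z t
    have h2 : ‖z‖ ≤ ‖z - t‖ + R := by
      have := norm_add_le (z - t) (t : ℂ)
      rw [sub_add_cancel, Complex.norm_real] at this
      linarith [hb t ht]
    have hd : 0 < ‖z - t‖ := hz0.trans_le h1
    rw [norm_div, Complex.norm_I, div_le_div_iff₀ hd (by positivity), one_mul]
    have h3 : 1 + R ≤ (1 + R) / ε * ‖z - t‖ := by
      rw [div_mul_eq_mul_div, le_div_iff₀ hε]
      have : ε ≤ ‖z - t‖ := hz.trans h1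
      gcongr
    calc 1 + ‖z‖ ≤ (1 + R) / ε * ‖z - t‖ + ‖z - t‖ := by linarith
      _ = c * ‖z - t‖ := by ring
  · rw [image_eq_zero_of_notMem_tsupport ht]
    simp

theorem re_I_div_sub (z : ℂ) (t : ℝ) : (Complex.I / (z - t)).re = z.im / ((z.re - t) ^ 2 + z.im ^ 2) := by
  simp [Complex.div_re, Complex.normSq_apply, pow_two]

theorem im_I_div_sub (z : ℂ) (t : ℝ) :
    (Complex.I / (z - t)).im = (z.re - t) / ((z.re - t) ^ 2 + z.im ^ 2) := by
  simp [Complex.div_im, Complex.normSq_apply, pow_two]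

theorem re_cauchyInt (hf : Continuous f) (hfc : HasCompactSupport f) {z : ℂ} (hz : 0 < z.im) :
    (cauchyInt f z).re = ∫ t, f t * (z.im / ((z.re - t) ^ 2 + z.im ^ 2)) := by
  rw [cauchyInt, ← Complex.reCLM_apply,
    ← Complex.reCLM.integral_comp_comm (integrable_cauchy_integrand hf hfc hz)]
  refine integral_congr_ae (Eventually.of_forall fun t => ?_)
  simp only [Complex.reCLM_apply, Complex.re_ofReal_mul, re_I_div_sub]

theorem im_cauchyInt (hf : Continuous f) (hfc : HasCompactSupport f) {z : ℂ} (hz : 0 < z.im) :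
    (cauchyInt f z).im = ∫ t, f t * ((z.re - t) / ((z.re - t) ^ 2 + z.im ^ 2)) := by
  rw [cauchyInt, ← Complex.imCLM_apply,
    ← Complex.imCLM.integral_comp_comm (integrable_cauchy_integrand hf hfc hz)]
  refine integral_congr_ae (Eventually.of_forall fun t => ?_)
  simp only [Complex.imCLM_apply, Complex.im_ofReal_mul, im_I_div_sub]

/-- The real part is the integral of `f` against a multiple of the Poisson kernel, which is
positive. Values in the right half plane make the principal power `F^p` holomorphic. -/
theorem re_cauchyInt_pos (hf : Continuous f) (hfc : HasCompactSupport f) (h0 : 0 ≤ f) {t₀ : ℝ}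
    (ht₀ : f t₀ ≠ 0) {z : ℂ} (hz : 0 < z.im) : 0 < (cauchyInt f z).re := by
  rw [re_cauchyInt hf hfc hz]
  have hpos : ∀ t : ℝ, 0 < (z.re - t) ^ 2 + z.im ^ 2 := fun t => by positivity
  refine Continuous.integral_pos_of_hasCompactSupport_nonneg_nonzero (x := t₀) ?_ ?_ ?_ ?_
  · exact hf.mul (continuous_const.div (by fun_prop) fun t => (hpos t).ne')
  · exact hfc.mono fun t ht h0 => ht (by simp [h0])
  · intro t
    have := hpos t
    exact mul_nonneg (h0 t) (by positivity)
  · exact mul_ne_zero ht₀ (div_pos hz (hpos t₀)).ne'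

theorem norm_cauchyInt_cpow (p : ℝ) {z : ℂ} (h : 0 < (cauchyInt f z).re) :
    ‖cauchyInt f z ^ (p : ℂ)‖ = ‖cauchyInt f z‖ ^ p := by
  have hne : cauchyInt f z ≠ 0 := fun h0 => by simp [h0] at h
  exact Complex.norm_cpow_real _ _

theorem integrable_line_cauchyInt (hf : Continuous f) (hfc : HasCompactSupport f) {p : ℝ}
    (hp1 : 1 < p) {ε : ℝ} (hε : 0 < ε) :
    Integrable fun x : ℝ => ‖cauchyInt f (x + ε * Complex.I)‖ ^ p := by
  obtain ⟨C, hC0, hC⟩ := exists_norm_cauchyInt_le hf hfc hε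
  have hi : Integrable fun x : ℝ => C ^ p * (1 + ‖x‖) ^ (-p) :=
    (integrable_one_add_norm (by simpa using hp1)).const_mul _
  have hcont : Continuous fun x : ℝ => cauchyInt f (x + ε * Complex.I) := by
    refine continuous_iff_continuousAt.2 fun x => ?_
    have h1 := (differentiableAt_cauchyInt hf hfc (z := x + ε * Complex.I)
      (by simpa using hε)).continuousAt
    exact ContinuousAt.comp (f := fun x : ℝ => (x : ℂ) + ε * Complex.I) h1 (by fun_prop)
  refine hi.mono' (hcont.norm.rpow_const fun x => Or.inr (by linarith)).aestronglyMeasurable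
    (Eventually.of_forall fun x => ?_)
  rw [Real.norm_of_nonneg (by positivity), Real.rpow_neg (by positivity), ← div_eq_mul_inv,
    ← Real.div_rpow hC0 (by positivity)]
  refine Real.rpow_le_rpow (norm_nonneg _) ((hC _ (by simp)).trans ?_) (by linarith)
  have : ‖x‖ ≤ ‖(x : ℂ) + ε * Complex.I‖ := by
    have := Complex.abs_re_le_norm ((x : ℂ) + ε * Complex.I)
    simpa using this
  gcongr

/-- The powers of a Cauchy integral have vanishing integrals over horizontal lines. -/
theorem integral_cauchyInt_cpow_eq_zero (hf : Continuous f) (hfc : HasCompactSupport f)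
    (h0 : 0 ≤ f) {t₀ : ℝ} (ht₀ : f t₀ ≠ 0) {p : ℝ} (hp1 : 1 < p) {ε : ℝ} (hε : 0 < ε) :
    Integrable (fun x : ℝ => cauchyInt f (x + ε * Complex.I) ^ (p : ℂ)) ∧
    ∫ x : ℝ, cauchyInt f (x + ε * Complex.I) ^ (p : ℂ) = 0 := by
  have hp0 : 0 ≤ p := by linarith
  have hdiff : ∀ z : ℂ, 0 < z.im → DifferentiableAt ℂ (fun z => cauchyInt f z ^ (p : ℂ)) z :=
    fun z hz => (differentiableAt_cauchyInt hf hfc hz).cpow_const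
      (Or.inl (re_cauchyInt_pos hf hfc h0 ht₀ hz))
  have hcont : Continuous fun x : ℝ => cauchyInt f (x + ε * Complex.I) ^ (p : ℂ) := by
    refine continuous_iff_continuousAt.2 fun x => ?_
    have h1 := (hdiff (x + ε * Complex.I) (by simpa using hε)).continuousAt
    exact ContinuousAt.comp (f := fun x : ℝ => (x : ℂ) + ε * Complex.I) h1 (by fun_prop)
  have hint : Integrable (fun x : ℝ => cauchyInt f (x + ε * Complex.I) ^ (p : ℂ)) :=
    (integrable_line_cauchyInt hf hfc hp1 hε).mono' hcont.aestronglyMeasurable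
      (Eventually.of_forall fun x => (norm_cauchyInt_cpow p (re_cauchyInt_pos hf hfc h0 ht₀
        (by simpa using hε))).le)
  refine ⟨hint, ?_⟩
  obtain ⟨C, hC0, hC⟩ := exists_norm_cauchyInt_le hf hfc hε
  have hlim := intervalIntegral_tendsto_integral hint tendsto_neg_atTop_atBot
    (tendsto_id (α := ℝ) (x := atTop))
  -- Cauchy's theorem on the rectangle with corners `-T + iε` and `T + iT`. The other three sides
  -- have total length at most `4T`, and there `|F^p| ≤ (C/T)^p`; the bound `4 C^p T^{1-p}` vanishes
  -- in the limit since `p > 1`.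
  refine tendsto_nhds_unique hlim (squeeze_zero_norm' (a := fun T => 4 * C ^ p * T ^ (-(p - 1)))
    ?_ ?_)
  swap
  · simpa using (tendsto_rpow_neg_atTop (sub_pos.2 hp1)).const_mul (4 * C ^ p)
  filter_upwards [eventually_gt_atTop ε] with T hT
  have hT0 : 0 < T := hε.trans hT
  have hrect := Complex.integral_boundary_rect_eq_zero_of_differentiableOn
    (fun z => cauchyInt f z ^ (p : ℂ)) (-T + ε * Complex.I) (T + T * Complex.I) (by
      intro z hz
      refine (hdiff z ?_).differentiableWithinAt
      have := hz.2
      simp only [Set.mem_preimage, Complex.add_im, Complex.neg_im, Complex.ofReal_im,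
        Complex.mul_im, Complex.ofReal_re, Complex.I_im, mul_one, Complex.I_re, mul_zero, add_zero,
        neg_zero, zero_add, Set.uIcc_of_le hT.le] at this
      exact hε.trans_le this.1)
  simp only [Complex.add_re, Complex.neg_re, Complex.ofReal_re, Complex.mul_re, Complex.I_re,
    mul_zero, Complex.ofReal_im, Complex.I_im, mul_one, sub_self, add_zero, Complex.add_im,
    Complex.neg_im, Complex.mul_im, neg_zero, zero_add] at hrect
  have hb : ∀ z : ℂ, ε ≤ z.im → T ≤ ‖z‖ → ‖cauchyInt f z ^ (p : ℂ)‖ ≤ (C / T) ^ p := by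
    intro z hz hzT
    rw [norm_cauchyInt_cpow p (re_cauchyInt_pos hf hfc h0 ht₀ (hε.trans_le hz))]
    refine Real.rpow_le_rpow (norm_nonneg _) ((hC z hz).trans ?_) hp0
    gcongr
    linarith
  have b1 : ‖∫ x in (-T)..T, cauchyInt f (x + T * Complex.I) ^ (p : ℂ)‖ ≤ (C / T) ^ p * (2 * T) := by
    have := intervalIntegral.norm_integral_le_of_norm_le_const (a := -T) (b := T)
      (f := fun x : ℝ => cauchyInt f (x + T * Complex.I) ^ (p : ℂ)) (C := (C / T) ^ p)
      fun x _ => hb _ (by simpa using hT.le) (by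
        have := Complex.abs_im_le_norm ((x : ℂ) + T * Complex.I)
        simp at this
        exact (le_abs_self T).trans this)
    rwa [sub_neg_eq_add, ← two_mul, abs_of_pos (by positivity)] at this
  have b2 : ∀ a : ℝ, |a| = T →
      ‖∫ y in ε..T, cauchyInt f (a + y * Complex.I) ^ (p : ℂ)‖ ≤ (C / T) ^ p * T := by
    intro a ha
    have := intervalIntegral.norm_integral_le_of_norm_le_const (a := ε) (b := T)
      (f := fun y : ℝ => cauchyInt f (a + y * Complex.I) ^ (p : ℂ)) (C := (C / T) ^ p)
      fun y hy => hb _ (by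
        rw [Set.uIoc_of_le hT.le] at hy
        simpa using hy.1.le) (by
        have := Complex.abs_re_le_norm ((a : ℂ) + y * Complex.I)
        simp [ha] at this
        exact this)
    refine this.trans ?_
    rw [abs_of_pos (by linarith)]
    gcongr
    linarith
  have b3 := b2 T (abs_of_pos hT0)
  have b4 := b2 (-T) (by rw [abs_neg, abs_of_pos hT0])
  have e : ∫ x in (-T)..T, cauchyInt f (x + ε * Complex.I) ^ (p : ℂ) =
      (∫ x in (-T)..T, cauchyInt f (x + T * Complex.I) ^ (p : ℂ)) -
      Complex.I • (∫ y in ε..T, cauchyInt f (T + y * Complex.I) ^ (p : ℂ)) +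
      Complex.I • (∫ y in ε..T, cauchyInt f ((-T : ℝ) + y * Complex.I) ^ (p : ℂ)) := by
    push_cast at hrect ⊢
    linear_combination hrect
  simp only [id]
  rw [e]
  calc _ ≤ (C / T) ^ p * (2 * T) + (C / T) ^ p * T + (C / T) ^ p * T := by
        refine (norm_add_le _ _).trans (add_le_add ((norm_sub_le _ _).trans (add_le_add b1 ?_)) ?_)
        · rw [norm_smul, Complex.norm_I, one_mul]; exact b3
        · rw [norm_smul, Complex.norm_I, one_mul]; exact b4
    _ = 4 * ((C / T) ^ p * T) := by ring
    _ = 4 * C ^ p * T ^ (-(p - 1)) := by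
        rw [Real.div_rpow hC0 hT0.le, neg_sub, Real.rpow_sub hT0, Real.rpow_one]
        ring

theorem lintegral_poisson_le {ε : ℝ} (hε : 0 < ε) :
    ∫⁻ y : ℝ, ENNReal.ofReal (ε / (y ^ 2 + ε ^ 2)) ≤ ENNReal.ofReal Real.pi := by
  have h1 : ∀ y : ℝ, ε / (y ^ 2 + ε ^ 2) = ε⁻¹ * (1 + (ε⁻¹ * y) ^ 2)⁻¹ := fun y => by
    field_simp
    ring
  have hi : Integrable fun y : ℝ => ε⁻¹ * (1 + (ε⁻¹ * y) ^ 2)⁻¹ :=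
    (integrable_inv_one_add_sq.comp_mul_left' (inv_ne_zero hε.ne')).const_mul _
  simp_rw [h1]
  rw [← ofReal_integral_eq_lintegral_ofReal hi (Eventually.of_forall fun y => by positivity)]
  refine ENNReal.ofReal_le_ofReal (le_of_eq ?_)
  rw [integral_const_mul, Measure.integral_comp_mul_left (fun y : ℝ => (1 + y ^ 2)⁻¹) ε⁻¹,
    integral_univ_inv_one_add_sq, inv_inv, abs_of_pos hε, smul_eq_mul]
  field_simp

/-- Young's inequality: the real part is a convolution with a kernel of mass at most `π`, whatever
`ε`. -/
theorem lintegral_re_cauchyInt_rpow_le (hf : Continuous f) (hfc : HasCompactSupport f) {p : ℝ}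
    (hp1 : 1 < p) {ε : ℝ} (hε : 0 < ε) :
    ∫⁻ x : ℝ, ‖(cauchyInt f (x + ε * Complex.I)).re‖ₑ ^ p ≤
      ENNReal.ofReal Real.pi ^ p * ∫⁻ t, ‖f t‖ₑ ^ p := by
  have hm : AEMeasurable (fun y : ℝ => ENNReal.ofReal (ε / (y ^ 2 + ε ^ 2))) := by
    have : Measurable fun y : ℝ => ε / (y ^ 2 + ε ^ 2) := by fun_prop
    exact this.ennreal_ofReal.aemeasurable
  have hfm : AEMeasurable (fun t => ‖f t‖ₑ) := hf.measurable.enorm.aemeasurable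
  calc ∫⁻ x : ℝ, ‖(cauchyInt f (x + ε * Complex.I)).re‖ₑ ^ p
      ≤ ∫⁻ x : ℝ, (∫⁻ y, ENNReal.ofReal (ε / (y ^ 2 + ε ^ 2)) * ‖f (x - y)‖ₑ) ^ p := by
        refine lintegral_mono fun x => ENNReal.rpow_le_rpow ?_ (by linarith)
        rw [re_cauchyInt hf hfc (by simpa using hε),
          ← integral_sub_left_eq_self _ volume x]
        refine (enorm_integral_le_lintegral_enorm _).trans (lintegral_mono fun y => ?_)
        simp only [Complex.add_re, Complex.ofReal_re, Complex.mul_re, Complex.I_re, mul_zero,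
          Complex.ofReal_im, Complex.I_im, sub_self, add_zero, Complex.add_im, Complex.mul_im,
          mul_one, zero_add, sub_sub_cancel]
        rw [enorm_mul, mul_comm, Real.enorm_of_nonneg (by positivity)]
    _ ≤ (∫⁻ y : ℝ, ENNReal.ofReal (ε / (y ^ 2 + ε ^ 2))) ^ p * ∫⁻ t, ‖f t‖ₑ ^ p :=
        lintegral_conv_rpow_le hp1.le hm hfm
    _ ≤ _ := by
        gcongr
        exact lintegral_poisson_le hε

/-- Integrate the pointwise inequality over a horizontal line. The term `Re F^p` has integral zero,
so `∫ |F|^p ≤ A ∫ (Re F)^p`, and the real part obeys the Poisson bound. -/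
theorem exists_lintegral_im_cauchyInt_le_of_nonneg {p : ℝ} (hp1 : 1 < p) (hp2 : p ≤ 2) :
    ∃ C : ℝ≥0∞, C ≠ ⊤ ∧ ∀ f : ℝ → ℝ, Continuous f → HasCompactSupport f → 0 ≤ f → ∀ ε : ℝ, 0 < ε →
      ∫⁻ x : ℝ, ‖(cauchyInt f (x + ε * Complex.I)).im‖ₑ ^ p ≤ C * ∫⁻ t, ‖f t‖ₑ ^ p := by
  obtain ⟨A, B, hA, hAB⟩ := exists_norm_rpow_le_re hp1 hp2
  have hp0 : 0 ≤ p := by linarith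
  refine ⟨ENNReal.ofReal A * ENNReal.ofReal Real.pi ^ p, by finiteness, ?_⟩
  intro f hf hfc h0 ε hε
  -- Strict positivity of the real part needs a point where `f` does not vanish.
  by_cases hz : ∀ t, f t = 0
  · have : f = 0 := funext hz
    subst this
    simp [cauchyInt, ENNReal.zero_rpow_of_pos (by linarith : 0 < p)]
  push Not at hz
  obtain ⟨t₀, ht₀⟩ := hz
  obtain ⟨hi, hi0⟩ := integral_cauchyInt_cpow_eq_zero hf hfc h0 ht₀ hp1 hε
  have hline := integrable_line_cauchyInt hf hfc hp1 hε
  have hpos : ∀ x : ℝ, 0 < (cauchyInt f (x + ε * Complex.I)).re := fun x =>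
    re_cauchyInt_pos hf hfc h0 ht₀ (by simpa using hε)
  have hcont : Continuous fun x : ℝ => cauchyInt f (x + ε * Complex.I) := by
    refine continuous_iff_continuousAt.2 fun x => ?_
    have h1 := (differentiableAt_cauchyInt hf hfc (z := x + ε * Complex.I)
      (by simpa using hε)).continuousAt
    exact ContinuousAt.comp (f := fun x : ℝ => (x : ℂ) + ε * Complex.I) h1 (by fun_prop)
  have hre : Integrable fun x : ℝ => (cauchyInt f (x + ε * Complex.I)).re ^ p := by
    refine hline.mono' ((Complex.continuous_re.comp hcont).rpow_const
      fun x => Or.inr hp0).aestronglyMeasurable (Eventually.of_forall fun x => ?_)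
    have := hpos x
    rw [Real.norm_of_nonneg (by positivity)]
    exact Real.rpow_le_rpow this.le (Complex.re_le_norm _) hp0
  have h1 : ∫ x : ℝ, ‖cauchyInt f (x + ε * Complex.I)‖ ^ p ≤
      A * ∫ x : ℝ, (cauchyInt f (x + ε * Complex.I)).re ^ p := by
    calc _ ≤ ∫ x : ℝ, (A * (cauchyInt f (x + ε * Complex.I)).re ^ p -
          B * (cauchyInt f (x + ε * Complex.I) ^ (p : ℂ)).re) :=
          integral_mono hline ((hre.const_mul A).sub (hi.re.const_mul B)) fun x => hAB _ (hpos x)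
      _ = _ := by
          have hire : Integrable fun x : ℝ => (cauchyInt f (x + ε * Complex.I) ^ (p : ℂ)).re :=
            hi.re
          have := integral_re hi
          simp only [RCLike.re_to_complex] at this
          rw [integral_sub (hre.const_mul A) (hire.const_mul B), integral_const_mul,
            integral_const_mul, this, hi0]
          simp
  have h2 : ∀ w : ℂ, ‖w.im‖ₑ ^ p ≤ ENNReal.ofReal (‖w‖ ^ p) := fun w => by
    rw [← ENNReal.ofReal_rpow_of_nonneg (norm_nonneg _) hp0]
    gcongr
    rw [← ofReal_norm]
    exact ENNReal.ofReal_le_ofReal (Complex.abs_im_le_norm w)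
  calc ∫⁻ x : ℝ, ‖(cauchyInt f (x + ε * Complex.I)).im‖ₑ ^ p
      ≤ ∫⁻ x : ℝ, ENNReal.ofReal (‖cauchyInt f (x + ε * Complex.I)‖ ^ p) :=
        lintegral_mono fun x => h2 _
    _ = ENNReal.ofReal (∫ x : ℝ, ‖cauchyInt f (x + ε * Complex.I)‖ ^ p) :=
        (ofReal_integral_eq_lintegral_ofReal hline
          (Eventually.of_forall fun x => by positivity)).symm
    _ ≤ ENNReal.ofReal (A * ∫ x : ℝ, (cauchyInt f (x + ε * Complex.I)).re ^ p) :=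
        ENNReal.ofReal_le_ofReal h1
    _ = ENNReal.ofReal A * ∫⁻ x : ℝ, ‖(cauchyInt f (x + ε * Complex.I)).re‖ₑ ^ p := by
        rw [ENNReal.ofReal_mul hA, ofReal_integral_eq_lintegral_ofReal hre
          (Eventually.of_forall fun x => (Real.rpow_nonneg (hpos x).le p))]
        congr 1
        refine lintegral_congr fun x => ?_
        rw [Real.enorm_of_nonneg (hpos x).le, ENNReal.ofReal_rpow_of_nonneg (hpos x).le hp0]
    _ ≤ _ := by
        rw [mul_assoc]
        gcongr
        exact lintegral_re_cauchyInt_rpow_le hf hfc hp1 hε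

/-- The theorem of M. Riesz for the truncated Hilbert kernels `r / (r ^ 2 + ε ^ 2)`, with a bound that
does not depend on `ε`. -/
theorem exists_lintegral_hilbert_le {p : ℝ} (hp1 : 1 < p) (hp2 : p ≤ 2) :
    ∃ C : ℝ≥0∞, C ≠ ⊤ ∧ ∀ f : ℝ → ℝ, Continuous f → HasCompactSupport f → ∀ ε : ℝ, 0 < ε →
      ∫⁻ s : ℝ, ‖∫ r, r / (r ^ 2 + ε ^ 2) * f (s - r)‖ₑ ^ p ≤ C * ∫⁻ t, ‖f t‖ₑ ^ p := by
  obtain ⟨C, hC, hbd⟩ := exists_lintegral_im_cauchyInt_le_of_nonneg hp1 hp2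
  have hp0 : 0 ≤ p := by linarith
  -- The positive and negative parts contribute `C` each, and `2^{p-1}` comes from convexity of the
  -- power. The truncated Hilbert integral is the imaginary part of the Cauchy integral at height
  -- `ε`.
  refine ⟨2 ^ (p - 1) * (C + C), by finiteness, fun f hf hfc ε hε => ?_⟩
  set fp : ℝ → ℝ := fun t => max (f t) 0
  set fm : ℝ → ℝ := fun t => max (-f t) 0
  have hfp : Continuous fp := hf.max continuous_const
  have hfm : Continuous fm := hf.neg.max continuous_const
  have hfpc : HasCompactSupport fp := hfc.mono fun t ht h0 => ht (by simp [fp, h0])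
  have hfmc : HasCompactSupport fm := hfc.mono fun t ht h0 => ht (by simp [fm, h0])
  have hsub : ∀ t, f t = fp t - fm t := fun t => by
    rcases le_total (f t) 0 with h | h <;> simp [fp, fm, h]
  have hle1 : ∀ t, ‖fp t‖ₑ ≤ ‖f t‖ₑ := fun t => by
    refine enorm_le_iff_norm_le.2 ?_
    rcases le_total (f t) 0 with h | h <;> simp [fp, h]
  have hle2 : ∀ t, ‖fm t‖ₑ ≤ ‖f t‖ₑ := fun t => by
    refine enorm_le_iff_norm_le.2 ?_
    rcases le_total (f t) 0 with h | h <;> simp [fm, h]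
  have hz : ∀ s : ℝ, 0 < ((s : ℂ) + ε * Complex.I).im := fun s => by simpa using hε
  have key : ∀ s : ℝ, ∫ r, r / (r ^ 2 + ε ^ 2) * f (s - r) =
      (cauchyInt fp (s + ε * Complex.I)).im - (cauchyInt fm (s + ε * Complex.I)).im := by
    intro s
    have e1 : (cauchyInt f (s + ε * Complex.I)) =
        cauchyInt fp (s + ε * Complex.I) - cauchyInt fm (s + ε * Complex.I) := by
      rw [cauchyInt, cauchyInt, cauchyInt, ← integral_sub
        (integrable_cauchy_integrand hfp hfpc (hz s)) (integrable_cauchy_integrand hfm hfmc (hz s))]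
      refine integral_congr_ae (Eventually.of_forall fun t => ?_)
      simp only [hsub t]
      push_cast
      ring
    rw [← Complex.sub_im, ← e1, im_cauchyInt hf hfc (hz s), ← integral_sub_left_eq_self _ volume s]
    refine integral_congr_ae (Eventually.of_forall fun r => ?_)
    simp [mul_comm]
  calc _ ≤ ∫⁻ s : ℝ, 2 ^ (p - 1) * (‖(cauchyInt fp (s + ε * Complex.I)).im‖ₑ ^ p +
        ‖(cauchyInt fm (s + ε * Complex.I)).im‖ₑ ^ p) := by
        refine lintegral_mono fun s => ?_
        rw [key s]
        exact (ENNReal.rpow_le_rpow (enorm_sub_le) hp0).trans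
          (ENNReal.rpow_add_le_mul_rpow_add_rpow _ _ hp1.le)
    _ = 2 ^ (p - 1) * ((∫⁻ s : ℝ, ‖(cauchyInt fp (s + ε * Complex.I)).im‖ₑ ^ p) +
        ∫⁻ s : ℝ, ‖(cauchyInt fm (s + ε * Complex.I)).im‖ₑ ^ p) := by
        rw [lintegral_const_mul' _ _ (by finiteness), lintegral_add_left]
        have hcont : Continuous fun x : ℝ => cauchyInt fp (x + ε * Complex.I) := by
          refine continuous_iff_continuousAt.2 fun x => ?_
          have h1 := (differentiableAt_cauchyInt hfp hfpc (hz x)).continuousAt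
          exact ContinuousAt.comp (f := fun x : ℝ => (x : ℂ) + ε * Complex.I) h1 (by fun_prop)
        exact ((Complex.continuous_im.comp hcont).measurable.enorm).pow_const p
    _ ≤ 2 ^ (p - 1) * ((C * ∫⁻ t, ‖f t‖ₑ ^ p) + C * ∫⁻ t, ‖f t‖ₑ ^ p) := by
        gcongr
        · refine (hbd fp hfp hfpc (fun t => le_max_right _ _) ε hε).trans ?_
          gcongr with t
          exact hle1 t
        · refine (hbd fm hfm hfmc (fun t => le_max_right _ _) ε hε).trans ?_
          gcongr with t
          exact hle2 t
    _ = _ := by ring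

end Hilbert

/-! ### Hilbert transforms along lines in `ℝⁿ`. -/

section DirectionalHilbert

variable {n : ℕ}

/-- Integration over `ℝⁿ` by integration over the lines parallel to `v`. -/
theorem lintegral_eq_lintegral_lines {v : Rn n} (hv : v ≠ 0) {h : Rn n → ℝ≥0∞}
    (hh : Measurable h) :
    ∫⁻ x, h x = ∫⁻ x, (Set.Ico (0 : ℝ) 1).indicator 1 (inner ℝ v x / ‖v‖ ^ 2) *
      ∫⁻ s : ℝ, h (x + s • v) := by
  have hv2 : ‖v‖ ^ 2 ≠ 0 := pow_ne_zero 2 (norm_ne_zero_iff.2 hv)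
  set I : ℝ → ℝ≥0∞ := (Set.Ico (0 : ℝ) 1).indicator 1 with hI
  have hIm : Measurable I := measurable_one.indicator measurableSet_Ico
  -- Inserting `1 = ∫ I(c - s) ds` with `c = ⟨v,x⟩/|v|²`, exchanging the integrals and translating
  -- by `s v` disintegrates Lebesgue measure along `v` without a choice of coordinates.
  have hI1 : ∀ c : ℝ, ∫⁻ s, I (c - s) = 1 := fun c => by
    rw [lintegral_sub_left_eq_self I c, hI, lintegral_indicator_one measurableSet_Ico]
    simp
  have hl : ∀ (x : Rn n) (s : ℝ), inner ℝ v (x - s • v) / ‖v‖ ^ 2 =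
      inner ℝ v x / ‖v‖ ^ 2 - s := fun x s => by
    rw [inner_sub_right, inner_smul_right, real_inner_self_eq_norm_sq, sub_div,
      mul_div_cancel_right₀ _ hv2]
  have hm : ∀ w : Rn n, Measurable fun x : Rn n => inner ℝ w x / ‖v‖ ^ 2 := fun w => by fun_prop
  calc ∫⁻ x, h x = ∫⁻ x, ∫⁻ s : ℝ, I (inner ℝ v x / ‖v‖ ^ 2 - s) * h x := by
        refine lintegral_congr fun x => ?_
        rw [lintegral_mul_const _ (by fun_prop), hI1, one_mul]
    _ = ∫⁻ s : ℝ, ∫⁻ x, I (inner ℝ v x / ‖v‖ ^ 2 - s) * h x := by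
        refine lintegral_lintegral_swap (Measurable.aemeasurable ?_)
        refine Measurable.mul (hIm.comp ?_) (hh.comp measurable_fst)
        exact ((hm v).comp measurable_fst).sub measurable_snd
    _ = ∫⁻ s : ℝ, ∫⁻ x, I (inner ℝ v x / ‖v‖ ^ 2) * h (x + s • v) := by
        refine lintegral_congr fun s => ?_
        rw [← lintegral_sub_right_eq_self (fun x => I (inner ℝ v x / ‖v‖ ^ 2) * h (x + s • v))
          (s • v)]
        refine lintegral_congr fun x => ?_
        rw [hl, sub_add_cancel]
    _ = ∫⁻ x, ∫⁻ s : ℝ, I (inner ℝ v x / ‖v‖ ^ 2) * h (x + s • v) := by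
        refine lintegral_lintegral_swap (Measurable.aemeasurable ?_)
        refine Measurable.mul (hIm.comp ((hm v).comp measurable_snd)) (hh.comp ?_)
        exact measurable_snd.add (measurable_fst.smul_const v)
    _ = _ := by
        refine lintegral_congr fun x => ?_
        exact lintegral_const_mul _ (by fun_prop)

/-- The truncated Hilbert transform in the direction `v`. -/
noncomputable def dirHilbert (ε : ℝ) (v : Rn n) (φ : Rn n → ℝ) (x : Rn n) : ℝ :=
  ∫ r : ℝ, r / (r ^ 2 + ε ^ 2) * φ (x - r • v)

theorem continuous_hilbertKernel {ε : ℝ} (hε : 0 < ε) :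
    Continuous fun r : ℝ => r / (r ^ 2 + ε ^ 2) :=
  continuous_id.div (by fun_prop) fun r => by positivity

theorem stronglyMeasurable_dirHilbert {ε : ℝ} (hε : 0 < ε) (v : Rn n) {φ : Rn n → ℝ}
    (hφ : Continuous φ) : StronglyMeasurable (dirHilbert ε v φ) := by
  have : Continuous fun z : Rn n × ℝ => z.2 / (z.2 ^ 2 + ε ^ 2) * φ (z.1 - z.2 • v) :=
    ((continuous_hilbertKernel hε).comp continuous_snd).mul (hφ.comp (by fun_prop))
  exact this.stronglyMeasurable.integral_prod_right

theorem hasCompactSupport_comp_line {v : Rn n} (hv : v ≠ 0) {φ : Rn n → ℝ}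
    (hφc : HasCompactSupport φ) (x : Rn n) : HasCompactSupport fun s : ℝ => φ (x + s • v) := by
  have hv0 : 0 < ‖v‖ := norm_pos_iff.2 hv
  obtain ⟨R, hR, hb⟩ := hφc.isCompact.isBounded.exists_pos_norm_le
  refine HasCompactSupport.intro (isCompact_closedBall (0 : ℝ) ((R + ‖x‖) / ‖v‖)) fun s hs => ?_
  rw [mem_closedBall_zero_iff, not_le, div_lt_iff₀ hv0, ← norm_smul] at hs
  refine image_eq_zero_of_notMem_tsupport fun hmem => ?_
  have h1 := hb _ hmem
  have h2 := norm_sub_le (x + s • v) x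
  rw [add_sub_cancel_left] at h2
  linarith

/-- On each line `s ↦ x + s v` the operator is the one-dimensional truncated Hilbert transform. The
parametrization by `v` itself makes the constant independent of `v` as well as of `ε`. -/
theorem exists_eLpNorm_dirHilbert_le {p : ℝ≥0∞} (hp1 : 1 < p) (hp2 : p ≤ 2) :
    ∃ C : ℝ≥0∞, C ≠ ⊤ ∧ ∀ φ : Rn n → ℝ, Continuous φ → HasCompactSupport φ → ∀ ε : ℝ, 0 < ε →
      ∀ v : Rn n, v ≠ 0 →
        eLpNorm (dirHilbert ε v φ) p volume ≤ C * eLpNorm φ p volume := by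
  have hpt : p ≠ ⊤ := (hp2.trans_lt (by simp)).ne
  have hp0 : p ≠ 0 := (zero_lt_one.trans hp1).ne'
  have h1 : 1 < p.toReal := by
    simpa using (ENNReal.toReal_lt_toReal ENNReal.one_ne_top hpt).2 hp1
  have h2 : p.toReal ≤ 2 := by
    simpa using (ENNReal.toReal_le_toReal hpt (by simp)).2 hp2
  obtain ⟨C, hC, hbd⟩ := exists_lintegral_hilbert_le h1 h2
  have hpos : 0 < p.toReal := by linarith
  refine ⟨C ^ (1 / p.toReal), by finiteness, fun φ hφ hφc ε hε v hv => ?_⟩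
  rw [eLpNorm_eq_lintegral_rpow_enorm_toReal hp0 hpt, eLpNorm_eq_lintegral_rpow_enorm_toReal hp0 hpt,
    ← ENNReal.mul_rpow_of_nonneg _ _ (by positivity)]
  refine ENNReal.rpow_le_rpow ?_ (by positivity)
  rw [lintegral_eq_lintegral_lines hv
    ((stronglyMeasurable_dirHilbert hε v hφ).measurable.enorm.pow_const _),
    lintegral_eq_lintegral_lines hv (hφ.measurable.enorm.pow_const p.toReal),
    ← lintegral_const_mul' _ _ hC]
  refine lintegral_mono fun x => ?_
  rw [mul_left_comm]
  gcongr
  refine le_trans (le_of_eq (lintegral_congr fun s => ?_)) (hbd (fun s => φ (x + s • v))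
    (hφ.comp (by fun_prop)) (hasCompactSupport_comp_line hv hφc x) ε hε)
  simp only [dirHilbert, sub_smul, add_sub_assoc]

/-- The correlation `z ↦ ∫ φ(x - z) ψ(x) dx`. -/
noncomputable def corr (φ ψ : Rn n → ℝ) (z : Rn n) : ℝ := ∫ x, φ (x - z) * ψ x

theorem integral_dirHilbert_mul {ε : ℝ} (hε : 0 < ε) {v : Rn n} (hv : v ≠ 0) {φ ψ : Rn n → ℝ}
    (hφ : Continuous φ) (hφc : HasCompactSupport φ) (hψ : Continuous ψ)
    (hψc : HasCompactSupport ψ) :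
    ∫ x, dirHilbert ε v φ x * ψ x = ∫ r : ℝ, r / (r ^ 2 + ε ^ 2) * corr φ ψ (r • v) := by
  have hv0 : 0 < ‖v‖ := norm_pos_iff.2 hv
  have hcont : Continuous fun z : Rn n × ℝ =>
      z.2 / (z.2 ^ 2 + ε ^ 2) * φ (z.1 - z.2 • v) * ψ z.1 :=
    (((continuous_hilbertKernel hε).comp continuous_snd).mul (hφ.comp (by fun_prop))).mul
      (hψ.comp continuous_fst)
  obtain ⟨R, hR, hb⟩ := hφc.isCompact.isBounded.exists_pos_norm_le
  obtain ⟨R', hR', hb'⟩ := hψc.isCompact.isBounded.exists_pos_norm_le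
  have hint : Integrable (fun z : Rn n × ℝ =>
      z.2 / (z.2 ^ 2 + ε ^ 2) * φ (z.1 - z.2 • v) * ψ z.1) (volume.prod volume) := by
    refine hcont.integrable_of_hasCompactSupport (HasCompactSupport.intro
      ((isCompact_closedBall (0 : Rn n) R').prod
        (isCompact_closedBall (0 : ℝ) ((R' + R) / ‖v‖))) fun z hz => ?_)
    by_contra h0
    have h1 : z.1 ∈ tsupport ψ := by
      by_contra h
      exact h0 (by rw [image_eq_zero_of_notMem_tsupport h, mul_zero])
    have h2 : z.1 - z.2 • v ∈ tsupport φ := by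
      by_contra h
      exact h0 (by rw [image_eq_zero_of_notMem_tsupport h, mul_zero, zero_mul])
    refine hz ⟨mem_closedBall_zero_iff.2 (hb' _ h1), mem_closedBall_zero_iff.2 ?_⟩
    rw [le_div_iff₀ hv0, ← norm_smul]
    have h3 := norm_sub_le z.1 (z.1 - z.2 • v)
    rw [sub_sub_cancel] at h3
    linarith [hb _ h2, hb' _ h1]
  calc _ = ∫ x, ∫ r : ℝ, r / (r ^ 2 + ε ^ 2) * φ (x - r • v) * ψ x := by
        simp only [dirHilbert, integral_mul_const]
    _ = ∫ r : ℝ, ∫ x, r / (r ^ 2 + ε ^ 2) * φ (x - r • v) * ψ x :=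
        integral_integral_swap hint
    _ = _ := by simp only [corr, mul_assoc, integral_const_mul]

/-- The uniformity in `ε` and `v` is what permits averaging over `v` against a Gaussian weight and
letting `ε → 0`. -/
theorem exists_norm_integral_hilbert_corr_le {p q : ℝ≥0∞} (hpq : p.HolderConjugate q)
    (hp1 : 1 < p) (hp2 : p ≤ 2) :
    ∃ C : ℝ, 0 ≤ C ∧ ∀ φ ψ : Rn n → ℝ, Continuous φ → HasCompactSupport φ → Continuous ψ →
      HasCompactSupport ψ → ∀ ε : ℝ, 0 < ε → ∀ v : Rn n, v ≠ 0 →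
        ‖∫ r : ℝ, r / (r ^ 2 + ε ^ 2) * corr φ ψ (r • v)‖ ≤
          C * ((eLpNorm φ p volume).toReal * (eLpNorm ψ q volume).toReal) := by
  obtain ⟨C, hC, hbd⟩ := exists_eLpNorm_dirHilbert_le (n := n) hp1 hp2
  refine ⟨C.toReal, ENNReal.toReal_nonneg, fun φ ψ hφ hφc hψ hψc ε hε v hv => ?_⟩
  have hφL : MemLp φ p := hφ.memLp_of_hasCompactSupport hφc
  have hψL : MemLp ψ q := hψ.memLp_of_hasCompactSupport hψc
  have hle := hbd φ hφ hφc ε hε v hv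
  have hH : MemLp (dirHilbert ε v φ) p :=
    ⟨(stronglyMeasurable_dirHilbert hε v hφ).aestronglyMeasurable,
      hle.trans_lt (ENNReal.mul_lt_top hC.lt_top hφL.2)⟩
  rw [← integral_dirHilbert_mul hε hv hφ hφc hψ hψc]
  refine (norm_integral_mul_le_of_memLp hpq hH hψL).trans ?_
  rw [← mul_assoc, ← ENNReal.toReal_mul (a := C)]
  exact mul_le_mul_of_nonneg_right (ENNReal.toReal_mono (ENNReal.mul_ne_top hC hφL.2.ne) hle)
    ENNReal.toReal_nonneg

end DirectionalHilbert

/-! ### Gaussians times linear forms and their Fourier transforms. -/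

section Gaussian

variable {n : ℕ}

theorem integrable_gaussian {b : ℝ} (hb : 0 < b) :
    Integrable fun v : Rn n => Real.exp (-b * ‖v‖ ^ 2) := by
  have h := (GaussianFourier.integrable_cexp_neg_mul_sq_norm_add (V := Rn n) (b := (b : ℂ))
    (by simpa using hb) 0 0).norm
  refine h.congr (Eventually.of_forall fun v => ?_)
  simp only [zero_mul, add_zero, Complex.norm_exp]
  congr 1
  norm_cast

/-- The factor `t` is absorbed by half of the Gaussian exponent, through `1 + x ≤ e^x`. -/
theorem mul_exp_neg_sq_le {b : ℝ} (hb : 0 < b) (t : ℝ) :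
    t * Real.exp (-b * t ^ 2) ≤ (1 + 2 / b) * Real.exp (-(b / 2) * t ^ 2) := by
  have h1 : t ≤ (1 + 2 / b) * Real.exp (b / 2 * t ^ 2) := by
    have h2 := Real.add_one_le_exp (b / 2 * t ^ 2)
    have h3 : (1 + 2 / b) * (b / 2 * t ^ 2 + 1) = 1 + t ^ 2 + (b / 2 * t ^ 2 + 2 / b) := by
      field_simp
      ring
    have h4 : 0 ≤ b / 2 * t ^ 2 + 2 / b := by positivity
    calc t ≤ (1 + 2 / b) * (b / 2 * t ^ 2 + 1) := by rw [h3]; nlinarith [sq_nonneg (t - 1)]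
      _ ≤ _ := by gcongr
  have e : Real.exp (-b * t ^ 2) = Real.exp (-(b / 2) * t ^ 2) * Real.exp (-(b / 2) * t ^ 2) := by
    rw [← Real.exp_add]; ring_nf
  have e' : Real.exp (b / 2 * t ^ 2) * Real.exp (-(b / 2) * t ^ 2) = 1 := by
    rw [← Real.exp_add]; simp
  calc t * Real.exp (-b * t ^ 2)
      ≤ (1 + 2 / b) * Real.exp (b / 2 * t ^ 2) * Real.exp (-b * t ^ 2) := by gcongr
    _ = (1 + 2 / b) * (Real.exp (b / 2 * t ^ 2) * Real.exp (-(b / 2) * t ^ 2)) *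
        Real.exp (-(b / 2) * t ^ 2) := by rw [e]; ring
    _ = _ := by rw [e', mul_one]

theorem integrable_norm_mul_gaussian {b : ℝ} (hb : 0 < b) :
    Integrable fun v : Rn n => ‖v‖ * Real.exp (-b * ‖v‖ ^ 2) := by
  refine ((integrable_gaussian (n := n) (half_pos hb)).const_mul (1 + 2 / b)).mono'
    (by fun_prop) (Eventually.of_forall fun v => ?_)
  rw [Real.norm_of_nonneg (by positivity)]
  exact mul_exp_neg_sq_le hb _

theorem integrable_inner_mul_gaussian {b : ℝ} (hb : 0 < b) (a : Rn n) :
    Integrable fun v : Rn n => ⟪a, v⟫ * Real.exp (-b * ‖v‖ ^ 2) := by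
  refine ((integrable_norm_mul_gaussian (n := n) hb).const_mul ‖a‖).mono'
    (by fun_prop) (Eventually.of_forall fun v => ?_)
  rw [norm_mul, Real.norm_of_nonneg (Real.exp_pos _).le, ← mul_assoc]
  gcongr
  exact norm_inner_le_norm a v

/-- The Fourier transform of a linear form times a Gaussian. -/
theorem fourier_inner_mul_gaussian {b : ℝ} (hb : 0 < b) (a ξ : Rn n) :
    𝓕 (fun v : Rn n => ((⟪a, v⟫ * Real.exp (-b * ‖v‖ ^ 2) : ℝ) : ℂ)) ξ =
      -(Complex.I * ((Real.pi / b * ⟪a, ξ⟫ * ((Real.pi / b) ^ ((n : ℝ) / 2) *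
        Real.exp (-(Real.pi ^ 2 / b) * ‖ξ‖ ^ 2)) : ℝ) : ℂ)) := by
  set g : Rn n → ℂ := fun v => Complex.exp (-(b : ℂ) * ‖v‖ ^ 2) with hg
  have hgn : ∀ v, ‖g v‖ = Real.exp (-b * ‖v‖ ^ 2) := fun v => by
    rw [hg]
    simp only [Complex.norm_exp]
    congr 1
    norm_cast
  have hgc : Continuous g := by fun_prop
  have hgi : Integrable g := by
    rw [← integrable_norm_iff hgc.aestronglyMeasurable]
    simpa only [hgn] using integrable_gaussian (n := n) hb
  have hgi' : Integrable fun v => ‖v‖ * ‖g v‖ := by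
    simpa only [hgn] using integrable_norm_mul_gaussian (n := n) hb
  -- The derivative of `𝓕 g` is the transform of `-2πi ⟨v, ·⟩ g(v)`. Comparing it, in the direction
  -- `a`, with the derivative of the explicit Gaussian `𝓕 g` gives the formula.
  have hF := Real.hasFDerivAt_fourier hgi hgi' ξ
  have hint : Integrable (VectorFourier.fourierSMulRight (innerSL ℝ) g) := by
    refine (hgi'.const_mul (2 * Real.pi * ‖(innerSL ℝ : Rn n →L[ℝ] Rn n →L[ℝ] ℝ)‖)).mono'
      (AEStronglyMeasurable.fourierSMulRight hgc.aestronglyMeasurable)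
      (Eventually.of_forall fun v => ?_)
    refine (VectorFourier.norm_fourierSMulRight_le _ _ _).trans (le_of_eq (by ring))
  have e1 : 𝓕 g = fun w => ((Real.pi / b) ^ ((n : ℝ) / 2) : ℝ) *
      Complex.exp (((-(Real.pi ^ 2 / b) * ‖w‖ ^ 2 : ℝ) : ℂ)) := by
    funext w
    rw [hg, fourier_gaussian_innerProductSpace (by simpa using hb)]
    congr 1
    · rw [Complex.ofReal_cpow (by positivity)]
      simp
    · congr 1
      push_cast
      ring
  have h2 : HasFDerivAt (fun w : Rn n => -(Real.pi ^ 2 / b) * ‖w‖ ^ 2)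
      ((-(Real.pi ^ 2 / b)) • (2 • innerSL ℝ ξ)) ξ :=
    (hasStrictFDerivAt_norm_sq ξ).hasFDerivAt.const_mul _
  have h3 := (Complex.ofRealCLM.hasFDerivAt.comp ξ h2).cexp.const_mul
    (((Real.pi / b) ^ ((n : ℝ) / 2) : ℝ) : ℂ)
  rw [e1] at hF
  have h4 := congrArg (fun L => L a) (hF.unique h3)
  rw [Real.fourier_continuousLinearMap_apply hint] at h4
  have h5 : (fun v => VectorFourier.fourierSMulRight (innerSL ℝ) g v a) =
      (-(2 * Real.pi * Complex.I)) • fun v : Rn n => ((⟪a, v⟫ * Real.exp (-b * ‖v‖ ^ 2) : ℝ) : ℂ) := by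
    funext v
    rw [VectorFourier.fourierSMulRight_apply, innerSL_apply_apply, real_inner_comm]
    simp only [Pi.smul_apply, hg, smul_eq_mul, Complex.real_smul]
    push_cast
    ring
  have h6 : 𝓕 ((-(2 * Real.pi * Complex.I)) •
      fun v : Rn n => ((⟪a, v⟫ * Real.exp (-b * ‖v‖ ^ 2) : ℝ) : ℂ)) ξ =
      (-(2 * Real.pi * Complex.I)) *
        𝓕 (fun v : Rn n => ((⟪a, v⟫ * Real.exp (-b * ‖v‖ ^ 2) : ℝ) : ℂ)) ξ := by
    rw [Real.fourier_eq, Real.fourier_eq, ← integral_const_mul]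
    refine integral_congr_ae (Eventually.of_forall fun v => ?_)
    simp only [Pi.smul_apply, smul_eq_mul, Circle.smul_def]
    ring
  rw [h5, h6] at h4
  have hπ : (2 * Real.pi * Complex.I) ≠ 0 := Complex.two_pi_I_ne_zero
  have hI2 : Complex.I * Complex.I = -1 := Complex.I_mul_I
  refine mul_left_cancel₀ (neg_ne_zero.2 hπ) (h4.trans ?_)
  simp [real_inner_comm]
  linear_combination (-2 * ((Real.pi / b) ^ ((n : ℝ) / 2) : ℝ) *
    Complex.exp (-(Real.pi ^ 2 / b * ‖ξ‖ ^ 2)) * Real.pi ^ 2 * (b : ℂ)⁻¹ * ⟪a, ξ⟫) * hI2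

end Gaussian

/-! ### The Fourier transform of real-valued functions. -/

section RealFourier

variable {n : ℕ}

/-- The Fourier transform of a real-valued function. -/
noncomputable def ft (φ : Rn n → ℝ) : Rn n → ℂ := 𝓕 (fun x => (φ x : ℂ))

/-- The inverse Fourier transform of a real-valued function. -/
noncomputable def ftInv (φ : Rn n → ℝ) : Rn n → ℂ := 𝓕⁻ (fun x => (φ x : ℂ))

theorem ftInv_eq_ft_neg (φ : Rn n → ℝ) (ξ : Rn n) : ftInv φ ξ = ft φ (-ξ) :=
  Real.fourierInv_eq_fourier_neg _ _

theorem ft_eq_ftInv_neg (φ : Rn n → ℝ) (ξ : Rn n) : ft φ ξ = ftInv φ (-ξ) := by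
  rw [ftInv_eq_ft_neg, neg_neg]

theorem continuous_ft {φ : Rn n → ℝ} (hφ : Integrable φ) : Continuous (ft φ) :=
  VectorFourier.fourierIntegral_continuous Real.continuous_fourierChar
    (by exact continuous_inner) hφ.ofReal

theorem norm_ft_le (φ : Rn n → ℝ) (ξ : Rn n) : ‖ft φ ξ‖ ≤ ∫ x, ‖φ x‖ := by
  refine (VectorFourier.norm_fourierIntegral_le_integral_norm _ _ _ _ _).trans (le_of_eq ?_)
  simp

theorem ft_sub {φ ψ : Rn n → ℝ} (hφ : Integrable φ) (hψ : Integrable ψ) (ξ : Rn n) :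
    ft (fun x => φ x - ψ x) ξ = ft φ ξ - ft ψ ξ := by
  have h1 := (Real.fourierIntegral_convergent_iff ξ).2 (hφ.ofReal (𝕜 := ℂ))
  have h2 := (Real.fourierIntegral_convergent_iff ξ).2 (hψ.ofReal (𝕜 := ℂ))
  simp only [ft, Real.fourier_eq]
  refine Eq.trans (integral_congr_ae (Eventually.of_forall fun x => ?_)) (integral_sub h1 h2)
  simp only [Complex.ofReal_sub, smul_sub]

/-- The complexification of a real-valued Schwartz function. -/
noncomputable def toComplex (f : 𝓢(Rn n, ℝ)) : 𝓢(Rn n, ℂ) :=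
  SchwartzMap.postcompCLM (𝕜 := ℝ) Complex.ofRealCLM f

theorem ft_schwartz (f : 𝓢(Rn n, ℝ)) : ft f = 𝓕 (toComplex f) := rfl

theorem ftInv_schwartz (f : 𝓢(Rn n, ℝ)) : ftInv f = 𝓕⁻ (toComplex f) :=
  (SchwartzMap.fourierInv_coe (toComplex f)).symm

theorem integrable_ftInv_schwartz (f : 𝓢(Rn n, ℝ)) : Integrable (ftInv f) := by
  rw [ftInv_schwartz]
  exact SchwartzMap.integrable _

theorem continuous_ftInv_schwartz (f : 𝓢(Rn n, ℝ)) : Continuous (ftInv f) := by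
  rw [ftInv_schwartz]
  exact SchwartzMap.continuous _

/-- Parseval's formula `∫ h ψ = ∫ 𝓕 h 𝓕⁻ ψ`. -/
theorem integral_mul_eq_integral_ft {h : Rn n → ℝ} (hh : Integrable h) (ψ : 𝓢(Rn n, ℝ)) :
    ((∫ x, h x * ψ x : ℝ) : ℂ) = ∫ ξ, ft h ξ * ftInv ψ ξ := by
  have key := VectorFourier.integral_bilin_fourierIntegral_eq_flip (ContinuousLinearMap.mul ℂ ℂ)
    (L := innerₗ (Rn n)) Real.continuous_fourierChar continuous_inner (hh.ofReal (𝕜 := ℂ))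
    (integrable_ftInv_schwartz ψ)
  have e : ∀ x, VectorFourier.fourierIntegral 𝐞 volume (innerₗ (Rn n)).flip (ftInv ψ) x = ψ x := by
    intro x
    rw [flip_innerₗ, ftInv_schwartz]
    have : 𝓕 (𝓕⁻ (toComplex ψ)) = toComplex ψ := FourierTransform.fourier_fourierInv_eq _
    exact congrArg (fun g : 𝓢(Rn n, ℂ) => g x) this
  rw [← integral_complex_ofReal]
  refine Eq.trans ?_ key.symm
  refine integral_congr_ae (Eventually.of_forall fun x => ?_)
  simp only [ContinuousLinearMap.mul_apply', e]
  push_cast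
  rfl

theorem ft_comp_sub (φ : Rn n → ℝ) (z ξ : Rn n) :
    ft (fun x => φ (x - z)) ξ = 𝐞 (-⟪z, ξ⟫) • ft φ ξ := by
  have := congrFun (VectorFourier.fourierIntegral_comp_add_right 𝐞 (volume : Measure (Rn n))
    (innerₗ (Rn n)) (fun x => (φ x : ℂ)) (-z)) ξ
  simp only [map_neg, LinearMap.neg_apply, innerₗ_apply_apply] at this
  exact this

/-- Parseval for a translate of `φ`: the translation becomes a character, so averages of
correlations turn into Fourier multipliers. -/
theorem corr_eq {φ : Rn n → ℝ} (hφ : Integrable φ) (ψ : 𝓢(Rn n, ℝ)) (z : Rn n) :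
    (corr φ ψ z : ℂ) = ∫ ξ, 𝐞 (-⟪z, ξ⟫) • (ft φ ξ * ftInv ψ ξ) := by
  rw [corr, integral_mul_eq_integral_ft (hφ.comp_sub_right z) ψ]
  refine integral_congr_ae (Eventually.of_forall fun ξ => ?_)
  simp only [ft_comp_sub, smul_mul_assoc]

end RealFourier

/-! ### Riesz transforms by the method of rotations. -/

section Riesz

variable {n : ℕ}

/-- The correlation is bounded and vanishes for large `z`. The extra factor `‖z‖` is needed because
`r/(r²+ε²)` is not integrable: with `z = r v` it supplies the missing power of `r`. -/
theorem exists_norm_mul_corr_le {φ ψ : Rn n → ℝ} (hφ : Continuous φ) (hφc : HasCompactSupport φ)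
    (hψ : Continuous ψ) (hψc : HasCompactSupport ψ) :
    ∃ M, ∀ z, ‖z‖ * ‖corr φ ψ z‖ ≤ M := by
  obtain ⟨R, hR, hb⟩ := hφc.isCompact.isBounded.exists_pos_norm_le
  obtain ⟨R', hR', hb'⟩ := hψc.isCompact.isBounded.exists_pos_norm_le
  obtain ⟨D, hD⟩ := hφ.bounded_above_of_compact_support hφc
  have hψi : Integrable ψ := hψ.integrable_of_hasCompactSupport hψc
  refine ⟨∫ x, (R + R') * D * ‖ψ x‖, fun z => ?_⟩
  rw [corr, ← norm_norm z, ← norm_mul, ← integral_const_mul]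
  refine norm_integral_le_of_norm_le (hψi.norm.const_mul _) (Eventually.of_forall fun x => ?_)
  rw [norm_mul, norm_mul, norm_norm, ← mul_assoc]
  by_cases h1 : x ∈ tsupport ψ
  · by_cases h2 : x - z ∈ tsupport φ
    · have h3 := norm_sub_le x (x - z)
      rw [sub_sub_cancel] at h3
      have h4 : ‖z‖ ≤ R + R' := by linarith [hb _ h2, hb' _ h1]
      gcongr
      exact hD _
    · have := (norm_nonneg _).trans (hD 0)
      rw [image_eq_zero_of_notMem_tsupport h2]
      simp
      positivity
  · rw [image_eq_zero_of_notMem_tsupport h1]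
    simp

theorem measurable_corr {φ ψ : Rn n → ℝ} (hφ : Continuous φ) (hψ : Continuous ψ) :
    Measurable (corr φ ψ) := by
  have : Continuous fun z : Rn n × Rn n => φ (z.2 - z.1) * ψ z.2 := by fun_prop
  exact this.stronglyMeasurable.integral_prod_right.measurable

/-- A Gaussian average of correlations on the Fourier side. -/
theorem integral_gaussian_mul_corr {φ : Rn n → ℝ} (hφ : Integrable φ) (ψ : 𝓢(Rn n, ℝ))
    (a : Rn n) (r : ℝ) :
    ((∫ v, ⟪a, v⟫ * Real.exp (-Real.pi * ‖v‖ ^ 2) * corr φ ψ (r • v) : ℝ) : ℂ) =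
      ∫ ξ, -(Complex.I * ((r * ⟪a, ξ⟫ * Real.exp (-(Real.pi * ‖ξ‖ ^ 2) * r ^ 2) : ℝ) : ℂ)) *
        (ft φ ξ * ftInv ψ ξ) := by
  set g : Rn n → ℝ := fun v => ⟪a, v⟫ * Real.exp (-Real.pi * ‖v‖ ^ 2) with hg
  set Φ : Rn n → ℂ := fun ξ => ft φ ξ * ftInv ψ ξ with hΦ
  have hΦi : Integrable Φ := (integrable_ftInv_schwartz ψ).bdd_mul
    (continuous_ft hφ).aestronglyMeasurable (c := ∫ x, ‖φ x‖)
    (Eventually.of_forall fun ξ => norm_ft_le φ ξ)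
  have hΦc : Continuous Φ := (continuous_ft hφ).mul (continuous_ftInv_schwartz ψ)
  have hgi : Integrable g := integrable_inner_mul_gaussian Real.pi_pos a
  have hgc : Continuous g := by fun_prop
  have hint : Integrable (fun z : Rn n × Rn n => (g z.1 : ℂ) * (𝐞 (-⟪r • z.1, z.2⟫) • Φ z.2))
      (volume.prod volume) := by
    refine ((hgi.ofReal (𝕜 := ℂ)).mul_prod hΦi).mono (Continuous.aestronglyMeasurable ?_)
      (Eventually.of_forall fun z => by simp [Circle.norm_smul])
    refine (Complex.continuous_ofReal.comp (hgc.comp continuous_fst)).mul ?_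
    exact (Real.continuous_fourierChar.comp (by fun_prop)).smul (hΦc.comp continuous_snd)
  calc ((∫ v, g v * corr φ ψ (r • v) : ℝ) : ℂ)
      = ∫ v, ∫ ξ, (g v : ℂ) * (𝐞 (-⟪r • v, ξ⟫) • Φ ξ) := by
        rw [← integral_complex_ofReal]
        refine integral_congr_ae (Eventually.of_forall fun v => ?_)
        simp only [Complex.ofReal_mul, corr_eq hφ ψ, integral_const_mul, hΦ]
    _ = ∫ ξ, ∫ v, (g v : ℂ) * (𝐞 (-⟪r • v, ξ⟫) • Φ ξ) := integral_integral_swap hint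
    _ = ∫ ξ, 𝓕 (fun v => (g v : ℂ)) (r • ξ) * Φ ξ := by
        refine integral_congr_ae (Eventually.of_forall fun ξ => ?_)
        simp only [Real.fourier_eq, ← integral_mul_const]
        refine integral_congr_ae (Eventually.of_forall fun v => ?_)
        simp only [Circle.smul_def, smul_eq_mul, real_inner_smul_left, real_inner_smul_right]
        ring
    _ = _ := by
        refine integral_congr_ae (Eventually.of_forall fun ξ => ?_)
        simp only [hg, fourier_inner_mul_gaussian Real.pi_pos]
        congr 4
        have hπ := Real.pi_ne_zero
        rw [div_self hπ, Real.one_rpow, real_inner_smul_right, norm_smul, mul_pow,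
          Real.norm_eq_abs, sq_abs]
        have : Real.pi ^ 2 / Real.pi = Real.pi := by field_simp
        rw [this]
        ring_nf

theorem integrable_inv_sq_add_sq {ε : ℝ} (hε : 0 < ε) :
    Integrable fun r : ℝ => (r ^ 2 + ε ^ 2)⁻¹ := by
  have hi : Integrable fun y : ℝ => ε⁻¹ ^ 2 * (1 + (ε⁻¹ * y) ^ 2)⁻¹ :=
    (integrable_inv_one_add_sq.comp_mul_left' (inv_ne_zero hε.ne')).const_mul _
  refine hi.congr (Eventually.of_forall fun y => ?_)
  have : 0 < y ^ 2 + ε ^ 2 := by positivity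
  have : 0 < 1 + (ε⁻¹ * y) ^ 2 := by positivity
  field_simp
  ring

/-- Fubini in `(v, r)`, then the Gaussian average is computed on the Fourier side. It produces a
second factor `r`, so the odd kernel becomes `r²/(r²+ε²)`, which is bounded by `1`. -/
theorem integral_gaussian_hilbert_corr {φ : Rn n → ℝ} (hφ : Continuous φ)
    (hφc : HasCompactSupport φ) {ψ : 𝓢(Rn n, ℝ)} (hψc : HasCompactSupport ψ) (a : Rn n) {ε : ℝ}
    (hε : 0 < ε) :
    ((∫ v, ⟪a, v⟫ * Real.exp (-Real.pi * ‖v‖ ^ 2) *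
      ∫ r : ℝ, r / (r ^ 2 + ε ^ 2) * corr φ ψ (r • v) : ℝ) : ℂ) =
      ∫ r : ℝ, ∫ ξ, ((r ^ 2 / (r ^ 2 + ε ^ 2) : ℝ) : ℂ) *
        (-(Complex.I * ((⟪a, ξ⟫ * Real.exp (-(Real.pi * ‖ξ‖ ^ 2) * r ^ 2) : ℝ) : ℂ)) *
        (ft φ ξ * ftInv ψ ξ)) := by
  have hφi : Integrable φ := hφ.integrable_of_hasCompactSupport hφc
  set g : Rn n → ℝ := fun v => ⟪a, v⟫ * Real.exp (-Real.pi * ‖v‖ ^ 2) with hg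
  have hgc : Continuous g := by fun_prop
  obtain ⟨M, hM⟩ := exists_norm_mul_corr_le hφ hφc ψ.continuous hψc
  have hM0 : 0 ≤ M := le_trans (by positivity) (hM 0)
  have hint : Integrable (fun z : Rn n × ℝ => g z.1 * (z.2 / (z.2 ^ 2 + ε ^ 2) *
      corr φ ψ (z.2 • z.1))) (volume.prod volume) := by
    have hb := (((integrable_gaussian (n := n) Real.pi_pos).mul_prod
      (integrable_inv_sq_add_sq hε)).const_mul (‖a‖ * M))
    refine hb.mono' (Measurable.aestronglyMeasurable ?_) (Eventually.of_forall fun z => ?_)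
    · refine (hgc.measurable.comp measurable_fst).mul
        (((continuous_hilbertKernel hε).measurable.comp measurable_snd).mul
          ((measurable_corr hφ ψ.continuous).comp ?_))
      exact measurable_snd.smul measurable_fst
    · have h1 : ‖g z.1‖ ≤ ‖a‖ * ‖z.1‖ * Real.exp (-Real.pi * ‖z.1‖ ^ 2) := by
        rw [hg, norm_mul, Real.norm_of_nonneg (Real.exp_pos _).le]
        gcongr
        exact norm_inner_le_norm _ _
      have h2 : 0 < z.2 ^ 2 + ε ^ 2 := by positivity
      rw [norm_mul, norm_mul (z.2 / (z.2 ^ 2 + ε ^ 2)), norm_div, Real.norm_of_nonneg h2.le]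
      have h3 := hM (z.2 • z.1)
      rw [norm_smul] at h3
      calc _ ≤ ‖a‖ * ‖z.1‖ * Real.exp (-Real.pi * ‖z.1‖ ^ 2) *
            (‖z.2‖ / (z.2 ^ 2 + ε ^ 2) * ‖corr φ ψ (z.2 • z.1)‖) := by gcongr
        _ = ‖a‖ * (‖z.2‖ * ‖z.1‖ * ‖corr φ ψ (z.2 • z.1)‖) *
            (Real.exp (-Real.pi * ‖z.1‖ ^ 2) * (z.2 ^ 2 + ε ^ 2)⁻¹) := by
            rw [div_eq_mul_inv]; ring
        _ ≤ _ := by gcongr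
  calc _ = ((∫ v, ∫ r : ℝ, g v * (r / (r ^ 2 + ε ^ 2) * corr φ ψ (r • v)) : ℝ) : ℂ) := by
        simp only [integral_const_mul, hg]
    _ = ((∫ r : ℝ, ∫ v, g v * (r / (r ^ 2 + ε ^ 2) * corr φ ψ (r • v)) : ℝ) : ℂ) := by
        rw [integral_integral_swap hint]
    _ = ∫ r : ℝ, ((r / (r ^ 2 + ε ^ 2) * ∫ v, g v * corr φ ψ (r • v) : ℝ) : ℂ) := by
        rw [← integral_complex_ofReal]
        refine integral_congr_ae (Eventually.of_forall fun r => ?_)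
        simp only [← integral_const_mul]
        congr 1
        refine integral_congr_ae (Eventually.of_forall fun v => ?_)
        ring
    _ = _ := by
        refine integral_congr_ae (Eventually.of_forall fun r => ?_)
        simp only
        rw [Complex.ofReal_mul, hg, integral_gaussian_mul_corr hφi ψ a r, ← integral_const_mul]
        refine integral_congr_ae (Eventually.of_forall fun ξ => ?_)
        push_cast
        ring

/-- The value of `∫ e^{-π t² r²} dr`; at `t = 0` both sides are `0` by the conventions for division.
-/
theorem sqrt_pi_div_mul_sq {t : ℝ} (ht : 0 ≤ t) : √(Real.pi / (Real.pi * t ^ 2)) = t⁻¹ := by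
  rw [← div_div, div_self Real.pi_ne_zero, one_div, ← inv_pow, Real.sqrt_sq (inv_nonneg.2 ht)]

/-- Integrating first in `r` gives `|⟨a,ξ⟩| ‖ξ‖⁻¹ ‖Φ ξ‖ ≤ ‖a‖ ‖Φ ξ‖`. This is also where the
homogeneous symbol `⟨a,ξ⟩/‖ξ‖` arises. -/
theorem integrable_riesz_gaussian {Φ : Rn n → ℂ} (hΦ : Integrable Φ) (hΦc : Continuous Φ)
    (a : Rn n) :
    Integrable (fun z : ℝ × Rn n =>
      -(Complex.I * ((⟪a, z.2⟫ * Real.exp (-(Real.pi * ‖z.2‖ ^ 2) * z.1 ^ 2) : ℝ) : ℂ)) * Φ z.2)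
      (volume.prod volume) := by
  have hnorm : ∀ (r : ℝ) (ξ : Rn n),
      ‖-(Complex.I * ((⟪a, ξ⟫ * Real.exp (-(Real.pi * ‖ξ‖ ^ 2) * r ^ 2) : ℝ) : ℂ)) * Φ ξ‖ =
      Real.exp (-(Real.pi * ‖ξ‖ ^ 2) * r ^ 2) * (‖⟪a, ξ⟫‖ * ‖Φ ξ‖) := fun r ξ => by
    rw [norm_mul, norm_neg, norm_mul, Complex.norm_I, Complex.norm_real, norm_mul,
      Real.norm_of_nonneg (Real.exp_pos _).le]
    ring
  rw [integrable_prod_iff' (Continuous.aestronglyMeasurable (by fun_prop))]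
  constructor
  · refine Eventually.of_forall fun ξ => ?_
    -- At `ξ = 0` the Gaussian in `r` is constant, but the factor `⟨a,ξ⟩` vanishes.
    rcases eq_or_ne ξ 0 with rfl | hξ
    · simp
    · have hb : 0 < Real.pi * ‖ξ‖ ^ 2 := by
        have := norm_pos_iff.2 hξ
        have := Real.pi_pos
        positivity
      rw [← integrable_norm_iff (Continuous.aestronglyMeasurable (by fun_prop))]
      simp only [hnorm]
      exact (integrable_exp_neg_mul_sq hb).mul_const _
  · simp only [hnorm, integral_mul_const, integral_gaussian,
      sqrt_pi_div_mul_sq (norm_nonneg _)]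
    refine (hΦ.norm.const_mul ‖a‖).mono' ?_ (Eventually.of_forall fun ξ => ?_)
    · exact Measurable.aestronglyMeasurable (by fun_prop)
    · rw [norm_mul, norm_inv, norm_mul, norm_norm, norm_norm, norm_norm, ← mul_assoc]
      gcongr
      rcases eq_or_ne ξ 0 with rfl | hξ
      · simp
      · rw [inv_mul_le_iff₀ (norm_pos_iff.2 hξ), mul_comm]
        exact norm_inner_le_norm _ _

theorem integrable_ft_mul_ftInv {φ : Rn n → ℝ} (hφ : Integrable φ) (ψ : 𝓢(Rn n, ℝ)) :
    Integrable fun ξ => ft φ ξ * ftInv ψ ξ :=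
  (integrable_ftInv_schwartz ψ).bdd_mul (continuous_ft hφ).aestronglyMeasurable
    (c := ∫ x, ‖φ x‖) (Eventually.of_forall fun ξ => norm_ft_le φ ξ)

/-- As `ε = 1/(k+1) → 0` the factor `r²/(r²+ε²)` increases to `1`, and dominated convergence
applies. The `r`-integral of the limit is the symbol of a Riesz transform, which is thereby a
Gaussian average of directional Hilbert transforms. -/
theorem tendsto_integral_gaussian_hilbert_corr {φ : Rn n → ℝ} (hφ : Continuous φ)
    (hφc : HasCompactSupport φ) {ψ : 𝓢(Rn n, ℝ)} (hψc : HasCompactSupport ψ) (a : Rn n) :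
    Tendsto (fun k : ℕ => ((∫ v, ⟪a, v⟫ * Real.exp (-Real.pi * ‖v‖ ^ 2) *
      ∫ r : ℝ, r / (r ^ 2 + (1 / ((k : ℝ) + 1)) ^ 2) * corr φ ψ (r • v) : ℝ) : ℂ)) atTop
      (𝓝 (-Complex.I * ∫ ξ, ((⟪a, ξ⟫ / ‖ξ‖ : ℝ) : ℂ) * (ft φ ξ * ftInv ψ ξ))) := by
  have hφi : Integrable φ := hφ.integrable_of_hasCompactSupport hφc
  have hΦi := integrable_ft_mul_ftInv hφi ψ
  have hΦc : Continuous fun ξ => ft φ ξ * ftInv ψ ξ :=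
    (continuous_ft hφi).mul (continuous_ftInv_schwartz ψ)
  set W : ℝ × Rn n → ℂ := fun z =>
    -(Complex.I * ((⟪a, z.2⟫ * Real.exp (-(Real.pi * ‖z.2‖ ^ 2) * z.1 ^ 2) : ℝ) : ℂ)) *
      (ft φ z.2 * ftInv ψ z.2) with hW
  have hWi : Integrable W (volume.prod volume) := integrable_riesz_gaussian hΦi hΦc a
  have hk : ∀ k : ℕ, 0 < 1 / ((k : ℝ) + 1) := fun k => by positivity
  set c : ℕ → ℝ → ℝ := fun k r => r ^ 2 / (r ^ 2 + (1 / ((k : ℝ) + 1)) ^ 2) with hc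
  have hc1 : ∀ k r, ‖((c k r : ℝ) : ℂ)‖ ≤ 1 := fun k r => by
    have := hk k
    rw [Complex.norm_real, Real.norm_of_nonneg (by positivity), div_le_one (by positivity)]
    have : 0 ≤ (1 / ((k : ℝ) + 1)) ^ 2 := by positivity
    linarith
  have hcm : ∀ k, AEStronglyMeasurable (fun z : ℝ × Rn n => ((c k z.1 : ℝ) : ℂ))
      (volume.prod volume) := fun k => by
    have : Measurable (c k) := by fun_prop
    exact (Complex.measurable_ofReal.comp (this.comp measurable_fst)).aestronglyMeasurable
  have hint : ∀ k, Integrable (fun z : ℝ × Rn n => ((c k z.1 : ℝ) : ℂ) * W z)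
      (volume.prod volume) := fun k =>
    hWi.bdd_mul (hcm k) (c := 1) (Eventually.of_forall fun z => hc1 k z.1)
  have e1 : ∀ k : ℕ, ((∫ v, ⟪a, v⟫ * Real.exp (-Real.pi * ‖v‖ ^ 2) *
      ∫ r : ℝ, r / (r ^ 2 + (1 / ((k : ℝ) + 1)) ^ 2) * corr φ ψ (r • v) : ℝ) : ℂ) =
      ∫ z, ((c k z.1 : ℝ) : ℂ) * W z ∂(volume.prod volume) := fun k => by
    rw [integral_gaussian_hilbert_corr hφ hφc hψc a (hk k), integral_prod _ (hint k)]
  have e2 : -Complex.I * ∫ ξ, ((⟪a, ξ⟫ / ‖ξ‖ : ℝ) : ℂ) * (ft φ ξ * ftInv ψ ξ) =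
      ∫ z, W z ∂(volume.prod volume) := by
    rw [integral_prod_symm _ hWi, ← integral_const_mul]
    refine integral_congr_ae (Eventually.of_forall fun ξ => ?_)
    simp only [hW]
    rw [integral_mul_const, integral_neg, integral_const_mul, integral_complex_ofReal,
      integral_const_mul, integral_gaussian, sqrt_pi_div_mul_sq (norm_nonneg _), div_eq_mul_inv]
    ring
  simp only [e1]
  rw [e2]
  refine tendsto_integral_of_dominated_convergence (fun z => ‖W z‖)
    (fun k => (hint k).1) hWi.norm (fun k => Eventually.of_forall fun z => ?_) ?_
  · rw [norm_mul]
    exact mul_le_of_le_one_left (norm_nonneg _) (hc1 k z.1)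
  · have hae : ∀ᵐ z : ℝ × Rn n ∂(volume.prod volume), z.1 ≠ 0 :=
      Measure.quasiMeasurePreserving_fst.ae (Measure.ae_ne volume (0 : ℝ))
    filter_upwards [hae] with z hz
    have h1 : Tendsto (fun k : ℕ => c k z.1) atTop (𝓝 (z.1 ^ 2 / (z.1 ^ 2 + 0 ^ 2))) := by
      refine Tendsto.div tendsto_const_nhds (tendsto_const_nhds.add
        (tendsto_one_div_add_atTop_nhds_zero_nat.pow 2)) ?_
      simpa using hz
    have h2 : z.1 ^ 2 / (z.1 ^ 2 + 0 ^ 2) = 1 := by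
      rw [zero_pow two_ne_zero, add_zero, div_self (pow_ne_zero 2 hz)]
    rw [h2] at h1
    have h3 := ((Complex.continuous_ofReal.tendsto 1).comp h1).mul_const (W z)
    simpa using h3

/-- The directional bound is averaged against `|⟨a,v⟩| e^{-π|v|²}`, which is integrable, and
survives the limit because it does not depend on `ε`. -/
theorem exists_norm_riesz_pairing_le_of_le_two {p q : ℝ≥0∞} (hpq : p.HolderConjugate q)
    (hp1 : 1 < p) (hp2 : p ≤ 2) (a : Rn n) :
    ∃ C : ℝ, 0 ≤ C ∧ ∀ φ ψ : 𝓢(Rn n, ℝ), HasCompactSupport φ → HasCompactSupport ψ →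
      ‖∫ ξ, ((⟪a, ξ⟫ / ‖ξ‖ : ℝ) : ℂ) * (ft φ ξ * ftInv ψ ξ)‖ ≤
        C * ((eLpNorm φ p volume).toReal * (eLpNorm ψ q volume).toReal) := by
  obtain ⟨C, hC, hbd⟩ := exists_norm_integral_hilbert_corr_le (n := n) hpq hp1 hp2
  set g : Rn n → ℝ := fun v => ⟪a, v⟫ * Real.exp (-Real.pi * ‖v‖ ^ 2) with hg
  have hgi : Integrable g := integrable_inner_mul_gaussian Real.pi_pos a
  refine ⟨(∫ v, ‖g v‖) * C, by positivity, fun φ ψ hφc hψc => ?_⟩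
  have hlim := (tendsto_integral_gaussian_hilbert_corr φ.continuous hφc hψc a).norm
  rw [norm_mul, norm_neg, Complex.norm_I, one_mul] at hlim
  refine le_of_tendsto hlim (Eventually.of_forall fun k => ?_)
  rw [Complex.norm_real, mul_assoc, ← integral_mul_const]
  refine norm_integral_le_of_norm_le (hgi.norm.mul_const _) (Eventually.of_forall fun v => ?_)
  rw [norm_mul]
  -- There is no direction at `v = 0`, and the weight vanishes there.
  rcases eq_or_ne v 0 with rfl | hv
  · simp [hg]
  · gcongr
    exact hbd φ ψ φ.continuous hφc ψ.continuous hψc _ (by positivity) v hv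

/-- For `p ≥ 2` the conjugate exponent is at most `2`. The symbol is odd, so `ξ ↦ -ξ` exchanges the
roles of `φ` and `ψ` up to a sign. -/
theorem exists_norm_riesz_pairing_le_of_hasCompactSupport {p q : ℝ≥0∞} (hpq : p.HolderConjugate q)
    (hp1 : 1 < p) (hp : p ≠ ⊤) (a : Rn n) :
    ∃ C : ℝ, 0 ≤ C ∧ ∀ φ ψ : 𝓢(Rn n, ℝ), HasCompactSupport φ → HasCompactSupport ψ →
      ‖∫ ξ, ((⟪a, ξ⟫ / ‖ξ‖ : ℝ) : ℂ) * (ft φ ξ * ftInv ψ ξ)‖ ≤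
        C * ((eLpNorm φ p volume).toReal * (eLpNorm ψ q volume).toReal) := by
  rcases le_total p 2 with h2 | h2
  · exact exists_norm_riesz_pairing_le_of_le_two hpq hp1 h2 a
  have hq2 : q ≤ 2 := by
    rw [← ENNReal.inv_le_inv, ← ENNReal.HolderConjugate.one_sub_inv p q, ← ENNReal.one_sub_inv_two]
    exact tsub_le_tsub_left (ENNReal.inv_le_inv.2 h2) 1
  have hq1 : 1 < q := (ENNReal.HolderConjugate.lt_top_iff_one_lt p q).1 hp.lt_top
  obtain ⟨C, hC, hbd⟩ := exists_norm_riesz_pairing_le_of_le_two hpq.symm hq1 hq2 a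
  refine ⟨C, hC, fun φ ψ hφc hψc => ?_⟩
  have h := hbd ψ φ hψc hφc
  rw [mul_comm (eLpNorm φ p volume).toReal]
  refine le_trans (le_of_eq ?_) h
  rw [← norm_neg, ← integral_neg, ← integral_neg_eq_self]
  congr 1
  refine integral_congr_ae (Eventually.of_forall fun ξ => ?_)
  simp only [← ft_eq_ftInv_neg, ← ftInv_eq_ft_neg, inner_neg_right, norm_neg]
  push_cast
  ring

end Riesz

/-! ### Extension of the Riesz bound to `L¹ ∩ L^p`. -/

section RieszExtension

variable {n : ℕ}

/-- Simultaneous approximation by test functions in `L¹` and `L^p`. -/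
theorem exists_test_approx_of_integrable {p : ℝ≥0∞} (hp1 : 1 ≤ p) (hp : p ≠ ⊤) {φ : Rn n → ℝ}
    (hφi : Integrable φ) (hφ : MemLp φ p) {ε : ℝ} (hε : 0 < ε) :
    ∃ u : 𝓢(Rn n, ℝ), HasCompactSupport u ∧
      eLpNorm (fun x => φ x - u x) 1 volume ≤ ENNReal.ofReal ε ∧
      eLpNorm (fun x => φ x - u x) p volume ≤ ENNReal.ofReal ε := by
  have hφ1 : MemLp φ 1 := memLp_one_iff_integrable.2 hφi
  have hε2 : 0 < ε / 2 := by positivity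
  obtain ⟨δ₁, hδ₁, h₁⟩ := exists_eLpNorm_mollify_sub_le le_rfl ENNReal.one_ne_top hφ1 hε2
  obtain ⟨δ₂, hδ₂, h₂⟩ := exists_eLpNorm_mollify_sub_le hp1 hp hφ hε2
  obtain ⟨ρ, hρ⟩ := exists_contDiffBump_rOut_lt (n := n) (lt_min hδ₁ hδ₂)
  have hm1 := memLp_mollify ρ le_rfl ENNReal.one_ne_top hφ1
  have hmp := memLp_mollify ρ hp1 hp hφ
  have a₁ := h₁ ρ (hρ.trans_le (min_le_left _ _))
  have a₂ := h₂ ρ (hρ.trans_le (min_le_right _ _))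
  have hsm := contDiff_mollify ρ hφi.locallyIntegrable
  set g := mollify ρ φ with hg
  obtain ⟨R₁, hR₁, b₁⟩ := exists_eLpNorm_cutoff_sub_le le_rfl ENNReal.one_ne_top hm1 hε2
  obtain ⟨R₂, hR₂, b₂⟩ := exists_eLpNorm_cutoff_sub_le hp1 hp hmp hε2
  set R := max R₁ R₂
  have hR : 0 < R := hR₁.trans_le (le_max_left _ _)
  have c₁ := b₁ R (le_max_left _ _)
  have c₂ := b₂ R (le_max_right _ _)
  have huc : HasCompactSupport fun x => cutoff n R x * g x :=
    (hasCompactSupport_cutoff hR).mono fun x hx h0 => hx (by simp [h0])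
  have hus : ContDiff ℝ ∞ fun x => cutoff n R x * g x := (contDiff_cutoff R).mul hsm
  have key : ∀ r : ℝ≥0∞, 1 ≤ r → MemLp φ r → MemLp g r →
      eLpNorm (g - φ) r volume ≤ ENNReal.ofReal (ε / 2) →
      eLpNorm (fun x => cutoff n R x • g x - g x) r volume ≤ ENNReal.ofReal (ε / 2) →
      eLpNorm (fun x => φ x - cutoff n R x * g x) r volume ≤ ENNReal.ofReal ε := by
    intro r hr hφr hgr h1 h2
    have e : (fun x => φ x - cutoff n R x * g x) =
        -((fun x => cutoff n R x • g x - g x) + (g - φ)) := by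
      funext x
      simp only [Pi.neg_apply, Pi.add_apply, Pi.sub_apply, smul_eq_mul]
      ring
    rw [e, eLpNorm_neg]
    refine (eLpNorm_add_le ?_ (hgr.1.sub hφr.1) hr).trans ?_
    · exact (((contDiff_cutoff R).continuous.aestronglyMeasurable.smul hgr.1).sub hgr.1)
    · refine (add_le_add h2 h1).trans (le_of_eq ?_)
      rw [← ENNReal.ofReal_add hε2.le hε2.le, add_halves]
  exact ⟨huc.toSchwartzMap hus, huc, key 1 le_rfl hφ1 hm1 a₁ c₁, key p hp1 hφ hmp a₂ c₂⟩

theorem norm_inner_div_norm_le (a ξ : Rn n) : ‖((⟪a, ξ⟫ / ‖ξ‖ : ℝ) : ℂ)‖ ≤ ‖a‖ := by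
  rw [Complex.norm_real, norm_div, norm_norm]
  rcases eq_or_ne ξ 0 with rfl | hξ
  · simp
  · rw [div_le_iff₀ (norm_pos_iff.2 hξ)]
    exact norm_inner_le_norm _ _

theorem integrable_riesz_pairing {φ : Rn n → ℝ} (hφ : Integrable φ) (ψ : 𝓢(Rn n, ℝ)) (a : Rn n) :
    Integrable fun ξ => ((⟪a, ξ⟫ / ‖ξ‖ : ℝ) : ℂ) * (ft φ ξ * ftInv ψ ξ) := by
  refine (integrable_ft_mul_ftInv hφ ψ).bdd_mul (c := ‖a‖) ?_
    (Eventually.of_forall fun ξ => norm_inner_div_norm_le a ξ)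
  have : Measurable fun ξ : Rn n => ⟪a, ξ⟫ / ‖ξ‖ := by fun_prop
  exact (Complex.measurable_ofReal.comp this).aestronglyMeasurable

/-- The Riesz transforms are bounded on `L^p`, in weak form. -/
theorem exists_norm_riesz_pairing_le {p q : ℝ≥0∞} (hpq : p.HolderConjugate q)
    (hp1 : 1 < p) (hp : p ≠ ⊤) (a : Rn n) :
    ∃ C : ℝ, 0 ≤ C ∧ ∀ φ : Rn n → ℝ, Integrable φ → MemLp φ p → ∀ ψ : 𝓢(Rn n, ℝ),
      HasCompactSupport ψ →
      ‖∫ ξ, ((⟪a, ξ⟫ / ‖ξ‖ : ℝ) : ℂ) * (ft φ ξ * ftInv ψ ξ)‖ ≤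
        C * ((eLpNorm φ p volume).toReal * (eLpNorm ψ q volume).toReal) := by
  obtain ⟨C, hC, hbd⟩ := exists_norm_riesz_pairing_le_of_hasCompactSupport hpq hp1 hp a
  refine ⟨C, hC, fun φ hφi hφ ψ hψc => ?_⟩
  set N := (eLpNorm ψ q volume).toReal
  have hN : 0 ≤ N := ENNReal.toReal_nonneg
  set D := ∫ ξ, ‖ftInv ψ ξ‖
  have hD : 0 ≤ D := by positivity
  have main : ∀ ε : ℝ, 0 < ε → ‖∫ ξ, ((⟪a, ξ⟫ / ‖ξ‖ : ℝ) : ℂ) * (ft φ ξ * ftInv ψ ξ)‖ ≤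
      C * ((eLpNorm φ p volume).toReal * N) + ε * (C * N + ‖a‖ * D) := by
    intro ε hε
    -- Closeness in `L^p` controls the right-hand side, and closeness in `L¹` controls the Fourier
    -- transform uniformly, hence the left-hand side since `ftInv ψ` is integrable. Admitting `φ`
    -- without compact support is needed for `φ = (-Δ)^{α/2} f`.
    obtain ⟨u, huc, h1, h2⟩ := exists_test_approx_of_integrable hp1.le hp hφi hφ hε
    have hui : Integrable u := u.integrable
    have huL : MemLp u p := u.continuous.memLp_of_hasCompactSupport huc
    have hsub : Integrable fun x => φ x - u x := hφi.sub hui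
    have e1 : ∫ ξ, ((⟪a, ξ⟫ / ‖ξ‖ : ℝ) : ℂ) * (ft φ ξ * ftInv ψ ξ) =
        (∫ ξ, ((⟪a, ξ⟫ / ‖ξ‖ : ℝ) : ℂ) * (ft u ξ * ftInv ψ ξ)) +
        ∫ ξ, ((⟪a, ξ⟫ / ‖ξ‖ : ℝ) : ℂ) * (ft (fun x => φ x - u x) ξ * ftInv ψ ξ) := by
      rw [← integral_add (integrable_riesz_pairing hui ψ a)
        (integrable_riesz_pairing hsub ψ a)]
      refine integral_congr_ae (Eventually.of_forall fun ξ => ?_)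
      simp only [ft_sub hφi hui]
      ring
    have e2 : (eLpNorm u p volume).toReal ≤ (eLpNorm φ p volume).toReal + ε := by
      have : eLpNorm u p volume ≤ eLpNorm φ p volume + ENNReal.ofReal ε := by
        have e : (u : Rn n → ℝ) = φ - fun x => φ x - u x := by
          funext x
          simp
        calc eLpNorm u p volume = eLpNorm (φ - fun x => φ x - u x) p volume := by rw [← e]
          _ ≤ _ := (eLpNorm_sub_le hφ.1 (hφ.1.sub huL.1) hp1.le).trans
            (by gcongr; exact h2)
      refine (ENNReal.toReal_mono (by finiteness [hφ.2.ne]) this).trans (le_of_eq ?_)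
      rw [ENNReal.toReal_add hφ.2.ne ENNReal.ofReal_ne_top, ENNReal.toReal_ofReal hε.le]
    have e3 : ∫ x, ‖φ x - u x‖ ≤ ε := by
      rw [integral_norm_eq_lintegral_enorm hsub.1, ← eLpNorm_one_eq_lintegral_enorm]
      exact ENNReal.toReal_le_of_le_ofReal hε.le h1
    have e4 : ‖∫ ξ, ((⟪a, ξ⟫ / ‖ξ‖ : ℝ) : ℂ) * (ft (fun x => φ x - u x) ξ * ftInv ψ ξ)‖ ≤
        ‖a‖ * (ε * D) := by
      simp only [D]
      rw [← integral_const_mul, ← integral_const_mul]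
      refine norm_integral_le_of_norm_le
        (((integrable_ftInv_schwartz ψ).norm.const_mul _).const_mul _)
        (Eventually.of_forall fun ξ => ?_)
      rw [norm_mul, norm_mul]
      gcongr
      · exact norm_inner_div_norm_le a ξ
      · exact (norm_ft_le _ _).trans e3
    rw [e1]
    calc _ ≤ C * ((eLpNorm u p volume).toReal * N) + ‖a‖ * (ε * D) :=
          (norm_add_le _ _).trans (add_le_add (hbd u ψ huc hψc) e4)
      _ ≤ C * (((eLpNorm φ p volume).toReal + ε) * N) + ‖a‖ * (ε * D) := by gcongr
      _ = _ := by ring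
  refine le_of_forall_pos_le_add fun δ hδ => ?_
  have hB : 0 ≤ C * N + ‖a‖ * D := by positivity
  refine (main (δ / (C * N + ‖a‖ * D + 1)) (by positivity)).trans ?_
  gcongr
  rw [div_mul_eq_mul_div, div_le_iff₀ (by positivity)]
  nlinarith

end RieszExtension

/-! ### Multipliers with integrable kernels as mixtures of heat kernels. -/

section Mixtures

variable {n : ℕ}

/-- This is the heat kernel at time `s`. It has mass `1`, so a mixture with weight `w` has `L¹` norm
at most `∫ |w|`. -/
theorem integral_gaussian_fourier {s : ℝ} (hs : 0 < s) (ξ : Rn n) :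
    ft (fun y : Rn n => (4 * Real.pi * s) ^ (-((n : ℝ) / 2)) * Real.exp (-(4 * s)⁻¹ * ‖y‖ ^ 2)) ξ =
      ((Real.exp (-s * ‖(2 * Real.pi) • ξ‖ ^ 2) : ℝ) : ℂ) := by
  have hb : 0 < (4 * s)⁻¹ := by positivity
  have h := fourier_gaussian_innerProductSpace (V := Rn n) (b := (((4 * s)⁻¹ : ℝ) : ℂ))
    (by simpa using hb) ξ
  have hπ := Real.pi_pos
  have e1 : ((Real.pi : ℂ) / (((4 * s)⁻¹ : ℝ) : ℂ)) ^ ((Module.finrank ℝ (Rn n) : ℂ) / 2) =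
      (((4 * Real.pi * s) ^ ((n : ℝ) / 2) : ℝ) : ℂ) := by
    rw [Complex.ofReal_cpow (by positivity)]
    congr 1
    · push_cast
      rw [div_inv_eq_mul]
      ring
    · simp
  rw [e1] at h
  have e2 : ft (fun y : Rn n => (4 * Real.pi * s) ^ (-((n : ℝ) / 2)) *
      Real.exp (-(4 * s)⁻¹ * ‖y‖ ^ 2)) ξ = (((4 * Real.pi * s) ^ (-((n : ℝ) / 2)) : ℝ) : ℂ) *
      𝓕 (fun v : Rn n => Complex.exp (-(((4 * s)⁻¹ : ℝ) : ℂ) * ‖v‖ ^ 2)) ξ := by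
    simp only [ft, Real.fourier_eq, ← integral_const_mul]
    refine integral_congr_ae (Eventually.of_forall fun v => ?_)
    simp only [Circle.smul_def, smul_eq_mul]
    push_cast
    ring
  rw [e2, h, ← mul_assoc, ← Complex.ofReal_mul, ← Real.rpow_add (by positivity), neg_add_cancel,
    Real.rpow_zero, Complex.ofReal_one, one_mul, Complex.ofReal_exp]
  congr 1
  rw [norm_smul, Real.norm_of_nonneg (by positivity)]
  have : (s : ℂ) ≠ 0 := by exact_mod_cast hs.ne'
  push_cast
  field_simp
  ring

theorem integral_gaussian_normalized {s : ℝ} (hs : 0 < s) :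
    Integrable (fun y : Rn n => (4 * Real.pi * s) ^ (-((n : ℝ) / 2)) *
      Real.exp (-(4 * s)⁻¹ * ‖y‖ ^ 2)) ∧
    ∫ y : Rn n, (4 * Real.pi * s) ^ (-((n : ℝ) / 2)) * Real.exp (-(4 * s)⁻¹ * ‖y‖ ^ 2) = 1 := by
  refine ⟨(integrable_gaussian (by positivity)).const_mul _, ?_⟩
  have hπ := Real.pi_pos
  rw [integral_const_mul, GaussianFourier.integral_rexp_neg_mul_sq_norm (by positivity),
    div_inv_eq_mul, finrank_euclideanSpace_fin, show Real.pi * (4 * s) = 4 * Real.pi * s by ring,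
    ← Real.rpow_add (by positivity), neg_add_cancel, Real.rpow_zero]

/-- A mixture of Gaussians is the inverse Fourier transform of an integrable function. -/
theorem exists_integrable_ft_eq_mixture {w : ℝ → ℝ} (hw : IntegrableOn w (Set.Ioi 0)) :
    ∃ K : Rn n → ℝ, Integrable K ∧ ∀ ξ, ft K ξ =
      ((∫ s in Set.Ioi (0 : ℝ), w s * Real.exp (-s * ‖(2 * Real.pi) • ξ‖ ^ 2) : ℝ) : ℂ) := by
  set G : ℝ → Rn n → ℝ := fun s y =>
    (4 * Real.pi * s) ^ (-((n : ℝ) / 2)) * Real.exp (-(4 * s)⁻¹ * ‖y‖ ^ 2) with hG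
  set ν : Measure ℝ := volume.restrict (Set.Ioi 0) with hν
  have hπ := Real.pi_pos
  have hpos : ∀ᵐ s ∂ν, 0 < s := ae_restrict_mem measurableSet_Ioi
  have hGm : Measurable fun z : Rn n × ℝ => G z.2 z.1 := by fun_prop
  have hint : Integrable (fun z : Rn n × ℝ => w z.2 * G z.2 z.1) (volume.prod ν) := by
    have hm : AEStronglyMeasurable (fun z : Rn n × ℝ => w z.2 * G z.2 z.1) (volume.prod ν) :=
      hw.1.comp_snd.mul hGm.aestronglyMeasurable
    rw [integrable_prod_iff' hm]
    constructor
    · filter_upwards [hpos] with s hs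
      exact (integral_gaussian_normalized hs).1.const_mul _
    · refine hw.norm.congr ?_
      filter_upwards [hpos] with s hs
      have : ∀ y : Rn n, ‖w s * G s y‖ = ‖w s‖ * G s y := fun y => by
        rw [norm_mul, Real.norm_of_nonneg (by positivity : 0 ≤ G s y)]
      simp only [this, integral_const_mul]
      rw [(integral_gaussian_normalized hs).2, mul_one]
  refine ⟨fun y => ∫ s, w s * G s y ∂ν, hint.integral_prod_left, fun ξ => ?_⟩
  have hint2 : Integrable (fun z : Rn n × ℝ => 𝐞 (-⟪z.1, ξ⟫) • ((w z.2 * G z.2 z.1 : ℝ) : ℂ))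
      (volume.prod ν) := by
    refine (hint.ofReal (𝕜 := ℂ)).mono (AEStronglyMeasurable.smul ?_ (hint.ofReal (𝕜 := ℂ)).1)
      (Eventually.of_forall fun z => by simp [Circle.norm_smul])
    have hc : Continuous fun z : Rn n × ℝ => -⟪z.1, ξ⟫ := by fun_prop
    exact (continuous_induced_dom.comp (Real.continuous_fourierChar.comp hc)).aestronglyMeasurable
  calc ft (fun y => ∫ s, w s * G s y ∂ν) ξ
      = ∫ y, ∫ s, 𝐞 (-⟪y, ξ⟫) • ((w s * G s y : ℝ) : ℂ) ∂ν := by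
        rw [ft, Real.fourier_eq]
        refine integral_congr_ae (Eventually.of_forall fun y => ?_)
        simp only [← integral_complex_ofReal, Circle.smul_def, smul_eq_mul, integral_const_mul]
    _ = ∫ s, (∫ y, 𝐞 (-⟪y, ξ⟫) • ((w s * G s y : ℝ) : ℂ)) ∂ν := integral_integral_swap hint2
    _ = ∫ s, ((w s * Real.exp (-s * ‖(2 * Real.pi) • ξ‖ ^ 2) : ℝ) : ℂ) ∂ν := by
        refine integral_congr_ae ?_
        filter_upwards [hpos] with s hs
        rw [Complex.ofReal_mul, ← integral_gaussian_fourier hs ξ, ft, Real.fourier_eq,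
          ← integral_const_mul]
        refine integral_congr_ae (Eventually.of_forall fun y => ?_)
        simp only [Circle.smul_def, smul_eq_mul, hG]
        push_cast
        ring
    _ = _ := integral_complex_ofReal

/-- The Bessel kernel. -/
theorem exists_integrable_ft_eq_bessel {β : ℝ} (hβ : 0 < β) :
    ∃ K : Rn n → ℝ, Integrable K ∧ ∀ ξ, ft K ξ =
      (((1 + ‖(2 * Real.pi) • ξ‖ ^ 2) ^ (-β) : ℝ) : ℂ) := by
  have hΓ : 0 < Real.Gamma β := Real.Gamma_pos_of_pos hβ
  have hw : IntegrableOn (fun s : ℝ => (Real.Gamma β)⁻¹ * (s ^ (β - 1) * Real.exp (-(1 * s))))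
      (Set.Ioi 0) := by
    refine Integrable.const_mul ?_ _
    have := Real.GammaIntegral_convergent hβ
    refine this.congr (Eventually.of_forall fun s => ?_)
    simp only [one_mul]
    ring
  obtain ⟨K, hK, hft⟩ := exists_integrable_ft_eq_mixture (n := n) hw
  refine ⟨K, hK, fun ξ => ?_⟩
  rw [hft ξ]
  congr 1
  set t := ‖(2 * Real.pi) • ξ‖ ^ 2
  have ht : 0 ≤ t := by positivity
  -- The subordination formula `(1+t)^{-β} = Γ(β)⁻¹ ∫ s^{β-1} e^{-(1+t)s} ds`.
  have h1 := Real.integral_rpow_mul_exp_neg_mul_Ioi hβ (by positivity : 0 < 1 + t)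
  calc ∫ s in Set.Ioi (0 : ℝ), (Real.Gamma β)⁻¹ * (s ^ (β - 1) * Real.exp (-(1 * s))) *
        Real.exp (-s * t)
      = (Real.Gamma β)⁻¹ * ∫ s in Set.Ioi (0 : ℝ), s ^ (β - 1) * Real.exp (-((1 + t) * s)) := by
        rw [← integral_const_mul]
        refine integral_congr_ae (Eventually.of_forall fun s => ?_)
        simp only
        rw [mul_assoc, mul_assoc, ← Real.exp_add]
        ring_nf
    _ = _ := by
        rw [h1, Real.rpow_neg (by positivity), one_div, Real.inv_rpow (by positivity)]
        field_simp

/-- The multiplier `(1 + |2πξ|²)^β - |2πξ|^{2β}` has an integrable kernel. -/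
theorem exists_integrable_ft_eq_bessel_sub {β : ℝ} (hβ : 0 < β) (hβ1 : β < 1) :
    ∃ K : Rn n → ℝ, Integrable K ∧ ∀ ξ, ft K ξ =
      (((1 + ‖(2 * Real.pi) • ξ‖ ^ 2) ^ β - (‖(2 * Real.pi) • ξ‖ ^ 2) ^ β : ℝ) : ℂ) := by
  have hΓ : 0 < Real.Gamma (1 - β) := Real.Gamma_pos_of_pos (by linarith)
  -- The representation is `(1+t)^β - t^β = ∫₀¹ β (t+u)^{β-1} du`, with `β (t+u)^{β-1} = c ∫ s^{-β}
  -- e^{-s(t+u)} ds`.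
  set c : ℝ := β * (Real.Gamma (1 - β))⁻¹ with hc
  have hc0 : 0 < c := by positivity
  have hI : ∀ t : ℝ, 0 < t →
      IntegrableOn (fun s : ℝ => c * s ^ (-β) * Real.exp (-s * t)) (Set.Ioi 0) ∧
      ∫ s in Set.Ioi (0 : ℝ), c * s ^ (-β) * Real.exp (-s * t) = β * t ^ (β - 1) := by
    intro t ht
    have h1 := Real.integral_rpow_mul_exp_neg_mul_Ioi (by linarith : 0 < 1 - β) ht
    have e : ∀ s : ℝ, c * s ^ (-β) * Real.exp (-s * t) =
        c * (s ^ (1 - β - 1) * Real.exp (-(t * s))) := fun s => by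
      rw [show 1 - β - 1 = -β by ring, mul_assoc]
      ring_nf
    have h2 : ∫ s in Set.Ioi (0 : ℝ), c * s ^ (-β) * Real.exp (-s * t) = β * t ^ (β - 1) := by
      simp only [e, integral_const_mul]
      rw [h1, one_div, Real.inv_rpow ht.le, ← Real.rpow_neg ht.le, neg_sub, hc]
      field_simp
    refine ⟨?_, h2⟩
    -- The integral of a non-integrable function is `0` by convention, so a positive value proves
    -- integrability.
    by_contra h
    rw [integral_undef h] at h2
    have : 0 < β * t ^ (β - 1) := by positivity
    linarith
  have hprod : ∀ t : ℝ, 0 ≤ t → Integrable (fun z : ℝ × ℝ => c * z.2 ^ (-β) *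
      Real.exp (-z.2 * (t + z.1))) ((volume.restrict (Set.Ioc 0 1)).prod
        (volume.restrict (Set.Ioi 0))) := by
    intro t ht
    have hpos : ∀ᵐ u ∂(volume.restrict (Set.Ioc (0 : ℝ) 1)), 0 < t + u := by
      filter_upwards [ae_restrict_mem measurableSet_Ioc] with u hu
      linarith [hu.1]
    have hm : Measurable fun z : ℝ × ℝ => c * z.2 ^ (-β) * Real.exp (-z.2 * (t + z.1)) := by
      fun_prop
    rw [integrable_prod_iff hm.aestronglyMeasurable]
    constructor
    · filter_upwards [hpos] with u hu
      exact (hI _ hu).1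
    · have h1 : IntegrableOn (fun u : ℝ => β * (t + u) ^ (β - 1)) (Set.Ioc 0 1) := by
        have h2 : IntervalIntegrable (fun u : ℝ => u ^ (β - 1)) volume (t + 0) (t + 1) :=
          intervalIntegral.intervalIntegrable_rpow' (by linarith)
        have h3 := (h2.comp_add_left t).const_mul β
        simp only [add_sub_cancel_left] at h3
        exact (intervalIntegrable_iff_integrableOn_Ioc_of_le zero_le_one).1 h3
      refine h1.congr ?_
      filter_upwards [hpos] with u hu
      rw [← (hI _ hu).2]
      refine setIntegral_congr_fun measurableSet_Ioi fun s hs => ?_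
      have hs0 : (0 : ℝ) < s := hs
      rw [Real.norm_of_nonneg (by positivity)]
  -- The `u`-integral at `t = 0`; for general `t` the factor `e^{-st}` comes out of it.
  -- Integrability of `w` is therefore the case `t = 0` of `hprod`.
  set w : ℝ → ℝ := fun s => ∫ u in Set.Ioc (0 : ℝ) 1, c * s ^ (-β) * Real.exp (-s * (0 + u))
  have hw : IntegrableOn w (Set.Ioi 0) := (hprod 0 le_rfl).integral_prod_right
  obtain ⟨K, hK, hft⟩ := exists_integrable_ft_eq_mixture (n := n) hw
  refine ⟨K, hK, fun ξ => ?_⟩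
  rw [hft ξ]
  congr 1
  set t := ‖(2 * Real.pi) • ξ‖ ^ 2
  have ht : 0 ≤ t := by positivity
  calc ∫ s in Set.Ioi (0 : ℝ), w s * Real.exp (-s * t)
      = ∫ s in Set.Ioi (0 : ℝ), ∫ u in Set.Ioc (0 : ℝ) 1,
          c * s ^ (-β) * Real.exp (-s * (t + u)) := by
        refine integral_congr_ae (Eventually.of_forall fun s => ?_)
        simp only [w, ← integral_mul_const]
        refine integral_congr_ae (Eventually.of_forall fun u => ?_)
        simp only
        rw [mul_assoc, ← Real.exp_add]
        ring_nf
    _ = ∫ u in Set.Ioc (0 : ℝ) 1, ∫ s in Set.Ioi (0 : ℝ),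
          c * s ^ (-β) * Real.exp (-s * (t + u)) := (integral_integral_swap (hprod t ht)).symm
    _ = ∫ u in Set.Ioc (0 : ℝ) 1, β * (t + u) ^ (β - 1) := by
        refine setIntegral_congr_fun measurableSet_Ioc fun u hu => ?_
        exact (hI _ (by linarith [hu.1])).2
    _ = _ := by
        rw [← intervalIntegral.integral_of_le zero_le_one, intervalIntegral.integral_const_mul,
          intervalIntegral.integral_comp_add_left (fun u => u ^ (β - 1)),
          integral_rpow (Or.inl (by linarith)), sub_add_cancel, add_zero, add_comm t 1]
        field_simp

end Mixtures

/-! ### The Fourier symbol of the fractional gradient. -/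

section Symbol

variable {n : ℕ} {α : ℝ}

/-- The Gamma integral after `t ↦ t⁻¹`. It sums up the Gaussian transforms, whose exponents involve
`1/t`. -/
theorem integral_rpow_mul_exp_neg_div {c : ℝ} (hc : 0 < c) (hα1 : α < 1) :
    ∫ t in Set.Ioi (0 : ℝ), t ^ ((α - 3) / 2) * Real.exp (-(c / t)) =
      Real.Gamma ((1 - α) / 2) * c ^ (-((1 - α) / 2)) := by
  have h1 := Real.integral_rpow_mul_exp_neg_mul_Ioi (by linarith : 0 < (1 - α) / 2) hc
  rw [one_div, Real.inv_rpow hc.le, ← Real.rpow_neg hc.le,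
    ← integral_comp_rpow_Ioi _ (by norm_num : (-1 : ℝ) ≠ 0)] at h1
  rw [mul_comm, ← h1]
  refine setIntegral_congr_fun measurableSet_Ioi fun t ht => ?_
  have ht0 : 0 < t := ht
  simp only [abs_neg, abs_one, one_mul, smul_eq_mul]
  rw [← Real.rpow_mul ht0.le, ← mul_assoc, ← Real.rpow_add ht0, Real.rpow_neg_one, div_eq_mul_inv]
  ring_nf

theorem norm_fourierChar_sub_one_le (h ξ : Rn n) :
    ‖((𝐞 ⟪h, ξ⟫ : Circle) : ℂ) - 1‖ ≤ (2 + 2 * Real.pi * ‖ξ‖) * min 1 ‖h‖ := by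
  have hπ := Real.pi_pos
  have h1 : ‖((𝐞 ⟪h, ξ⟫ : Circle) : ℂ) - 1‖ ≤ 2 := by
    refine (norm_sub_le _ _).trans (le_of_eq ?_)
    rw [Circle.norm_coe, norm_one]
    norm_num
  have h2 : ‖((𝐞 ⟪h, ξ⟫ : Circle) : ℂ) - 1‖ ≤ 2 * Real.pi * ‖ξ‖ * ‖h‖ := by
    have := Real.norm_exp_I_mul_ofReal_sub_one_le (x := 2 * Real.pi * ⟪h, ξ⟫)
    rw [Real.fourierChar_apply, mul_comm _ Complex.I]
    refine this.trans ?_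
    rw [norm_mul, Real.norm_of_nonneg (by positivity), mul_assoc _ ‖ξ‖, mul_comm ‖ξ‖]
    gcongr
    exact norm_inner_le_norm _ _
  have h3 := norm_nonneg h
  have h4 := norm_nonneg ξ
  rcases le_total 1 ‖h‖ with hh | hh
  · rw [min_eq_left hh]
    have : 0 ≤ 2 * Real.pi * ‖ξ‖ := by positivity
    linarith
  · rw [min_eq_right hh]
    linarith

theorem integrable_frac_symbol (hn : 1 ≤ n) (hα0 : 0 < α) (hα1 : α < 1) (a ξ : Rn n) :
    Integrable fun h : Rn n =>
      (((𝐞 ⟪h, ξ⟫ : Circle) : ℂ) - 1) * ((⟪a, h⟫ / ‖h‖ ^ ((n : ℝ) + α + 1) : ℝ) : ℂ) := by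
  have hpos : 0 < (n : ℝ) + α := by positivity
  refine ((integrable_kern hn hα0 hα1).const_mul ((2 + 2 * Real.pi * ‖ξ‖) * ‖a‖)).mono'
    ?_ (Eventually.of_forall fun h => ?_)
  · have h1 : Continuous fun h : Rn n => ((𝐞 ⟪h, ξ⟫ : Circle) : ℂ) - 1 :=
      (continuous_induced_dom.comp (Real.continuous_fourierChar.comp (by fun_prop))).sub
        continuous_const
    have h2 : Measurable fun h : Rn n => ⟪a, h⟫ / ‖h‖ ^ ((n : ℝ) + α + 1) := by fun_prop
    exact (h1.measurable.mul (Complex.measurable_ofReal.comp h2)).aestronglyMeasurable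
  · have h1 : ‖((⟪a, h⟫ / ‖h‖ ^ ((n : ℝ) + α + 1) : ℝ) : ℂ)‖ ≤ ‖a‖ * (1 / ‖h‖ ^ ((n : ℝ) + α)) := by
      rw [Complex.norm_real, norm_div, Real.norm_of_nonneg (Real.rpow_nonneg (norm_nonneg h) _),
        ← norm_div_rpow h hpos, mul_div_assoc']
      gcongr
      exact norm_inner_le_norm _ _
    rw [norm_mul]
    calc _ ≤ (2 + 2 * Real.pi * ‖ξ‖) * min 1 ‖h‖ * (‖a‖ * (1 / ‖h‖ ^ ((n : ℝ) + α))) := by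
          gcongr
          exact norm_fourierChar_sub_one_le h ξ
      _ = _ := by rw [kern]; ring

/-- A Gaussian mixture representation of the kernel of the fractional gradient. -/
theorem integral_gamma_inner_div (hα : 0 < (n : ℝ) + α) (a h : Rn n) :
    IntegrableOn (fun t : ℝ => ⟪a, h⟫ * (t ^ (((n : ℝ) + α + 1) / 2 - 1) *
      Real.exp (-(‖h‖ ^ 2 * t)))) (Set.Ioi 0) ∧
    ∫ t in Set.Ioi (0 : ℝ), ⟪a, h⟫ * (t ^ (((n : ℝ) + α + 1) / 2 - 1) *
      Real.exp (-(‖h‖ ^ 2 * t))) =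
      Real.Gamma (((n : ℝ) + α + 1) / 2) * (⟪a, h⟫ / ‖h‖ ^ ((n : ℝ) + α + 1)) := by
  rcases eq_or_ne h 0 with rfl | hh
  · simp
  have hpos : 0 < ‖h‖ := norm_pos_iff.2 hh
  have hs : 0 < ((n : ℝ) + α + 1) / 2 := by linarith
  have h1 := Real.integral_rpow_mul_exp_neg_mul_Ioi hs (by positivity : 0 < ‖h‖ ^ 2)
  have e : (1 / ‖h‖ ^ 2) ^ (((n : ℝ) + α + 1) / 2) = (‖h‖ ^ ((n : ℝ) + α + 1))⁻¹ := by
    rw [one_div, Real.inv_rpow (by positivity), ← Real.rpow_natCast, ← Real.rpow_mul hpos.le]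
    congr 2
    push_cast
    ring
  have hi : IntegrableOn (fun t : ℝ => t ^ (((n : ℝ) + α + 1) / 2 - 1) *
      Real.exp (-(‖h‖ ^ 2 * t))) (Set.Ioi 0) := by
    by_contra hni
    rw [integral_undef hni] at h1
    have : 0 < (1 / ‖h‖ ^ 2) ^ (((n : ℝ) + α + 1) / 2) * Real.Gamma (((n : ℝ) + α + 1) / 2) :=
      mul_pos (by positivity) (Real.Gamma_pos_of_pos hs)
    linarith
  refine ⟨hi.const_mul _, ?_⟩
  rw [integral_const_mul, h1, e]
  ring

/-- The symbol of the fractional gradient. -/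
theorem integral_frac_symbol (hn : 1 ≤ n) (hα0 : 0 < α) (hα1 : α < 1) (a ξ : Rn n) :
    ∫ h : Rn n, (((𝐞 ⟪h, ξ⟫ : Circle) : ℂ) - 1) * ((⟪a, h⟫ / ‖h‖ ^ ((n : ℝ) + α + 1) : ℝ) : ℂ) =
      Complex.I * (((Real.Gamma (((n : ℝ) + α + 1) / 2))⁻¹ * (⟪a, ξ⟫ *
        (Real.pi ^ (1 + (n : ℝ) / 2) * (Real.Gamma ((1 - α) / 2) *
          (Real.pi ^ 2 * ‖ξ‖ ^ 2) ^ (-((1 - α) / 2))))) : ℝ) : ℂ) := by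
  rcases eq_or_ne ξ 0 with rfl | hξ
  · simp
  have hξ0 : 0 < ‖ξ‖ := norm_pos_iff.2 hξ
  have hπ := Real.pi_pos
  have hpos : 0 < (n : ℝ) + α := by positivity
  have hgam := integral_gamma_inner_div (n := n) hpos
  set s : ℝ := ((n : ℝ) + α + 1) / 2 with hs
  have hΓ : 0 < Real.Gamma s := Real.Gamma_pos_of_pos (by rw [hs]; linarith)
  set ν : Measure ℝ := volume.restrict (Set.Ioi 0) with hν
  set E : Rn n → ℂ := fun h => ((𝐞 ⟪h, ξ⟫ : Circle) : ℂ) - 1 with hE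
  have hEc : Continuous E :=
    (continuous_induced_dom.comp (Real.continuous_fourierChar.comp (by fun_prop))).sub
      continuous_const
  have hm : Measurable fun z : Rn n × ℝ =>
      ⟪a, z.1⟫ * (z.2 ^ (s - 1) * Real.exp (-(‖z.1‖ ^ 2 * z.2))) := by fun_prop
  have hint : Integrable (fun z : Rn n × ℝ => E z.1 *
      ((⟪a, z.1⟫ * (z.2 ^ (s - 1) * Real.exp (-(‖z.1‖ ^ 2 * z.2))) : ℝ) : ℂ))
      (volume.prod ν) := by
    have hmm : AEStronglyMeasurable (fun z : Rn n × ℝ => E z.1 *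
      ((⟪a, z.1⟫ * (z.2 ^ (s - 1) * Real.exp (-(‖z.1‖ ^ 2 * z.2))) : ℝ) : ℂ))
      (volume.prod ν) :=
      ((hEc.measurable.comp measurable_fst).mul
        (Complex.measurable_ofReal.comp hm)).aestronglyMeasurable
    rw [integrable_prod_iff hmm]
    constructor
    · exact Eventually.of_forall fun h =>
        ((hgam a h).1.ofReal (𝕜 := ℂ)).const_mul (E h)
    · have h1 := (integrable_frac_symbol hn hα0 hα1 a ξ).norm.const_mul (Real.Gamma s)
      refine h1.congr (Eventually.of_forall fun h => ?_)
      -- Replacing `a` by `sign⟨a,h⟩ a` makes the integrand nonnegative, so the `t`-integral of the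
      -- norm is again given by the Gamma formula.
      have h2 : ∀ᵐ t ∂ν, ‖E h * ((⟪a, h⟫ * (t ^ (s - 1) * Real.exp (-(‖h‖ ^ 2 * t))) : ℝ) : ℂ)‖ =
          ‖E h‖ * (⟪(SignType.sign ⟪a, h⟫ : ℝ) • a, h⟫ *
            (t ^ (s - 1) * Real.exp (-(‖h‖ ^ 2 * t)))) := by
        filter_upwards [ae_restrict_mem measurableSet_Ioi] with t ht
        have ht0 : (0 : ℝ) < t := ht
        rw [norm_mul, Complex.norm_real, norm_mul, Real.norm_of_nonneg
          (by positivity : 0 ≤ t ^ (s - 1) * Real.exp (-(‖h‖ ^ 2 * t))), real_inner_smul_left,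
          sign_mul_self, Real.norm_eq_abs]
      simp only
      rw [integral_congr_ae h2, integral_const_mul, (hgam _ h).2,
        real_inner_smul_left, sign_mul_self, norm_mul, Complex.norm_real, norm_div,
        Real.norm_eq_abs ⟪a, h⟫, Real.norm_of_nonneg (Real.rpow_nonneg (norm_nonneg h) _)]
      ring
  have hin : ∀ t : ℝ, 0 < t →
      ∫ h, E h * ((⟪a, h⟫ * (t ^ (s - 1) * Real.exp (-(‖h‖ ^ 2 * t))) : ℝ) : ℂ) =
      Complex.I * ((⟪a, ξ⟫ * (Real.pi ^ (1 + (n : ℝ) / 2) *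
        (t ^ ((α - 3) / 2) * Real.exp (-(Real.pi ^ 2 * ‖ξ‖ ^ 2 / t)))) : ℝ) : ℂ) := by
    intro t ht
    set g : Rn n → ℝ := fun h => ⟪a, h⟫ * Real.exp (-t * ‖h‖ ^ 2) with hg
    have hgi : Integrable g := integrable_inner_mul_gaussian ht a
    have f1 := fourier_inner_mul_gaussian ht a (-ξ)
    have f2 := fourier_inner_mul_gaussian ht a 0
    -- For fixed `t` the integrand is a Gaussian times a linear form, so its two terms are Fourier
    -- transforms at `-ξ` and at `0`; the latter vanishes.
    have i1 := (Real.fourierIntegral_convergent_iff (-ξ)).2 (hgi.ofReal (𝕜 := ℂ))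
    have i2 := (Real.fourierIntegral_convergent_iff (0 : Rn n)).2 (hgi.ofReal (𝕜 := ℂ))
    have e1 : ∫ h, E h * ((⟪a, h⟫ * (t ^ (s - 1) * Real.exp (-(‖h‖ ^ 2 * t))) : ℝ) : ℂ) =
        ((t ^ (s - 1) : ℝ) : ℂ) * (𝓕 (fun h => (g h : ℂ)) (-ξ) - 𝓕 (fun h => (g h : ℂ)) 0) := by
      rw [Real.fourier_eq, Real.fourier_eq]
      refine Eq.trans ?_ (congrArg (fun w => ((t ^ (s - 1) : ℝ) : ℂ) * w) (integral_sub i1 i2))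
      rw [← integral_const_mul]
      refine integral_congr_ae (Eventually.of_forall fun h => ?_)
      simp only [hE, hg, Circle.smul_def, smul_eq_mul, inner_neg_right, neg_neg, inner_zero_right,
        neg_zero, AddChar.map_zero_eq_one, Circle.coe_one]
      rw [show -(‖h‖ ^ 2 * t) = -t * ‖h‖ ^ 2 by ring]
      push_cast
      ring
    rw [e1, hg, f1, f2]
    have e2 : t ^ ((α - 3) / 2) = t ^ (s - 1) * (t⁻¹ * (t ^ ((n : ℝ) / 2))⁻¹) := by
      rw [← Real.rpow_neg_one t, ← Real.rpow_neg ht.le, ← Real.rpow_add ht, ← Real.rpow_add ht, hs]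
      congr 1
      ring
    rw [e2, Real.rpow_add hπ, Real.rpow_one, Real.div_rpow hπ.le ht.le, inner_neg_right,
      inner_zero_right, norm_neg, show -(Real.pi ^ 2 * ‖ξ‖ ^ 2 / t) = -(Real.pi ^ 2 / t) * ‖ξ‖ ^ 2 by
        ring]
    push_cast
    ring
  calc ∫ h : Rn n, E h * ((⟪a, h⟫ / ‖h‖ ^ ((n : ℝ) + α + 1) : ℝ) : ℂ)
      = (((Real.Gamma s)⁻¹ : ℝ) : ℂ) * ∫ h, ∫ t, E h *
          ((⟪a, h⟫ * (t ^ (s - 1) * Real.exp (-(‖h‖ ^ 2 * t))) : ℝ) : ℂ) ∂ν := by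
        rw [← integral_const_mul]
        refine integral_congr_ae (Eventually.of_forall fun h => ?_)
        simp only [integral_const_mul]
        rw [integral_complex_ofReal, (hgam a h).2]
        have : (Real.Gamma s : ℂ) ≠ 0 := by exact_mod_cast hΓ.ne'
        push_cast
        field_simp
    _ = (((Real.Gamma s)⁻¹ : ℝ) : ℂ) * ∫ t, (∫ h, E h *
          ((⟪a, h⟫ * (t ^ (s - 1) * Real.exp (-(‖h‖ ^ 2 * t))) : ℝ) : ℂ)) ∂ν := by
        rw [integral_integral_swap hint]
    _ = (((Real.Gamma s)⁻¹ : ℝ) : ℂ) * ∫ t, Complex.I * ((⟪a, ξ⟫ * (Real.pi ^ (1 + (n : ℝ) / 2) *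
        (t ^ ((α - 3) / 2) * Real.exp (-(Real.pi ^ 2 * ‖ξ‖ ^ 2 / t)))) : ℝ) : ℂ) ∂ν := by
        congr 1
        refine integral_congr_ae ?_
        filter_upwards [ae_restrict_mem measurableSet_Ioi] with t ht
        exact hin t ht
    _ = _ := by
        rw [integral_const_mul, integral_complex_ofReal, integral_const_mul, integral_const_mul,
          integral_rpow_mul_exp_neg_div (by positivity) hα1]
        push_cast
        ring

/-- The normalization of `μ_{n,α}` is exactly the one that cancels both Gamma factors and leaves no
constant in front of the symbol. -/
theorem muConst_mul_symbol (hα0 : 0 < α) (hα1 : α < 1) (a ξ : Rn n) :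
    muConst n α * ((Real.Gamma (((n : ℝ) + α + 1) / 2))⁻¹ * (⟪a, ξ⟫ *
        (Real.pi ^ (1 + (n : ℝ) / 2) * (Real.Gamma ((1 - α) / 2) *
          (Real.pi ^ 2 * ‖ξ‖ ^ 2) ^ (-((1 - α) / 2)))))) =
      ⟪a, ξ⟫ / ‖ξ‖ * ‖(2 * Real.pi) • ξ‖ ^ α := by
  rcases eq_or_ne ξ 0 with rfl | hξ
  · simp
  have hξ0 : 0 < ‖ξ‖ := norm_pos_iff.2 hξ
  have hπ := Real.pi_pos
  have h1 : 0 < Real.Gamma (((n : ℝ) + α + 1) / 2) := Real.Gamma_pos_of_pos (by positivity)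
  have h2 : 0 < Real.Gamma ((1 - α) / 2) := Real.Gamma_pos_of_pos (by linarith)
  have e1 : (Real.pi ^ 2 * ‖ξ‖ ^ 2) ^ (-((1 - α) / 2)) = Real.pi ^ α * ‖ξ‖ ^ α *
      (Real.pi⁻¹ * ‖ξ‖⁻¹) := by
    rw [← mul_pow, ← Real.rpow_natCast, ← Real.rpow_mul (by positivity),
      Real.mul_rpow hπ.le hξ0.le, show ((2 : ℕ) : ℝ) * -((1 - α) / 2) = α - 1 by push_cast; ring,
      Real.rpow_sub_one hπ.ne', Real.rpow_sub_one hξ0.ne']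
    field_simp
  have e2 : Real.pi ^ (-(n : ℝ) / 2) * Real.pi ^ (1 + (n : ℝ) / 2) = Real.pi := by
    rw [← Real.rpow_add hπ, show -(n : ℝ) / 2 + (1 + (n : ℝ) / 2) = 1 by ring, Real.rpow_one]
  rw [e1, muConst, norm_smul, Real.norm_of_nonneg (by positivity), Real.mul_rpow (by positivity)
    hξ0.le, Real.mul_rpow (by norm_num) hπ.le]
  calc _ = (Real.pi ^ (-(n : ℝ) / 2) * Real.pi ^ (1 + (n : ℝ) / 2)) * (2 ^ α *
        (Real.Gamma (((n : ℝ) + α + 1) / 2) * (Real.Gamma (((n : ℝ) + α + 1) / 2))⁻¹) *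
        (Real.Gamma ((1 - α) / 2) * (Real.Gamma ((1 - α) / 2))⁻¹) * ⟪a, ξ⟫ *
        (Real.pi ^ α * ‖ξ‖ ^ α * (Real.pi⁻¹ * ‖ξ‖⁻¹))) := by
        rw [div_eq_mul_inv]; ring
    _ = _ := by
        rw [e2, mul_inv_cancel₀ h1.ne', mul_inv_cancel₀ h2.ne']
        field_simp

/-- The Fourier transform of the fractional gradient of a Schwartz function. -/
theorem ft_inner_fracGrad (hn : 1 ≤ n) (hα0 : 0 < α) (hα1 : α < 1) (f : 𝓢(Rn n, ℝ))
    (a ξ : Rn n) :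
    ft (fun x => ⟪a, fracGrad α f x⟫) ξ =
      Complex.I * ((⟪a, ξ⟫ / ‖ξ‖ * ‖(2 * Real.pi) • ξ‖ ^ α : ℝ) : ℂ) * ft f ξ := by
  have hgrad := integrable_grad_integrand hn hα0 hα1 f
  have hint : Integrable (fun z : Rn n × Rn n => ⟪a,
      ((f (z.1 + z.2) - f z.1) / ‖z.2‖ ^ ((n : ℝ) + α + 1)) • z.2⟫) (volume.prod volume) :=
    hgrad.const_inner a
  have hint2 : Integrable (fun z : Rn n × Rn n => 𝐞 (-⟪z.1, ξ⟫) • ((⟪a,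
      ((f (z.1 + z.2) - f z.1) / ‖z.2‖ ^ ((n : ℝ) + α + 1)) • z.2⟫ : ℝ) : ℂ))
      (volume.prod volume) := by
    refine (hint.ofReal (𝕜 := ℂ)).mono (AEStronglyMeasurable.smul ?_ (hint.ofReal (𝕜 := ℂ)).1)
      (Eventually.of_forall fun z => by simp [Circle.norm_smul])
    have hc : Continuous fun z : Rn n × Rn n => -⟪z.1, ξ⟫ := by fun_prop
    exact (continuous_induced_dom.comp (Real.continuous_fourierChar.comp hc)).aestronglyMeasurable
  have hfi : Integrable f := f.integrable
  calc ft (fun x => ⟪a, fracGrad α f x⟫) ξ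
      = (muConst n α : ℂ) * ∫ x, ∫ h, 𝐞 (-⟪x, ξ⟫) • ((⟪a,
          ((f (x + h) - f x) / ‖h‖ ^ ((n : ℝ) + α + 1)) • h⟫ : ℝ) : ℂ) := by
        rw [ft, Real.fourier_eq, ← integral_const_mul]
        refine integral_congr_ae ?_
        filter_upwards [hgrad.prod_right_ae] with x hx
        simp only [Circle.smul_def, smul_eq_mul, integral_const_mul]
        rw [integral_complex_ofReal, integral_inner hx, fracGrad, real_inner_smul_right]
        push_cast
        ring
    _ = (muConst n α : ℂ) * ∫ h, ∫ x, 𝐞 (-⟪x, ξ⟫) • ((⟪a,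
          ((f (x + h) - f x) / ‖h‖ ^ ((n : ℝ) + α + 1)) • h⟫ : ℝ) : ℂ) := by
        rw [integral_integral_swap hint2]
    _ = (muConst n α : ℂ) * ∫ h, (((𝐞 ⟪h, ξ⟫ : Circle) : ℂ) - 1) *
          ((⟪a, h⟫ / ‖h‖ ^ ((n : ℝ) + α + 1) : ℝ) : ℂ) * ft f ξ := by
        congr 1
        refine integral_congr_ae (Eventually.of_forall fun h => ?_)
        have h1 : ft (fun x => f (x + h) - f x) ξ = (((𝐞 ⟪h, ξ⟫ : Circle) : ℂ) - 1) * ft f ξ := by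
          have h2 := ft_comp_sub f (-h) ξ
          simp only [sub_neg_eq_add, inner_neg_left, neg_neg, Circle.smul_def, smul_eq_mul] at h2
          rw [ft_sub (hfi.comp_add_right h) hfi, h2]
          ring
        beta_reduce
        rw [mul_assoc, mul_comm _ (ft f ξ), ← mul_assoc, ← h1, ft, Real.fourier_eq,
          ← integral_mul_const]
        refine integral_congr_ae (Eventually.of_forall fun x => ?_)
        simp only [Circle.smul_def, smul_eq_mul, real_inner_smul_right]
        push_cast
        ring
    _ = _ := by
        rw [integral_mul_const, integral_frac_symbol hn hα0 hα1, ← muConst_mul_symbol hα0 hα1]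
        push_cast
        ring

end Symbol

/-! ### Bessel operators on real Schwartz functions. -/

section BesselSchwartz

variable {n : ℕ}

/-- The symbol `(1 + |2πξ|²)^{s/2}` of `(Id - Δ)^{s/2}`. -/
noncomputable def besselSymbol (n : ℕ) (s : ℝ) (ξ : Rn n) : ℝ :=
  (1 + ‖(2 * Real.pi) • ξ‖ ^ 2) ^ (s / 2)

theorem hasTemperateGrowth_besselSymbol (s : ℝ) :
    (fun ξ : Rn n => ((besselSymbol n s ξ : ℝ) : ℂ)).HasTemperateGrowth := by
  have h1 : (fun ξ : Rn n => (1 + ‖ξ‖ ^ 2) ^ (s / 2)).HasTemperateGrowth := by fun_prop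
  have h2 : (fun ξ : Rn n => (2 * Real.pi) • ξ).HasTemperateGrowth := by fun_prop
  have h3 : (fun ξ : Rn n => besselSymbol n s ξ).HasTemperateGrowth := h1.comp h2
  fun_prop

/-- The operator `(Id - Δ)^{s/2}` on complex-valued Schwartz functions. -/
noncomputable def besselC (s : ℝ) : 𝓢(Rn n, ℂ) →L[ℂ] 𝓢(Rn n, ℂ) :=
  SchwartzMap.fourierMultiplierCLM ℂ (fun ξ : Rn n => ((besselSymbol n s ξ : ℝ) : ℂ))

theorem fourier_besselC (s : ℝ) (f : 𝓢(Rn n, ℂ)) (ξ : Rn n) :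
    𝓕 (besselC s f) ξ = besselSymbol n s ξ * 𝓕 f ξ := by
  rw [besselC, SchwartzMap.fourierMultiplierCLM_apply, FourierTransform.fourier_fourierInv_eq,
    SchwartzMap.smulLeftCLM_apply_apply (hasTemperateGrowth_besselSymbol s), smul_eq_mul]

/-- The operator `(Id - Δ)^{s/2}` on real-valued Schwartz functions. -/
noncomputable def besselR (s : ℝ) (f : 𝓢(Rn n, ℝ)) : 𝓢(Rn n, ℝ) :=
  SchwartzMap.postcompCLM (𝕜 := ℝ) Complex.reCLM (besselC s (toComplex f))

theorem conj_ft (f : Rn n → ℝ) (ξ : Rn n) : (starRingEnd ℂ) (ft f ξ) = ft f (-ξ) := by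
  rw [ft, Real.fourier_eq, Real.fourier_eq, ← integral_conj]
  refine integral_congr_ae (Eventually.of_forall fun x => ?_)
  simp only [Circle.smul_def, smul_eq_mul, map_mul, Complex.conj_ofReal, inner_neg_right, neg_neg,
    Circle.starRingEnd_addChar]

theorem besselSymbol_neg (s : ℝ) (ξ : Rn n) : besselSymbol n s (-ξ) = besselSymbol n s ξ := by
  simp [besselSymbol]

/-- The symbol is real and even, so conjugation of the inversion integral amounts to `ξ ↦ -ξ`. Hence
the operator preserves real-valued functions. -/
theorem im_besselC_toComplex (s : ℝ) (f : 𝓢(Rn n, ℝ)) (x : Rn n) :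
    (besselC s (toComplex f) x).im = 0 := by
  rw [← Complex.conj_eq_iff_im]
  have h1 : besselC s (toComplex f) x = ∫ ξ, 𝐞 ⟪ξ, x⟫ • (besselSymbol n s ξ * ft f ξ : ℂ) := by
    rw [besselC, SchwartzMap.fourierMultiplierCLM_apply, SchwartzMap.fourierInv_coe,
      Real.fourierInv_eq]
    refine integral_congr_ae (Eventually.of_forall fun ξ => ?_)
    simp only
    rw [SchwartzMap.smulLeftCLM_apply_apply (hasTemperateGrowth_besselSymbol s), smul_eq_mul]
    rfl
  rw [h1, ← integral_conj, ← integral_neg_eq_self]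
  refine integral_congr_ae (Eventually.of_forall fun ξ => ?_)
  simp only [Circle.smul_def, smul_eq_mul, map_mul, Complex.conj_ofReal, inner_neg_left,
    conj_ft, neg_neg, besselSymbol_neg, Circle.starRingEnd_addChar]

theorem toComplex_besselR (s : ℝ) (f : 𝓢(Rn n, ℝ)) :
    toComplex (besselR s f) = besselC s (toComplex f) := by
  ext x
  apply Complex.ext
  · rfl
  · rw [im_besselC_toComplex]
    rfl

theorem ft_besselR (s : ℝ) (f : 𝓢(Rn n, ℝ)) (ξ : Rn n) :
    ft (besselR s f) ξ = besselSymbol n s ξ * ft f ξ := by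
  rw [ft_schwartz, toComplex_besselR, fourier_besselC, ft_schwartz]

end BesselSchwartz

/-! ### Equivalence of the norms on Schwartz functions. -/

section Estimates

variable {n : ℕ} {α : ℝ}

/-- Convolution with an integrable kernel. -/
theorem exists_conv {K : Rn n → ℝ} (hK : Integrable K) (f : 𝓢(Rn n, ℝ)) :
    ∃ u : Rn n → ℝ, Integrable u ∧ (∀ ξ, ft u ξ = ft K ξ * ft f ξ) ∧
      ∀ p : ℝ≥0∞, 1 ≤ p → p ≠ ⊤ → MemLp u p ∧
        (eLpNorm u p volume).toReal ≤ (∫ x, ‖K x‖) * (eLpNorm f p volume).toReal := by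
  have hf : Integrable f := f.integrable
  set u : Rn n → ℝ := fun x => ∫ y, K y * f (x - y) with hu
  have hui : Integrable u := hK.integrable_convolution (ContinuousLinearMap.mul ℝ ℝ) hf
  refine ⟨u, hui, fun ξ => ?_, fun p hp1 hp => ?_⟩
  · have h := Real.fourier_mul_convolution_eq (hK.ofReal (𝕜 := ℂ)) (hf.ofReal (𝕜 := ℂ)) ξ
    have e : ((fun x => (K x : ℂ)) ⋆[ContinuousLinearMap.mul ℂ ℂ] fun x => (f x : ℂ)) =
        fun x => (u x : ℂ) := by
      funext x
      rw [convolution_def, hu, ← integral_complex_ofReal]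
      refine integral_congr_ae (Eventually.of_forall fun y => ?_)
      simp
    exact (congrFun (congrArg (fun g : Rn n → ℂ => 𝓕 g) e) ξ).symm.trans h
  · have hfp : MemLp f p := f.memLp p
    have hle : eLpNorm u p volume ≤ (∫⁻ y, ‖K y‖ₑ) * eLpNorm f p volume := by
      refine eLpNorm_le_of_conv_bound hp1 hp hK.1.enorm hfp.1 (Eventually.of_forall fun x => ?_)
      refine (enorm_integral_le_lintegral_enorm _).trans (le_of_eq ?_)
      simp only [enorm_mul]
    have hKt : ∫⁻ y, ‖K y‖ₑ ≠ ⊤ := hK.2.ne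
    refine ⟨⟨hui.1, hle.trans_lt (ENNReal.mul_lt_top hKt.lt_top hfp.2)⟩, ?_⟩
    rw [integral_norm_eq_lintegral_enorm hK.1, ← ENNReal.toReal_mul]
    exact ENNReal.toReal_mono (ENNReal.mul_ne_top hKt hfp.2.ne) hle

/-- By Parseval equal Fourier transforms give equal pairings with test functions, and these pairings
determine the `L^p` norm. -/
theorem eLpNorm_toReal_le_of_ft_eq {p : ℝ≥0∞} (hp1 : 1 < p) (hp : p ≠ ⊤) {u v : Rn n → ℝ}
    (hu : Integrable u) (hup : MemLp u p) (hv : Integrable v) (hvp : MemLp v p)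
    (h : ∀ ξ, ft u ξ = ft v ξ) : (eLpNorm u p volume).toReal ≤ (eLpNorm v p volume).toReal := by
  obtain ⟨q, hpq⟩ : ∃ q, p.HolderConjugate q := ⟨_, ENNReal.HolderConjugate.inv_one_sub_inv' hp1.le⟩
  have hq : q ≠ ⊤ := (ENNReal.HolderConjugate.ne_top_iff_ne_one q p).2 hp1.ne'
  refine eLpNorm_le_of_test hpq hp hq hup ENNReal.toReal_nonneg fun ψ hψ hψc => ?_
  have e1 := integral_mul_eq_integral_ft hu (hψc.toSchwartzMap hψ)
  have e2 := integral_mul_eq_integral_ft hv (hψc.toSchwartzMap hψ)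
  simp only [h] at e1
  have e3 : ∫ x, u x * ψ x = ∫ x, v x * ψ x := Complex.ofReal_injective (e1.trans e2.symm)
  rw [e3]
  exact norm_integral_mul_le_of_memLp hpq hvp (hψ.continuous.memLp_of_hasCompactSupport hψc)

/-- The Bessel potential is bounded on `L^p`. -/
theorem exists_eLpNorm_le_besselR (hα0 : 0 < α) {p : ℝ≥0∞} (hp1 : 1 < p) (hp : p ≠ ⊤) :
    ∃ C : ℝ, 0 ≤ C ∧ ∀ f : 𝓢(Rn n, ℝ),
      (eLpNorm f p volume).toReal ≤ C * (eLpNorm (besselR α f) p volume).toReal := by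
  obtain ⟨K, hK, hft⟩ := exists_integrable_ft_eq_bessel (n := n) (half_pos hα0)
  refine ⟨∫ x, ‖K x‖, by positivity, fun f => ?_⟩
  obtain ⟨u, hu, hfu, hup⟩ := exists_conv hK (besselR α f)
  obtain ⟨hum, hule⟩ := hup p hp1.le hp
  refine (eLpNorm_toReal_le_of_ft_eq hp1 hp f.integrable (f.memLp p) hu hum fun ξ => ?_).trans hule
  rw [hfu, hft, ft_besselR, ← mul_assoc, besselSymbol, ← Complex.ofReal_mul,
    ← Real.rpow_add (by positivity), neg_add_cancel, Real.rpow_zero, Complex.ofReal_one, one_mul]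

/-- The fractional Laplacian `(-Δ)^{α/2}` on Schwartz functions. -/
theorem exists_fracLaplacian (hα0 : 0 < α) (hα1 : α < 1) {p : ℝ≥0∞} (hp1 : 1 < p) (hp : p ≠ ⊤) :
    ∃ C : ℝ, 0 ≤ C ∧ ∀ f : 𝓢(Rn n, ℝ), ∃ u : Rn n → ℝ, Integrable u ∧ MemLp u p ∧
      (∀ ξ, ft u ξ = ((‖(2 * Real.pi) • ξ‖ ^ α : ℝ) : ℂ) * ft f ξ) ∧
      (eLpNorm u p volume).toReal ≤
        (eLpNorm (besselR α f) p volume).toReal + C * (eLpNorm f p volume).toReal ∧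
      (eLpNorm (besselR α f) p volume).toReal ≤
        (eLpNorm u p volume).toReal + C * (eLpNorm f p volume).toReal := by
  obtain ⟨K, hK, hft⟩ := exists_integrable_ft_eq_bessel_sub (n := n) (half_pos hα0)
    (by linarith : α / 2 < 1)
  refine ⟨∫ x, ‖K x‖, by positivity, fun f => ?_⟩
  obtain ⟨v, hv, hfv, hvp⟩ := exists_conv hK f
  obtain ⟨hvm, hvle⟩ := hvp p hp1.le hp
  have hB : MemLp (besselR α f) p := (besselR α f).memLp p
  have hBi : Integrable (besselR α f) := (besselR α f).integrable
  have hum : MemLp (fun x => besselR α f x - v x) p := hB.sub hvm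
  -- The fractional Laplacian is `(Id-Δ)^{α/2} f` minus the convolution `v` with the kernel of the
  -- difference of symbols. The triangle inequality then works in both directions.
  refine ⟨fun x => besselR α f x - v x, hBi.sub hv, hum, fun ξ => ?_, ?_, ?_⟩
  · rw [ft_sub hBi hv, hfv, hft, ft_besselR, besselSymbol, ← sub_mul, ← Complex.ofReal_sub,
      sub_sub_cancel, ← Real.rpow_natCast, ← Real.rpow_mul (norm_nonneg _)]
    congr 4
    push_cast
    ring
  · have h1 : eLpNorm (fun x => besselR α f x - v x) p volume ≤
        eLpNorm (besselR α f) p volume + eLpNorm v p volume := eLpNorm_sub_le hB.1 hvm.1 hp1.le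
    refine (ENNReal.toReal_mono (by finiteness [hB.2.ne, hvm.2.ne]) h1).trans ?_
    rw [ENNReal.toReal_add hB.2.ne hvm.2.ne]
    gcongr
  · have h1 : eLpNorm (besselR α f) p volume ≤
        eLpNorm (fun x => besselR α f x - v x) p volume + eLpNorm v p volume := by
      refine le_trans (le_of_eq ?_) (eLpNorm_add_le hum.1 hvm.1 hp1.le)
      congr 1
      funext x
      simp
    refine (ENNReal.toReal_mono (by finiteness [hum.2.ne, hvm.2.ne]) h1).trans ?_
    rw [ENNReal.toReal_add hum.2.ne hvm.2.ne]
    gcongr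

theorem inner_single_one (j : Fin n) (x : Rn n) : ⟪EuclideanSpace.single j (1 : ℝ), x⟫ = x j := by
  simp [EuclideanSpace.inner_single_left]

theorem memLp_inner_fracGrad (hn : 1 ≤ n) (hα0 : 0 < α) (hα1 : α < 1) (f : 𝓢(Rn n, ℝ)) (a : Rn n)
    {p : ℝ≥0∞} (hp1 : 1 ≤ p) : MemLp (fun x => ⟪a, fracGrad α f x⟫) p :=
  (memLp_fracGrad hn hα0 hα1 f hp1).const_inner a

theorem integrable_inner_fracGrad (hn : 1 ≤ n) (hα0 : 0 < α) (hα1 : α < 1) (f : 𝓢(Rn n, ℝ))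
    (a : Rn n) : Integrable fun x => ⟪a, fracGrad α f x⟫ :=
  (integrable_fracGrad hn hα0 hα1 f).const_inner a

/-- Up to the factor `i`, the component `⟨a, ∇^α f⟩` has the Fourier transform of a Riesz transform
of `u = (-Δ)^{α/2} f`; the Riesz bound and duality conclude. -/
theorem exists_eLpNorm_inner_fracGrad_le (hn : 1 ≤ n) (hα0 : 0 < α) (hα1 : α < 1) {p : ℝ≥0∞}
    (hp1 : 1 < p) (hp : p ≠ ⊤) (a : Rn n) :
    ∃ C : ℝ, 0 ≤ C ∧ ∀ (f : 𝓢(Rn n, ℝ)) (u : Rn n → ℝ), Integrable u → MemLp u p →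
      (∀ ξ, ft u ξ = ((‖(2 * Real.pi) • ξ‖ ^ α : ℝ) : ℂ) * ft f ξ) →
      (eLpNorm (fun x => ⟪a, fracGrad α f x⟫) p volume).toReal ≤
        C * (eLpNorm u p volume).toReal := by
  obtain ⟨q, hpq⟩ : ∃ q, p.HolderConjugate q := ⟨_, ENNReal.HolderConjugate.inv_one_sub_inv' hp1.le⟩
  have hq : q ≠ ⊤ := (ENNReal.HolderConjugate.ne_top_iff_ne_one q p).2 hp1.ne'
  obtain ⟨C, hC, hbd⟩ := exists_norm_riesz_pairing_le hpq hp1 hp a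
  refine ⟨C, hC, fun f u hu hup hft => ?_⟩
  refine eLpNorm_le_of_test hpq hp hq (memLp_inner_fracGrad hn hα0 hα1 f a hp1.le) (by positivity)
    fun ψ hψ hψc => ?_
  have e1 := integral_mul_eq_integral_ft (integrable_inner_fracGrad hn hα0 hα1 f a)
    (hψc.toSchwartzMap hψ)
  have h1 := hbd u hu hup (hψc.toSchwartzMap hψ) hψc
  have e2 : ∫ ξ, ft (fun x => ⟪a, fracGrad α f x⟫) ξ * ftInv (hψc.toSchwartzMap hψ) ξ =
      Complex.I * ∫ ξ, ((⟪a, ξ⟫ / ‖ξ‖ : ℝ) : ℂ) * (ft u ξ * ftInv (hψc.toSchwartzMap hψ) ξ) := by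
    rw [← integral_const_mul]
    refine integral_congr_ae (Eventually.of_forall fun ξ => ?_)
    simp only [ft_inner_fracGrad hn hα0 hα1, hft]
    push_cast
    ring
  rw [e2] at e1
  have e3 := congrArg norm e1
  rw [Complex.norm_real, norm_mul, Complex.norm_I, one_mul] at e3
  refine (le_of_eq e3).trans (h1.trans (le_of_eq ?_))
  rw [mul_assoc]
  rfl

/-- The identity `∑ (ξ_j/|ξ|)² = 1`. At `ξ = 0` the sum is `0` by convention, which is why `t` must
vanish there. -/
theorem sum_coord_div_mul (ξ : Rn n) {t : ℝ} (ht : ξ = 0 → t = 0) :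
    ∑ j, ξ j / ‖ξ‖ * (ξ j / ‖ξ‖ * t) = t := by
  rcases eq_or_ne ξ 0 with h | hξ
  · simp [ht h]
  · have h1 := EuclideanSpace.real_norm_sq_eq ξ
    have h2 : 0 < ‖ξ‖ := norm_pos_iff.2 hξ
    calc ∑ j, ξ j / ‖ξ‖ * (ξ j / ‖ξ‖ * t) = (∑ j, ξ j ^ 2) * (t / ‖ξ‖ ^ 2) := by
          rw [Finset.sum_mul]
          refine Finset.sum_congr rfl fun j _ => ?_
          field_simp
      _ = t := by
          rw [← h1]
          field_simp

/-- The reverse bound: a second application of the Riesz transforms to the components of `∇^α f`,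
summed over `j`, gives back `(-Δ)^{α/2} f`. -/
theorem exists_eLpNorm_fracLaplacian_le (hn : 1 ≤ n) (hα0 : 0 < α) (hα1 : α < 1) {p : ℝ≥0∞}
    (hp1 : 1 < p) (hp : p ≠ ⊤) :
    ∃ C : ℝ, 0 ≤ C ∧ ∀ (f : 𝓢(Rn n, ℝ)) (u : Rn n → ℝ), Integrable u → MemLp u p →
      (∀ ξ, ft u ξ = ((‖(2 * Real.pi) • ξ‖ ^ α : ℝ) : ℂ) * ft f ξ) →
      (eLpNorm u p volume).toReal ≤ C * (eLpNorm (fracGrad α f) p volume).toReal := by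
  obtain ⟨q, hpq⟩ : ∃ q, p.HolderConjugate q := ⟨_, ENNReal.HolderConjugate.inv_one_sub_inv' hp1.le⟩
  have hq : q ≠ ⊤ := (ENNReal.HolderConjugate.ne_top_iff_ne_one q p).2 hp1.ne'
  choose C hC hbd using fun j : Fin n =>
    exists_norm_riesz_pairing_le hpq hp1 hp (EuclideanSpace.single j (1 : ℝ))
  refine ⟨∑ j, C j, Finset.sum_nonneg fun j _ => hC j, fun f u hu hup hft => ?_⟩
  refine eLpNorm_le_of_test hpq hp hq hup
    (mul_nonneg (Finset.sum_nonneg fun j _ => hC j) ENNReal.toReal_nonneg) fun ψ hψ hψc => ?_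
  set ψs := hψc.toSchwartzMap hψ
  set e : Fin n → Rn n := fun j => EuclideanSpace.single j (1 : ℝ) with he
  have hgi := fun j => integrable_inner_fracGrad hn hα0 hα1 f (e j)
  have hgp := fun j => memLp_inner_fracGrad hn hα0 hα1 f (e j) hp1.le
  have hgrad := memLp_fracGrad hn hα0 hα1 f hp1.le
  have hle : ∀ j, (eLpNorm (fun x => ⟪e j, fracGrad α f x⟫) p volume).toReal ≤
      (eLpNorm (fracGrad α f) p volume).toReal := fun j => by
    refine ENNReal.toReal_mono hgrad.2.ne (eLpNorm_mono fun x => ?_)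
    refine (norm_inner_le_norm _ _).trans (le_of_eq ?_)
    simp [he]
  have e1 := integral_mul_eq_integral_ft hu ψs
  have e2 : ∫ ξ, ft u ξ * ftInv ψs ξ = ∑ j, -Complex.I * ∫ ξ, ((⟪e j, ξ⟫ / ‖ξ‖ : ℝ) : ℂ) *
      (ft (fun x => ⟪e j, fracGrad α f x⟫) ξ * ftInv ψs ξ) := by
    simp only [← integral_const_mul]
    rw [← integral_finsetSum _ fun j _ =>
      (integrable_riesz_pairing (hgi j) ψs (e j)).const_mul (-Complex.I)]
    refine integral_congr_ae (Eventually.of_forall fun ξ => ?_)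
    have h3 := sum_coord_div_mul ξ (t := ‖(2 * Real.pi) • ξ‖ ^ α) fun h => by
      rw [h, smul_zero, norm_zero, Real.zero_rpow hα0.ne']
    simp only [hft, ft_inner_fracGrad hn hα0 hα1]
    simp only [he, inner_single_one]
    conv_lhs => rw [← h3]
    push_cast
    rw [Finset.sum_mul, Finset.sum_mul]
    refine Finset.sum_congr rfl fun j _ => ?_
    linear_combination ((ξ j / ‖ξ‖ : ℂ) ^ 2 * (‖(2 * Real.pi) • ξ‖ ^ α : ℝ) * ft f ξ * ftInv ψs ξ) *
      Complex.I_mul_I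
  rw [e2] at e1
  have e3 := congrArg norm e1
  rw [Complex.norm_real] at e3
  refine (le_of_eq e3).trans ((norm_sum_le _ _).trans ?_)
  rw [mul_assoc, Finset.sum_mul]
  refine Finset.sum_le_sum fun j _ => ?_
  rw [norm_mul, norm_neg, Complex.norm_I, one_mul]
  refine (hbd j _ (hgi j) (hgp j) ψs hψc).trans ?_
  exact mul_le_mul_of_nonneg_left (mul_le_mul_of_nonneg_right (hle j) ENNReal.toReal_nonneg) (hC j)

theorem eLpNorm_toReal_le_sum_inner {p : ℝ≥0∞} (hp1 : 1 ≤ p) {g : Rn n → Rn n} (hg : MemLp g p) :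
    (eLpNorm g p volume).toReal ≤
      ∑ j, (eLpNorm (fun x => ⟪EuclideanSpace.single j (1 : ℝ), g x⟫) p volume).toReal := by
  have hm : ∀ j : Fin n, MemLp (fun x => ⟪EuclideanSpace.single j (1 : ℝ), g x⟫) p := fun j =>
    hg.const_inner _
  rw [← ENNReal.toReal_sum fun j _ => (hm j).2.ne]
  refine ENNReal.toReal_mono (ENNReal.sum_ne_top.2 fun j _ => (hm j).2.ne) ?_
  have h1 : eLpNorm g p volume ≤
      eLpNorm (∑ j, fun x => ‖⟪EuclideanSpace.single j (1 : ℝ), g x⟫‖) p volume := by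
    refine eLpNorm_mono fun x => ?_
    rw [Finset.sum_apply]
    refine le_trans ?_ (le_abs_self _)
    simp only [inner_single_one]
    rw [EuclideanSpace.norm_eq]
    refine Real.sqrt_le_iff.2 ⟨Finset.sum_nonneg fun j _ => norm_nonneg _, ?_⟩
    exact Finset.sum_sq_le_sq_sum_of_nonneg fun j _ => norm_nonneg _
  refine h1.trans ((eLpNorm_sum_le (fun j _ => (hm j).1.norm) hp1).trans (le_of_eq ?_))
  simp only [eLpNorm_norm]

/-- The two norms are equivalent on Schwartz functions. -/
theorem exists_schwartz_norm_equiv (hn : 1 ≤ n) (hα0 : 0 < α) (hα1 : α < 1) {p : ℝ≥0∞}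
    (hp1 : 1 < p) (hp : p ≠ ⊤) :
    ∃ C : ℝ, 0 < C ∧ ∀ f : 𝓢(Rn n, ℝ),
      (eLpNorm f p volume).toReal + (eLpNorm (fracGrad α f) p volume).toReal ≤
        C * (eLpNorm (besselR α f) p volume).toReal ∧
      (eLpNorm (besselR α f) p volume).toReal ≤
        C * ((eLpNorm f p volume).toReal + (eLpNorm (fracGrad α f) p volume).toReal) := by
  obtain ⟨C₁, hC₁, h₁⟩ := exists_eLpNorm_le_besselR (n := n) hα0 hp1 hp
  obtain ⟨C₂, hC₂, h₂⟩ := exists_fracLaplacian (n := n) hα0 hα1 hp1 hp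
  choose C₃ hC₃ h₃ using fun j : Fin n =>
    exists_eLpNorm_inner_fracGrad_le hn hα0 hα1 hp1 hp (EuclideanSpace.single j (1 : ℝ))
  obtain ⟨C₄, hC₄, h₄⟩ := exists_eLpNorm_fracLaplacian_le hn hα0 hα1 hp1 hp
  set D := ∑ j, C₃ j
  have hD : 0 ≤ D := Finset.sum_nonneg fun j _ => hC₃ j
  -- The first bound costs `C₁ + D (1 + C₂ C₁)` and the second `C₄ + C₂`; the final `1` ensures
  -- positivity.
  refine ⟨C₁ + D * (1 + C₂ * C₁) + C₄ + C₂ + 1, by positivity, fun f => ?_⟩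
  obtain ⟨u, hu, hup, hft, hu1, hu2⟩ := h₂ f
  have a1 := h₁ f
  have a4 := h₄ f u hu hup hft
  have a3 : (eLpNorm (fracGrad α f) p volume).toReal ≤ D * (eLpNorm u p volume).toReal := by
    refine (eLpNorm_toReal_le_sum_inner hp1.le (memLp_fracGrad hn hα0 hα1 f hp1.le)).trans ?_
    rw [Finset.sum_mul]
    exact Finset.sum_le_sum fun j _ => h₃ j f u hu hup hft
  set F := (eLpNorm f p volume).toReal
  set B := (eLpNorm (besselR α f) p volume).toReal
  set U := (eLpNorm u p volume).toReal
  set G := (eLpNorm (fracGrad α f) p volume).toReal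
  have hF : 0 ≤ F := ENNReal.toReal_nonneg
  have hB : 0 ≤ B := ENNReal.toReal_nonneg
  have hG : 0 ≤ G := ENNReal.toReal_nonneg
  constructor
  · have b1 : U ≤ (1 + C₂ * C₁) * B := by
      calc U ≤ B + C₂ * F := hu1
        _ ≤ B + C₂ * (C₁ * B) := by gcongr
        _ = _ := by ring
    have b2 : G ≤ D * ((1 + C₂ * C₁) * B) := a3.trans (by gcongr)
    calc F + G ≤ C₁ * B + D * ((1 + C₂ * C₁) * B) := add_le_add a1 b2
      _ = (C₁ + D * (1 + C₂ * C₁)) * B := by ring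
      _ ≤ _ := mul_le_mul_of_nonneg_right (by linarith) hB
  · have h0 : 0 ≤ D * (1 + C₂ * C₁) := by positivity
    calc B ≤ C₄ * G + C₂ * F := hu2.trans (by gcongr)
      _ ≤ (C₁ + D * (1 + C₂ * C₁) + C₄ + C₂ + 1) * G +
          (C₁ + D * (1 + C₂ * C₁) + C₄ + C₂ + 1) * F := by
        gcongr <;> linarith
      _ = _ := by ring

end Estimates

/-! ### Bessel operators on tempered distributions. -/

section Distributions

variable {n : ℕ} {α : ℝ} {p : ℝ≥0∞} [Fact (1 ≤ p)]

theorem continuous_toDistribution :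
    Continuous (toDistribution : Lp ℝ p (volume : Measure (Rn n)) → 𝓢'(Rn n, ℂ)) :=
  (Lp.toTemperedDistributionCLM ℂ (volume : Measure (Rn n)) p).continuous.comp
    (Complex.ofRealCLM.compLpL p (volume : Measure (Rn n))).continuous

theorem toDistribution_injective :
    Function.Injective (toDistribution : Lp ℝ p (volume : Measure (Rn n)) → 𝓢'(Rn n, ℂ)) := by
  intro f g hfg
  have h := LinearMap.ker_eq_bot.1
    (Lp.ker_toTemperedDistributionCLM_eq_bot (F := ℂ) (μ := (volume : Measure (Rn n))) (p := p))
  have h1 : Complex.ofRealCLM.compLp f = Complex.ofRealCLM.compLp g := h hfg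
  refine Lp.ext ?_
  filter_upwards [Complex.ofRealCLM.coeFn_compLp f, Complex.ofRealCLM.coeFn_compLp g] with x h2 h3
  rw [h1] at h2
  exact Complex.ofReal_injective (h2.symm.trans h3)

theorem isRealDistribution_toDistribution (f : Lp ℝ p (volume : Measure (Rn n))) :
    IsRealDistribution (toDistribution f) := by
  intro φ hφ
  have h : toDistribution f φ = ((∫ x, (φ x).re * f x : ℝ) : ℂ) := by
    rw [toDistribution, Lp.toTemperedDistribution_apply, ← integral_complex_ofReal]
    refine integral_congr_ae ?_
    filter_upwards [Complex.ofRealCLM.coeFn_compLp f] with x hx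
    rw [hx]
    apply Complex.ext <;> simp [hφ x]
  rw [h, Complex.ofReal_im]

theorem toDistribution_toLp (f : 𝓢(Rn n, ℝ)) :
    toDistribution (f.toLp p) =
      SchwartzMap.toTemperedDistributionCLM (Rn n) ℂ volume (toComplex f) := by
  have h : Complex.ofRealCLM.compLp (f.toLp p) = (toComplex f).toLp p := by
    refine Lp.ext ?_
    filter_upwards [Complex.ofRealCLM.coeFn_compLp (f.toLp p (volume : Measure (Rn n))),
      f.coeFn_toLp p volume, (toComplex f).coeFn_toLp p volume] with x h1 h2 h3
    rw [h1, h2, h3]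
    rfl
  rw [toDistribution, h, Lp.toTemperedDistribution_toLp_eq]

theorem besselOp_toDistribution_toLp (s : ℝ) (f : 𝓢(Rn n, ℝ)) :
    besselOp n s (toDistribution (f.toLp p)) = toDistribution ((besselR s f).toLp p) := by
  rw [toDistribution_toLp, toDistribution_toLp, toComplex_besselR]
  exact TemperedDistribution.fourierMultiplierCLM_toTemperedDistributionCLM_eq
    (hasTemperateGrowth_besselSymbol s) (toComplex f)

theorem besselSymbol_mul_neg (s : ℝ) :
    (fun ξ : Rn n => ((besselSymbol n s ξ : ℝ) : ℂ)) *
      (fun ξ : Rn n => ((besselSymbol n (-s) ξ : ℝ) : ℂ)) = fun _ => 1 := by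
  funext ξ
  have h : 0 < 1 + ‖(2 * Real.pi) • ξ‖ ^ 2 := by positivity
  rw [Pi.mul_apply, besselSymbol, besselSymbol, ← Complex.ofReal_mul, ← Real.rpow_add h]
  simp [neg_div]

/-- The symbols of orders `s` and `-s` multiply to `1`, so the operator of order `-s` is a left
inverse. -/
theorem besselOp_injective (s : ℝ) : Function.Injective (besselOp n s) := by
  refine Function.LeftInverse.injective (g := besselOp n (-s)) fun T => ?_
  refine (TemperedDistribution.fourierMultiplierCLM_fourierMultiplierCLM_apply
    (hasTemperateGrowth_besselSymbol s) (hasTemperateGrowth_besselSymbol (-s)) T).trans ?_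
  rw [besselSymbol_mul_neg, TemperedDistribution.fourierMultiplierCLM_const]
  simp

theorem besselR_besselR_neg (s : ℝ) (f : 𝓢(Rn n, ℝ)) : besselR s (besselR (-s) f) = f := by
  have h : toComplex (besselR s (besselR (-s) f)) = toComplex f := by
    rw [toComplex_besselR, toComplex_besselR]
    refine (SchwartzMap.fourierMultiplierCLM_fourierMultiplierCLM_apply
      (hasTemperateGrowth_besselSymbol s) (hasTemperateGrowth_besselSymbol (-s)) _).trans ?_
    rw [besselSymbol_mul_neg, SchwartzMap.fourierMultiplierCLM_const]
    simp
  ext x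
  exact Complex.ofReal_injective (congrArg (fun g : 𝓢(Rn n, ℂ) => g x) h)

theorem besselR_sub (s : ℝ) (f g : 𝓢(Rn n, ℝ)) :
    besselR s (f - g) = besselR s f - besselR s g := by
  have h : toComplex (f - g) = toComplex f - toComplex g := map_sub _ f g
  rw [besselR, h, map_sub, map_sub]
  rfl

theorem toLp_sub (f g : 𝓢(Rn n, ℝ)) :
    (f - g).toLp p (volume : Measure (Rn n)) = f.toLp p volume - g.toLp p volume :=
  map_sub (SchwartzMap.toLpCLM ℝ ℝ p (volume : Measure (Rn n))) f g

theorem besselNorm_eq {T : 𝓢'(Rn n, ℂ)} {g : Lp ℝ p (volume : Measure (Rn n))}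
    (h : besselOp n α T = toDistribution g) : besselNorm α p T = ‖g‖ := by
  have hex : ∃ g : Lp ℝ p (volume : Measure (Rn n)), besselOp n α T = toDistribution g := ⟨g, h⟩
  rw [besselNorm, dif_pos hex, toDistribution_injective (hex.choose_spec.symm.trans h)]

end Distributions

/-! ### Passage from Schwartz functions to the full spaces. -/

section Completion

variable {n : ℕ} {α : ℝ} {p : ℝ≥0∞}

theorem isWeakFracGrad_weakFracGrad {f : Lp ℝ p (volume : Measure (Rn n))} (hf : f ∈ S n α p) :
    IsWeakFracGrad α f (weakFracGrad α f) := by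
  obtain ⟨g, hg⟩ := hf
  rwa [weakFracGrad_eq hg]

theorem isWeakFracGrad_lp_sub (hn : 1 ≤ n) (hα0 : 0 < α) (hα1 : α < 1) (hp1 : 1 ≤ p)
    {f g : Lp ℝ p (volume : Measure (Rn n))} (hf : f ∈ S n α p) (hg : g ∈ S n α p) :
    IsWeakFracGrad α (f - g : Lp ℝ p (volume : Measure (Rn n)))
      (weakFracGrad α f - weakFracGrad α g : Lp (Rn n) p (volume : Measure (Rn n))) :=
  ((isWeakFracGrad_weakFracGrad hf).sub hn hα0 hα1 hp1 (Lp.memLp f) (Lp.memLp g)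
    (isWeakFracGrad_weakFracGrad hg)).congr (Lp.coeFn_sub f g).symm (Lp.coeFn_sub _ _).symm

theorem weakFracGrad_sub (hn : 1 ≤ n) (hα0 : 0 < α) (hα1 : α < 1) (hp1 : 1 ≤ p)
    {f g : Lp ℝ p (volume : Measure (Rn n))} (hf : f ∈ S n α p) (hg : g ∈ S n α p) :
    weakFracGrad α (f - g) = weakFracGrad α f - weakFracGrad α g :=
  weakFracGrad_eq (isWeakFracGrad_lp_sub hn hα0 hα1 hp1 hf hg)

variable [Fact (1 ≤ p)]

/-- The weak fractional gradient is a closed operator in `L^p`. -/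
theorem isWeakFracGrad_of_tendsto (hn : 1 ≤ n) (hα0 : 0 < α) (hα1 : α < 1)
    {u : ℕ → Lp ℝ p (volume : Measure (Rn n))} {f : Lp ℝ p (volume : Measure (Rn n))}
    {g : Lp (Rn n) p (volume : Measure (Rn n))} (hu : ∀ k, u k ∈ S n α p)
    (hf : Tendsto u atTop (𝓝 f)) (hg : Tendsto (fun k => weakFracGrad α (u k)) atTop (𝓝 g)) :
    IsWeakFracGrad α f g := by
  refine isWeakFracGrad_of_approx hn hα0 hα1 (Fact.out : 1 ≤ p) (Lp.memLp f) (Lp.memLp g)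
    fun ε hε => ?_
  obtain ⟨k, hk1, hk2⟩ :=
    ((Metric.tendsto_nhds.1 hf ε hε).and (Metric.tendsto_nhds.1 hg ε hε)).exists
  refine ⟨u k, weakFracGrad α (u k), Lp.memLp _, Lp.memLp _, isWeakFracGrad_weakFracGrad (hu k),
    ?_, ?_⟩
  · rw [dist_comm, Lp.dist_def] at hk1
    exact hk1.le
  · rw [dist_comm, Lp.dist_def] at hk2
    exact hk2.le

theorem toLp_mem_S (hn : 1 ≤ n) (hα0 : 0 < α) (hα1 : α < 1) (u : 𝓢(Rn n, ℝ)) :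
    u.toLp p (volume : Measure (Rn n)) ∈ S n α p ∧
      normS α (u.toLp p (volume : Measure (Rn n))) =
        (eLpNorm u p volume).toReal + (eLpNorm (fracGrad α u) p volume).toReal := by
  have h := mem_S_of_isWeakFracGrad (u.coeFn_toLp p volume)
    (memLp_fracGrad hn hα0 hα1 u (Fact.out : 1 ≤ p)) (isWeakFracGrad_schwartz hn hα0 hα1 u)
  rwa [SchwartzMap.norm_toLp] at h

theorem exists_normS_toLp_equiv (hn : 1 ≤ n) (hα0 : 0 < α) (hα1 : α < 1) (hp1 : 1 < p)
    (hp : p ≠ ⊤) :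
    ∃ C : ℝ, 0 < C ∧ ∀ u : 𝓢(Rn n, ℝ),
      normS α (u.toLp p (volume : Measure (Rn n))) ≤
        C * ‖(besselR α u).toLp p (volume : Measure (Rn n))‖ ∧
      ‖(besselR α u).toLp p (volume : Measure (Rn n))‖ ≤
        C * normS α (u.toLp p (volume : Measure (Rn n))) := by
  obtain ⟨C, hC, h⟩ := exists_schwartz_norm_equiv hn hα0 hα1 hp1 hp
  refine ⟨C, hC, fun u => ?_⟩
  rw [(toLp_mem_S hn hα0 hα1 u).2, SchwartzMap.norm_toLp]
  exact h u

/-- Schwartz functions approximate `S^{α,p}` in the graph norm. -/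
theorem exists_seq_toLp_tendsto (hn : 1 ≤ n) (hα0 : 0 < α) (hα1 : α < 1) (hp : p ≠ ⊤)
    {f : Lp ℝ p (volume : Measure (Rn n))} (hf : f ∈ S n α p) :
    ∃ u : ℕ → 𝓢(Rn n, ℝ), Tendsto (fun k => (u k).toLp p (volume : Measure (Rn n))) atTop (𝓝 f) ∧
      Tendsto (fun k => weakFracGrad α ((u k).toLp p (volume : Measure (Rn n)))) atTop
        (𝓝 (weakFracGrad α f)) := by
  have key : ∀ k : ℕ, ∃ u : 𝓢(Rn n, ℝ),
      dist (u.toLp p (volume : Measure (Rn n))) f ≤ 1 / ((k : ℝ) + 1) ∧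
      dist (weakFracGrad α (u.toLp p (volume : Measure (Rn n)))) (weakFracGrad α f) ≤
        1 / ((k : ℝ) + 1) := by
    intro k
    have hε : 0 < 1 / ((k : ℝ) + 1) := by positivity
    obtain ⟨u, gu, hu, huc, hgu, hw, h1, h2⟩ := exists_test_approx hn hα0 hα1
      (Fact.out : 1 ≤ p) hp (Lp.memLp f) (Lp.memLp _) (isWeakFracGrad_weakFracGrad hf) hε
    refine ⟨huc.toSchwartzMap hu, ?_, ?_⟩
    · rw [dist_comm, Lp.dist_def]
      refine ENNReal.toReal_le_of_le_ofReal hε.le (le_of_eq_of_le (eLpNorm_congr_ae ?_) h1)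
      filter_upwards [(huc.toSchwartzMap hu).coeFn_toLp p volume] with x hx
      rw [Pi.sub_apply, Pi.sub_apply, hx]
      rfl
    · have h3 := isWeakFracGrad_weakFracGrad
        (toLp_mem_S (p := p) hn hα0 hα1 (huc.toSchwartzMap hu)).1
      have h4 := (h3.congr ((huc.toSchwartzMap hu).coeFn_toLp p volume) EventuallyEq.rfl).ae_eq hw
      rw [dist_comm, Lp.dist_def]
      refine ENNReal.toReal_le_of_le_ofReal hε.le (le_of_eq_of_le (eLpNorm_congr_ae ?_) h2)
      filter_upwards [h4] with x hx
      rw [Pi.sub_apply, Pi.sub_apply, hx]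
  choose u hu1 hu2 using key
  exact ⟨u, tendsto_iff_dist_tendsto_zero.2 (squeeze_zero (fun _ => dist_nonneg) hu1
      tendsto_one_div_add_atTop_nhds_zero_nat),
    tendsto_iff_dist_tendsto_zero.2 (squeeze_zero (fun _ => dist_nonneg) hu2
      tendsto_one_div_add_atTop_nhds_zero_nat)⟩

theorem tendsto_normS {u : ℕ → Lp ℝ p (volume : Measure (Rn n))}
    {f : Lp ℝ p (volume : Measure (Rn n))} (hf : Tendsto u atTop (𝓝 f))
    (hg : Tendsto (fun k => weakFracGrad α (u k)) atTop (𝓝 (weakFracGrad α f))) :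
    Tendsto (fun k => normS α (u k)) atTop (𝓝 (normS α f)) :=
  hf.norm.add hg.norm

/-- `L^p` convergence implies convergence of tempered distributions, on which the Bessel operator is
continuous. -/
theorem besselOp_toDistribution_of_tendsto {s : ℝ} {u : ℕ → 𝓢(Rn n, ℝ)}
    {f g : Lp ℝ p (volume : Measure (Rn n))}
    (hf : Tendsto (fun k => (u k).toLp p (volume : Measure (Rn n))) atTop (𝓝 f))
    (hg : Tendsto (fun k => (besselR s (u k)).toLp p (volume : Measure (Rn n))) atTop (𝓝 g)) :
    besselOp n s (toDistribution f) = toDistribution g := by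
  have h1 := (((besselOp n s).continuous.comp continuous_toDistribution).tendsto f).comp hf
  have h2 := (continuous_toDistribution.tendsto g).comp hg
  refine tendsto_nhds_unique h1 (h2.congr fun k => ?_)
  exact (besselOp_toDistribution_toLp s (u k)).symm

/-- Along Schwartz functions converging to `f` in the graph norm, the a priori bound makes the
Bessel images Cauchy in `L^p`; their limit is the required `g`. -/
theorem exists_besselOp_eq_of_mem_S (hn : 1 ≤ n) (hα0 : 0 < α) (hα1 : α < 1) (hp : p ≠ ⊤)
    {C : ℝ} (hC : ∀ u : 𝓢(Rn n, ℝ), ‖(besselR α u).toLp p (volume : Measure (Rn n))‖ ≤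
        C * normS α (u.toLp p (volume : Measure (Rn n))))
    {f : Lp ℝ p (volume : Measure (Rn n))} (hf : f ∈ S n α p) :
    ∃ g : Lp ℝ p (volume : Measure (Rn n)),
      besselOp n α (toDistribution f) = toDistribution g ∧ ‖g‖ ≤ C * normS α f := by
  obtain ⟨u, hu1, hu2⟩ := exists_seq_toLp_tendsto hn hα0 hα1 hp hf
  have hd : Tendsto (fun kl : ℕ × ℕ => C *
      (dist ((u kl.1).toLp p (volume : Measure (Rn n))) ((u kl.2).toLp p) +
        dist (weakFracGrad α ((u kl.1).toLp p (volume : Measure (Rn n))))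
          (weakFracGrad α ((u kl.2).toLp p)))) atTop (𝓝 0) := by
    have h1 := cauchySeq_iff_tendsto_dist_atTop_0.1 hu1.cauchySeq
    have h2 := cauchySeq_iff_tendsto_dist_atTop_0.1 hu2.cauchySeq
    simpa using (h1.add h2).const_mul C
  have hc : CauchySeq fun k => (besselR α (u k)).toLp p (volume : Measure (Rn n)) := by
    refine cauchySeq_iff_tendsto_dist_atTop_0.2
      (squeeze_zero (fun _ => dist_nonneg) (fun kl => ?_) hd)
    -- The bound is applied to differences, since both operators are linear.
    have h := hC (u kl.1 - u kl.2)
    rw [besselR_sub, toLp_sub, toLp_sub, normS, weakFracGrad_sub hn hα0 hα1 Fact.out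
      (toLp_mem_S hn hα0 hα1 _).1 (toLp_mem_S hn hα0 hα1 _).1] at h
    rwa [dist_eq_norm, dist_eq_norm, dist_eq_norm]
  obtain ⟨g, hg⟩ := cauchySeq_tendsto_of_complete hc
  exact ⟨g, besselOp_toDistribution_of_tendsto hu1 hg,
    le_of_tendsto_of_tendsto' hg.norm ((tendsto_normS hu1 hu2).const_mul C) fun k => hC (u k)⟩

/-- Approximate `g` by Schwartz functions and invert the Bessel operator on them. The a priori bound
makes the preimages and their gradients Cauchy, and closedness of `∇^α` identifies the limit. -/
theorem exists_mem_S_besselOp_eq (hn : 1 ≤ n) (hα0 : 0 < α) (hα1 : α < 1) (hp : p ≠ ⊤)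
    {C : ℝ} (hC : ∀ u : 𝓢(Rn n, ℝ), normS α (u.toLp p (volume : Measure (Rn n))) ≤
        C * ‖(besselR α u).toLp p (volume : Measure (Rn n))‖)
    (g : Lp ℝ p (volume : Measure (Rn n))) :
    ∃ f ∈ S n α p, besselOp n α (toDistribution f) = toDistribution g ∧ normS α f ≤ C * ‖g‖ := by
  obtain ⟨v, hv, hvg⟩ := mem_closure_iff_seq_limit.1
    (SchwartzMap.denseRange_toLpCLM (F := ℝ) hp (μ := (volume : Measure (Rn n))) g)
  choose w hw using hv
  set u : ℕ → 𝓢(Rn n, ℝ) := fun k => besselR (-α) (w k) with hu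
  have hb : Tendsto (fun k => (besselR α (u k)).toLp p (volume : Measure (Rn n))) atTop (𝓝 g) := by
    refine hvg.congr fun k => ?_
    rw [hu, besselR_besselR_neg, ← hw k]
    rfl
  have hd : Tendsto (fun kl : ℕ × ℕ => C *
      dist ((besselR α (u kl.1)).toLp p (volume : Measure (Rn n))) ((besselR α (u kl.2)).toLp p))
      atTop (𝓝 0) := by
    simpa using (cauchySeq_iff_tendsto_dist_atTop_0.1 hb.cauchySeq).const_mul C
  have hle : ∀ kl : ℕ × ℕ,
      dist ((u kl.1).toLp p (volume : Measure (Rn n))) ((u kl.2).toLp p) +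
        dist (weakFracGrad α ((u kl.1).toLp p (volume : Measure (Rn n))))
          (weakFracGrad α ((u kl.2).toLp p)) ≤
      C * dist ((besselR α (u kl.1)).toLp p (volume : Measure (Rn n)))
        ((besselR α (u kl.2)).toLp p) := by
    intro kl
    have h := hC (u kl.1 - u kl.2)
    rw [besselR_sub, toLp_sub, toLp_sub, normS, weakFracGrad_sub hn hα0 hα1 Fact.out
      (toLp_mem_S hn hα0 hα1 _).1 (toLp_mem_S hn hα0 hα1 _).1] at h
    rwa [dist_eq_norm, dist_eq_norm, dist_eq_norm]
  have hcf : CauchySeq fun k => (u k).toLp p (volume : Measure (Rn n)) :=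
    cauchySeq_iff_tendsto_dist_atTop_0.2 (squeeze_zero (fun _ => dist_nonneg)
      (fun kl => (le_add_of_nonneg_right dist_nonneg).trans (hle kl)) hd)
  have hcG : CauchySeq fun k => weakFracGrad α ((u k).toLp p (volume : Measure (Rn n))) :=
    cauchySeq_iff_tendsto_dist_atTop_0.2 (squeeze_zero (fun _ => dist_nonneg)
      (fun kl => (le_add_of_nonneg_left dist_nonneg).trans (hle kl)) hd)
  obtain ⟨f, hf⟩ := cauchySeq_tendsto_of_complete hcf
  obtain ⟨G, hG⟩ := cauchySeq_tendsto_of_complete hcG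
  have hw := isWeakFracGrad_of_tendsto hn hα0 hα1 (fun k => (toLp_mem_S hn hα0 hα1 (u k)).1) hf hG
  refine ⟨f, ⟨G, hw⟩, besselOp_toDistribution_of_tendsto hf hb,
    le_of_tendsto_of_tendsto' (tendsto_normS hf ?_) (hb.norm.const_mul C) fun k => hC (u k)⟩
  rwa [weakFracGrad_eq hw]

/-- For `1 < p < ∞` the space `S^{α,p}` is the Bessel potential space, with equivalent norms. -/
theorem image_S_eq_besselSpace (hn : 1 ≤ n) (hα0 : 0 < α) (hα1 : α < 1) (hp : p ≠ ⊤)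
    (hp1 : 1 < p) :
    toDistribution '' S n α p = besselSpace n α p ∧
      ∃ c C : ℝ, 0 < c ∧ 0 < C ∧ ∀ f ∈ S n α p,
        c * besselNorm α p (toDistribution f) ≤ normS α f ∧
        normS α f ≤ C * besselNorm α p (toDistribution f) := by
  obtain ⟨C, hC, h⟩ := exists_normS_toLp_equiv (n := n) hn hα0 hα1 hp1 hp
  have hS := fun f (hf : f ∈ S n α p) =>
    exists_besselOp_eq_of_mem_S hn hα0 hα1 hp (fun u => (h u).2) hf
  have hB := exists_mem_S_besselOp_eq hn hα0 hα1 hp (fun u => (h u).1)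
  refine ⟨Set.Subset.antisymm ?_ ?_, C⁻¹, C, inv_pos.2 hC, hC, fun f hf => ?_⟩
  · rintro _ ⟨f, hf, rfl⟩
    obtain ⟨g, hg, -⟩ := hS f hf
    exact ⟨isRealDistribution_toDistribution f, g, hg⟩
  · rintro T ⟨-, g, hg⟩
    obtain ⟨f, hf, hfg, -⟩ := hB g
    -- The given `T` and the constructed `f` have the same Bessel image, hence they coincide.
    exact ⟨f, hf, besselOp_injective α (hfg.trans hg.symm)⟩
  · obtain ⟨g, hg, hle⟩ := hS f hf
    obtain ⟨f', -, hfg, hle'⟩ := hB g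
    -- Solving for the Bessel image `g` of `f` returns `f` itself, so the bound for the constructed
    -- function is the upper bound for `f`.
    obtain rfl : f' = f := toDistribution_injective (besselOp_injective α (hfg.trans hg.symm))
    rw [besselNorm_eq hg]
    exact ⟨(inv_mul_le_iff₀ hC).2 hle, hle'⟩

end Completion

end FracSobolev

theorem mainTheorem6 (n : ℕ) (hn : 1 ≤ n) (α : ℝ) (hα0 : 0 < α) (hα1 : α < 1)
    (p : ℝ≥0∞) [Fact (1 ≤ p)] (hp : p ≠ ⊤) :
    -- `C_c^∞(ℝⁿ)` is a dense subset of `S^{α,p}(ℝⁿ)`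
    (FracSobolev.testFunctions n p ⊆ FracSobolev.S n α p ∧
      ∀ f ∈ FracSobolev.S n α p, ∀ ε : ℝ, 0 < ε →
        ∃ u ∈ FracSobolev.testFunctions n p,
          f - u ∈ FracSobolev.S n α p ∧ FracSobolev.normS α (f - u) < ε) ∧
    -- `S^{α,p}(ℝⁿ) = L^{α,p}(ℝⁿ)` for `p > 1`, with equivalent norms
    (1 < p →
      FracSobolev.toDistribution '' FracSobolev.S n α p = FracSobolev.besselSpace n α p ∧
      ∃ c C : ℝ, 0 < c ∧ 0 < C ∧ ∀ f ∈ FracSobolev.S n α p,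
        c * FracSobolev.besselNorm α p (FracSobolev.toDistribution f) ≤ FracSobolev.normS α f ∧
        FracSobolev.normS α f ≤
          C * FracSobolev.besselNorm α p (FracSobolev.toDistribution f)) := by
  have hp1 : 1 ≤ p := Fact.out
  exact ⟨⟨FracSobolev.testFunctions_subset_S hn hα0 hα1 hp1, fun f hf ε hε =>
      FracSobolev.exists_testFunction_normS_lt hn hα0 hα1 hp1 hp hf hε⟩,
    FracSobolev.image_S_eq_besselSpace hn hα0 hα1 hp⟩
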